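/- Let $M\ge 1$ be an integer, let $\mathcal A$ be a finite alphabet, and let $(p_\alpha)_{\alpha\in\mathcal A}$ satisfy $0<p_\alpha<1$, $\sum_{\alpha}p_\alpha=1$ and $\sum_{\alpha}p_\alpha^2<\frac1M$ (the non-explosive case). A labeling assigns a letter of $\mathcal A$ to every edge of the rooted infinite $M$-ary tree (in which the $M$ children of every vertex are distinguished). The G-trie built from $n$ labelings consists of all pairs of a finite path in the $M$-ary tree starting at the root (the empty path included) and a sequence of letters on its edges, such that the path carries exactly these letters in at least two of the $n$ labelings. For each $n$, let $S_n$ be the size, i.e. the number of these (internal) nodes, of the G-trie built from $n$ random labelings, all of whose letters are independent and equal to $\alpha$ with probability $p_\alpha$. Then $S_n$ is almost surely finite with finite second moment for every $n$, $\mathrm{Var}(S_n)>0$ for $n\ge 2$, and \[ \frac{S_n-\mathbb E(S_n)}{\sqrt{\mathrm{Var}(S_n)}}\stackrel{d}{\longrightarrow}N(0,1)\qquad(n\to\infty), \] where $N(0,1)$ is the standard normal distribution. This covers both the uniform case ($p_\alpha=1/|\mathcal A|$ for all $\alpha$) and the non-uniform case. -/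

import Mathlib

open MeasureTheory ProbabilityTheory Filter

namespace GTrie

/-- Edges of the rooted infinite `M`-ary tree. A vertex is the word of the directions (in `Fin M`)
that lead to it from the root `[]`; the edge `(v, i)` joins `v` to its `i`-th child `v ++ [i]`. -/
abbrev Edge (M : ℕ) : Type := List (Fin M) × Fin M

/-- An (edge) labeling of the `M`-ary tree with letters from the alphabet `𝒜`. -/
abbrev Labeling (M : ℕ) (𝒜 : Type*) : Type _ := Edge M → 𝒜

/-- The labeling induced on the subtree that is rooted at the `i`-th child of the root. -/
def Labeling.sub {M : ℕ} {𝒜 : Type*} (L : Labeling M 𝒜) (i : Fin M) : Labeling M 𝒜 :=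
  fun e => L (i :: e.1, e.2)

/-- A node `(i₁, a₁), …, (iₗ, aₗ)` of the rooted infinite `M × A`-ary tree is a path of length `l`
in the `M`-ary tree, starting at the root and taking the directions `i₁, …, iₗ`, together with
letters `a₁, …, aₗ` on its edges. It occurs in the labeling `L` if `L` puts exactly these letters
on the edges of this path. -/
def Occurs {M : ℕ} {𝒜 : Type*} : Labeling M 𝒜 → List (Fin M × 𝒜) → Prop
  | _, [] => True
  | L, (i, a) :: w => L ([], i) = a ∧ Occurs (L.sub i) w

/-- The (internal) nodes of the G-trie built from the labelings `L 0, …, L (n - 1)`: the labeled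
paths that occur in at least two of them. -/
def nodes {M n : ℕ} {𝒜 : Type*} (L : Fin n → Labeling M 𝒜) : Set (List (Fin M × 𝒜)) :=
  {w | ∃ k l : Fin n, k ≠ l ∧ Occurs (L k) w ∧ Occurs (L l) w}

/-- The size of the G-trie: the number of its internal nodes. (`Set.ncard` gives `0` when there are
infinitely many nodes.) -/
noncomputable def size {M n : ℕ} {𝒜 : Type*} (L : Fin n → Labeling M 𝒜) : ℕ :=
  (nodes L).ncard

/-- `X k e` is the random letter that the `k`-th labeling puts on the edge `e`: all letters, of all
the labelings, are independent, and each of them equals the letter `a` with probability `p a`. -/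
structure IsRandomLabelings {M n : ℕ} {𝒜 : Type*} [MeasurableSpace 𝒜] (p : 𝒜 → ℝ)
    {Ω : Type*} [MeasurableSpace Ω] (X : Fin n → Edge M → Ω → 𝒜) (μ : Measure Ω) : Prop where
  measurable : ∀ k e, Measurable (X k e)
  indep : iIndepFun (fun (ke : Fin n × Edge M) => X ke.1 ke.2) μ
  law : ∀ k e a, μ.real {ω | X k e ω = a} = p a

/-- The size of the G-trie built from the random labelings `X`, as a real random variable. -/
noncomputable def randomSize {M n : ℕ} {𝒜 Ω : Type*} (X : Fin n → Edge M → Ω → 𝒜) (ω : Ω) : ℝ :=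
  (size fun k e => X k e ω : ℝ)

end GTrie

/-! Split the `n` labelings according to their letters on one edge at the root. The group sizes are
multinomial, and given these sizes the subtries are independent G-tries; the `M` edges give
independent branches. Hence the mean, the variance and the characteristic function of the number of
nodes at depth `< h` solve explicit recursions in `h`. All estimates concern these recursions, with
constants that do not depend on `h`. Only at the end does `h` tend to infinity, by monotone and
dominated convergence.

The engine is `le_of_contraction`. Thinning a count `n` to a binomial one with parameter `p a`
multiplies a power `n ^ y` (suitably modified) by at most `p a ^ y` as long as `y ≤ 2`, so a
recursive bound with a toll of order `n ^ y` closes as soon as `M * ∑ a, p a ^ y < 1`.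
Non-explosiveness says that this holds at `y = 2`; it then holds for all `y` above a critical
exponent `ρ < 2` with `M * ∑ a, p a ^ ρ = 1` (`exists_critical_exponent`). The contraction controls
the first and second differences of the mean in `n`, then the differences of the variance.

Gaussian comparison: given the letters on a root edge, the conditional mean of the branch is a
linear function of the letter counts plus a remainder that is small because the second differences
are small, and the conditional variance is concentrated. The linear part is a sum of independent
terms, hence nearly Gaussian. Replacing one level by a Gaussian thus costs a small toll
(`norm_levelToll_le`), and the distance `gaussDist` to the Gaussian characteristic function with the
same variance again solves a contracting recursion. The result (`gaussDist_le`) is an error `|t| ^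
(2 + θ) * n ^ x + |t| ^ 3 * n ^ z`. The gain `θ` is needed because contraction forces `x > ρ`, while
the variance may be only of order `n ^ ρ`. It comes from interpolating with a crude third-order
bound.

The error vanishes at `t = u / √Var` once the variance is at least of order `n ^ α` with `x < α * (1
+ θ / 2)` and `z < 3 / 2 * α`. In general `α = ρ` is available (`exists_rpow_le_varSize`). If the
numbers `M * p a ^ (ρ - 1)` are not all `1`, the letters near the root cause larger fluctuations,
and Cauchy–Schwarz against an additive statistic of these letters gives `α = 2 * ρ - 1`
(`exists_rpow_le_varSize_of_ne`). If they are all `1` and `ρ > 1`, then `p` is uniform, the linear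
part is constant, and the error is small enough for `α = ρ`. If `ρ = 1`, the two exponents agree. -/

namespace GTrie

/-! ### Binomial expectations -/

/-- The expectation of `g N` for a binomial random variable `N` with `n` trials and success
probability `q`. -/
noncomputable def binom (q : ℝ) : ℕ → (ℕ → ℝ) → ℝ
  | 0, g => g 0
  | n + 1, g => (1 - q) * binom q n g + q * binom q n (fun k => g (k + 1))

section Binomial

variable {q : ℝ}

lemma binom_zero (g : ℕ → ℝ) : binom q 0 g = g 0 := rfl

lemma binom_succ (n : ℕ) (g : ℕ → ℝ) :
    binom q (n + 1) g = (1 - q) * binom q n g + q * binom q n (fun k => g (k + 1)) := rfl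

lemma binom_add (n : ℕ) (f g : ℕ → ℝ) :
    binom q n (fun k => f k + g k) = binom q n f + binom q n g := by
  induction n generalizing f g with
  | zero => rfl
  | succ n ih => rw [binom_succ, binom_succ, binom_succ, ih, ih (fun k => f (k + 1))]; ring

lemma binom_const_mul (n : ℕ) (r : ℝ) (g : ℕ → ℝ) :
    binom q n (fun k => r * g k) = r * binom q n g := by
  induction n generalizing g with
  | zero => rfl
  | succ n ih => rw [binom_succ, binom_succ, ih, ih (fun k => g (k + 1))]; ring

lemma binom_const (n : ℕ) (r : ℝ) : binom q n (fun _ => r) = r := by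
  induction n with
  | zero => rfl
  | succ n ih => rw [binom_succ, ih]; ring

lemma binom_sub (n : ℕ) (f g : ℕ → ℝ) :
    binom q n (fun k => f k - g k) = binom q n f - binom q n g := by
  have := binom_add (q := q) n f (fun k => (-1) * g k)
  rw [binom_const_mul] at this
  simp only [neg_mul, one_mul, ← sub_eq_add_neg] at this
  exact this

lemma binom_mono (h0 : 0 ≤ q) (h1 : q ≤ 1) (n : ℕ) {f g : ℕ → ℝ}
    (hfg : ∀ k ≤ n, f k ≤ g k) : binom q n f ≤ binom q n g := by
  induction n generalizing f g with
  | zero => exact hfg 0 le_rfl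
  | succ n ih =>
    rw [binom_succ, binom_succ]
    have h2 : 0 ≤ 1 - q := by linarith
    gcongr
    · exact ih fun k hk => hfg k (by omega)
    · exact ih fun k hk => hfg (k + 1) (by omega)

lemma binom_congr (n : ℕ) {f g : ℕ → ℝ}
    (hfg : ∀ k ≤ n, f k = g k) : binom q n f = binom q n g := by
  induction n generalizing f g with
  | zero => exact hfg 0 le_rfl
  | succ n ih =>
    rw [binom_succ, binom_succ, ih fun k hk => hfg k (by omega),
      ih fun k hk => hfg (k + 1) (by omega)]

lemma binom_nonneg (h0 : 0 ≤ q) (h1 : q ≤ 1) (n : ℕ) {f : ℕ → ℝ}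
    (hf : ∀ k ≤ n, 0 ≤ f k) : 0 ≤ binom q n f := by
  have := binom_mono h0 h1 n (f := fun _ => 0) (g := f) hf
  rwa [binom_const] at this

lemma abs_binom_le (h0 : 0 ≤ q) (h1 : q ≤ 1) (n : ℕ) (f : ℕ → ℝ) :
    |binom q n f| ≤ binom q n (fun k => |f k|) := by
  rw [abs_le]
  constructor
  · have := binom_mono h0 h1 n (f := fun k => (-1) * |f k|) (g := f)
      fun k _ => by have := neg_abs_le (f k); linarith
    rw [binom_const_mul] at this
    linarith
  · exact binom_mono h0 h1 n fun k _ => le_abs_self _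

lemma binom_succ_sub (n : ℕ) (g : ℕ → ℝ) :
    binom q (n + 1) g - binom q n g = q * binom q n (fun k => g (k + 1) - g k) := by
  rw [binom_sub, binom_succ]; ring

/-- Size-biasing of the binomial distribution. -/
lemma binom_id_mul (n : ℕ) (g : ℕ → ℝ) :
    binom q (n + 1) (fun k => k * g k) = (n + 1) * q * binom q n (fun k => g (k + 1)) := by
  induction n generalizing g with
  | zero => simp [binom_succ, binom_zero]
  | succ n ih =>
    rw [binom_succ, ih]
    have h1 : (fun k : ℕ => ((k + 1 : ℕ) : ℝ) * g (k + 1))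
        = fun k : ℕ => (k : ℝ) * (fun j => g (j + 1)) k + g (k + 1) := by
      ext k; push_cast; ring
    rw [h1, binom_add, ih, binom_succ n (fun k => g (k + 1))]
    push_cast
    ring

lemma binom_id (n : ℕ) : binom q n (fun k => (k : ℝ)) = n * q := by
  cases n with
  | zero => simp [binom_zero]
  | succ n =>
    have := binom_id_mul (q := q) n (fun _ => 1)
    rw [binom_const] at this
    simpa using this

/-- Thinning a binomial random variable. -/
lemma binom_binom (r : ℝ) (n : ℕ) (g : ℕ → ℝ) :
    binom q n (fun k => binom r k g) = binom (q * r) n g := by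
  induction n generalizing g with
  | zero => rfl
  | succ n ih =>
    rw [binom_succ, ih, binom_succ n g]
    simp only [binom_succ]
    rw [binom_add, binom_const_mul, binom_const_mul, ih, ih]
    ring

lemma binom_one (n : ℕ) (g : ℕ → ℝ) : binom 1 n g = g n := by
  induction n generalizing g with
  | zero => rfl
  | succ n ih => rw [binom_succ, ih, ih]; ring

/-- A concave power lies below its tangent at `c`; this is weighted AM–GM for `x / c` and `1`. -/
lemma rpow_le_tangent {x c θ : ℝ} (hx : 0 ≤ x) (hc : 0 < c) (h0 : 0 ≤ θ) (h1 : θ ≤ 1) :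
    x ^ θ ≤ (1 - θ) * c ^ θ + θ * c ^ (θ - 1) * x := by
  have := Real.geom_mean_le_arith_mean2_weighted h0 (sub_nonneg.2 h1)
    (p₁ := x / c) (p₂ := 1) (by positivity) zero_le_one (by ring)
  rw [Real.one_rpow, mul_one, mul_one, Real.div_rpow hx hc.le] at this
  have hcθ : 0 < c ^ θ := Real.rpow_pos_of_pos hc _
  rw [div_le_iff₀ hcθ] at this
  rw [Real.rpow_sub_one hc.ne']
  calc x ^ θ ≤ _ := this
    _ = _ := by field_simp; ring

/-- Jensen's inequality for the concave function `x ↦ x ^ θ`. -/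
lemma binom_rpow_le (h0 : 0 ≤ q) (h1 : q ≤ 1) (n : ℕ) {g : ℕ → ℝ} (hg : ∀ k, 0 ≤ g k)
    {θ : ℝ} (hθ0 : 0 ≤ θ) (hθ1 : θ ≤ 1) {c : ℝ} (hc : 0 < c) (hgc : binom q n g ≤ c) :
    binom q n (fun k => g k ^ θ) ≤ c ^ θ := by
  calc binom q n (fun k => g k ^ θ)
      ≤ binom q n (fun k => (1 - θ) * c ^ θ + θ * c ^ (θ - 1) * g k) :=
        binom_mono h0 h1 n fun k _ => rpow_le_tangent (hg k) hc hθ0 hθ1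
    _ = (1 - θ) * c ^ θ + θ * c ^ (θ - 1) * binom q n g := by
        rw [binom_add, binom_const, binom_const_mul]
    _ ≤ (1 - θ) * c ^ θ + θ * c ^ (θ - 1) * c := by gcongr
    _ = c ^ θ := by rw [Real.rpow_sub_one hc.ne']; field_simp; ring

/-- Size-biasing turns the left side, times `(n + 1) * q`, into the probability that a binomial
variable with `n + 1` trials is nonzero. -/
lemma binom_inv_le (h0 : 0 < q) (h1 : q ≤ 1) (n : ℕ) :
    binom q n (fun k => ((k : ℝ) + 1)⁻¹) ≤ (((n : ℝ) + 1) * q)⁻¹ := by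
  have h := binom_id_mul (q := q) n (fun k => (k : ℝ)⁻¹)
  have h2 : binom q (n + 1) (fun k => (k : ℝ) * (k : ℝ)⁻¹) ≤ 1 := by
    rw [← binom_const (q := q) (n + 1) 1]
    exact binom_mono h0.le h1 _ fun k _ => mul_inv_le_one
  rw [h] at h2
  rw [le_inv_comm₀, ← one_div, le_div_iff₀]
  · simpa using h2
  all_goals
    first
    | positivity
    | skip
  -- The remaining side goals ask for positivity of the expectation, which is at least its smallest
  -- value `(n + 1)⁻¹`.
  all_goals
    refine lt_of_lt_of_le (b := ((n : ℝ) + 1)⁻¹) (by positivity) ?_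
    rw [← binom_const (q := q) n ((n : ℝ) + 1)⁻¹]
    refine binom_mono h0.le h1 _ fun k hk => ?_
    gcongr

lemma binom_rpow_neg_le (h0 : 0 < q) (h1 : q ≤ 1) (n : ℕ) {s : ℝ} (hs0 : 0 ≤ s) (hs1 : s ≤ 1) :
    binom q n (fun k => ((k : ℝ) + 1) ^ (-s)) ≤ q ^ (-s) * ((n : ℝ) + 1) ^ (-s) := by
  have h := binom_rpow_le h0.le h1 n (g := fun k => ((k : ℝ) + 1)⁻¹) (fun k => by positivity)
    hs0 hs1 (c := (((n : ℝ) + 1) * q)⁻¹) (by positivity) (binom_inv_le h0 h1 n)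
  rw [Real.inv_rpow (by positivity), ← Real.rpow_neg (by positivity),
    Real.mul_rpow (by positivity) h0.le, mul_comm] at h
  refine le_trans (le_of_eq ?_) h
  refine binom_congr _ fun k _ => ?_
  rw [Real.inv_rpow (by positivity), ← Real.rpow_neg (by positivity)]

/-- For `θ ≤ 1` this is Jensen's inequality. For `θ ≥ 1` it only uses `k ^ θ ≤ n ^ (θ - 1) * k`, so
that no more than one factor `q` is gained. There is no multiplicative constant, as a contraction
argument requires. -/
lemma binom_natCast_rpow_le (h0 : 0 < q) (h1 : q ≤ 1) (n : ℕ) {θ : ℝ} (hθ : 0 ≤ θ) :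
    binom q n (fun k => (k : ℝ) ^ θ) ≤ q ^ (min θ 1) * (n : ℝ) ^ θ := by
  rcases Nat.eq_zero_or_pos n with rfl | hn
  · rw [binom_zero]
    rcases hθ.eq_or_lt with rfl | hθ
    · simp
    · simp [Real.zero_rpow hθ.ne']
  have hn' : (0 : ℝ) < n := by exact_mod_cast hn
  rcases le_total θ 1 with h | h
  · rw [min_eq_left h, mul_comm, ← Real.mul_rpow hn'.le h0.le]
    exact binom_rpow_le h0.le h1 n (fun k => by positivity) hθ h (by positivity) (binom_id n).le
  · rw [min_eq_right h, Real.rpow_one]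
    calc binom q n (fun k => (k : ℝ) ^ θ) ≤ binom q n (fun k => (n : ℝ) ^ (θ - 1) * k) := by
          refine binom_mono h0.le h1 n fun k hk => ?_
          rcases Nat.eq_zero_or_pos k with rfl | hk0
          · simp [Real.zero_rpow (by linarith : θ ≠ 0)]
          have hk' : (0 : ℝ) < k := by exact_mod_cast hk0
          rw [← sub_add_cancel θ 1, Real.rpow_add_one hk'.ne', sub_add_cancel]
          have : (k : ℝ) ≤ n := by exact_mod_cast hk
          gcongr
      _ = q * (n : ℝ) ^ θ := by
          rw [binom_const_mul, binom_id, Real.rpow_sub_one hn'.ne']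
          field_simp

/-- The function `n (n - 1) ^ (y - 1)`, a version of `n ^ y` that vanishes at `0` and `1` and is
contracted by thinning. -/
noncomputable def fallPow (y : ℝ) (n : ℕ) : ℝ := n * (((n - 1 : ℕ) : ℝ)) ^ (y - 1)

lemma fallPow_nonneg (y : ℝ) (n : ℕ) : 0 ≤ fallPow y n := by
  unfold fallPow; positivity

/-- Size-biasing takes out the factor `n` and leaves the power `y - 1`, to which
`binom_natCast_rpow_le` applies. A plain power `n ^ y` with `1 < y ≤ 2` would not be contracted by
exactly `q ^ y`, because of lower-order terms. -/
lemma binom_fallPow_le (h0 : 0 < q) (h1 : q ≤ 1) (n : ℕ) {y : ℝ} (hy : 1 ≤ y) :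
    binom q n (fallPow y) ≤ q ^ (min y 2) * fallPow y n := by
  cases n with
  | zero => simp [binom_zero, fallPow]
  | succ n =>
    unfold fallPow
    rw [binom_id_mul n (fun k => (((k - 1 : ℕ) : ℝ)) ^ (y - 1))]
    simp only [Nat.add_sub_cancel]
    have h := binom_natCast_rpow_le h0 h1 n (θ := y - 1) (by linarith)
    have h2 : q ^ (min y 2) = q * q ^ (min (y - 1) 1) := by
      rw [mul_comm, ← Real.rpow_add_one h0.ne', ← min_add_add_right]
      norm_num
    rw [h2]
    calc ((n : ℝ) + 1) * q * binom q n (fun k => (k : ℝ) ^ (y - 1))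
        ≤ ((n : ℝ) + 1) * q * (q ^ (min (y - 1) 1) * (n : ℝ) ^ (y - 1)) := by gcongr
      _ = _ := by push_cast; ring

lemma fallPow_le (y : ℝ) (hy : 1 ≤ y) (n : ℕ) : fallPow y n ≤ (n : ℝ) ^ y := by
  unfold fallPow
  rcases Nat.eq_zero_or_pos n with rfl | hn
  · simp [Real.zero_rpow (by linarith : y ≠ 0)]
  have hn' : (0 : ℝ) < n := by exact_mod_cast hn
  calc (n : ℝ) * (((n - 1 : ℕ) : ℝ)) ^ (y - 1) ≤ n * (n : ℝ) ^ (y - 1) := by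
        gcongr
        omega
    _ = (n : ℝ) ^ y := by rw [mul_comm, ← Real.rpow_add_one hn'.ne']; simp

lemma rpow_le_fallPow (y : ℝ) (hy : 1 ≤ y) (n : ℕ) (hn : 2 ≤ n) :
    (n : ℝ) ^ y ≤ 2 ^ (y - 1) * fallPow y n := by
  unfold fallPow
  have hn' : (0 : ℝ) < n := by exact_mod_cast (by omega : 0 < n)
  have h2 : (n : ℝ) ≤ 2 * ((n - 1 : ℕ) : ℝ) := by exact_mod_cast (by omega : n ≤ 2 * (n - 1))
  calc (n : ℝ) ^ y = n * (n : ℝ) ^ (y - 1) := by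
        rw [mul_comm, ← Real.rpow_add_one hn'.ne']; simp
    _ ≤ n * (2 * ((n - 1 : ℕ) : ℝ)) ^ (y - 1) := by gcongr
    _ = _ := by rw [Real.mul_rpow (by norm_num) (by positivity)]; ring

lemma binom_centered (n : ℕ) : binom q n (fun k => (k : ℝ) - n * q) = 0 := by
  rw [binom_sub, binom_id, binom_const, sub_self]

lemma binom_sq_centered (n : ℕ) :
    binom q n (fun k => ((k : ℝ) - n * q) ^ 2) = n * (q * (1 - q)) := by
  induction n with
  | zero => simp [binom_zero]
  | succ n ih =>
    have e1 : (fun k : ℕ => ((k : ℝ) - ((n + 1 : ℕ) : ℝ) * q) ^ 2) = fun k : ℕ =>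
        (((k : ℝ) - n * q) ^ 2 + (-(2 * q)) * ((k : ℝ) - n * q)) + q ^ 2 := by
      ext k; push_cast; ring
    have e2 : (fun k : ℕ => (((k + 1 : ℕ) : ℝ) - ((n + 1 : ℕ) : ℝ) * q) ^ 2) = fun k : ℕ =>
        (((k : ℝ) - n * q) ^ 2 + (2 * (1 - q)) * ((k : ℝ) - n * q)) + (1 - q) ^ 2 := by
      ext k; push_cast; ring
    rw [binom_succ, e2, e1, binom_add, binom_add, binom_const, binom_const_mul, binom_centered, ih,
      binom_add, binom_add, binom_const, binom_const_mul, binom_centered, ih]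
    push_cast
    ring

lemma binom_sq_centered_le (h0 : 0 ≤ q) (h1 : q ≤ 1) (n : ℕ) :
    binom q n (fun k => ((k : ℝ) - n * q) ^ 2) ≤ n := by
  rw [binom_sq_centered]
  have : q * (1 - q) ≤ 1 := by nlinarith
  nlinarith [(Nat.cast_nonneg n : (0 : ℝ) ≤ n)]

lemma binom_fourth_centered_le (h0 : 0 ≤ q) (h1 : q ≤ 1) (n : ℕ) :
    binom q n (fun k => ((k : ℝ) - n * q) ^ 4) ≤ (n : ℝ) ^ 2 := by
  -- The bound `n * (n + 1) / 2` is chosen to be inductive: with `v = q * (1 - q) ≤ 1 / 4` the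
  -- fourth moment grows by `6 * n * v ^ 2 + v * (1 - 3 * v)`, at most `n + 1`.
  have key : binom q n (fun k => ((k : ℝ) - n * q) ^ 4) ≤ n * (n + 1) / 2 := by
    induction n with
    | zero => simp [binom_zero]
    | succ n ih =>
      have e : ∀ x : ℝ, (fun k : ℕ => ((k : ℝ) - n * q + x) ^ 4) = fun k : ℕ =>
          ((((k : ℝ) - n * q) ^ 4 + (4 * x) * ((k : ℝ) - n * q) ^ 3)
            + (6 * x ^ 2) * ((k : ℝ) - n * q) ^ 2)
            + (4 * x ^ 3) * ((k : ℝ) - n * q) + x ^ 4 := by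
        intro x; ext k; ring
      have e1 : (fun k : ℕ => ((k : ℝ) - ((n + 1 : ℕ) : ℝ) * q) ^ 4) = fun k : ℕ =>
          ((k : ℝ) - n * q + (-q)) ^ 4 := by
        ext k; push_cast; ring
      have e2 : (fun k : ℕ => (((k + 1 : ℕ) : ℝ) - ((n + 1 : ℕ) : ℝ) * q) ^ 4) = fun k : ℕ =>
          ((k : ℝ) - n * q + (1 - q)) ^ 4 := by
        ext k; push_cast; ring
      rw [binom_succ, e2, e1, e, e]
      simp only [binom_add, binom_const, binom_const_mul, binom_centered, binom_sq_centered]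
      set x4 := binom q n (fun k => ((k : ℝ) - n * q) ^ 4)
      set x3 := binom q n (fun k => ((k : ℝ) - n * q) ^ 3)
      have hn : (0 : ℝ) ≤ n := Nat.cast_nonneg n
      have hv0 : 0 ≤ q * (1 - q) := by nlinarith
      have hv : q * (1 - q) ≤ 1 / 4 := by nlinarith [sq_nonneg (q - 1 / 2)]
      set v := q * (1 - q) with hvdef
      have e3 : (1 - q) * (x4 + 4 * -q * x3 + 6 * (-q) ^ 2 * (n * v) + 4 * (-q) ^ 3 * 0 + (-q) ^ 4)
          + q * (x4 + 4 * (1 - q) * x3 + 6 * (1 - q) ^ 2 * (n * v) + 4 * (1 - q) ^ 3 * 0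
            + (1 - q) ^ 4) = x4 + 6 * n * v ^ 2 + v * (1 - 3 * v) := by
        rw [hvdef]; ring
      rw [e3]
      push_cast
      nlinarith [mul_nonneg hn hv0, mul_nonneg hv0 hv0, mul_nonneg hn (mul_nonneg hv0 hv0),
        mul_nonneg hn (sub_nonneg.2 hv), mul_nonneg (mul_nonneg hn hv0) (sub_nonneg.2 hv)]
  rcases Nat.eq_zero_or_pos n with rfl | hn
  · simpa using key
  · have : (1 : ℝ) ≤ n := by exact_mod_cast hn
    nlinarith

end Binomial

/-! ### Multinomial expectations -/

section Multinomial

variable {𝒜 : Type*} [Fintype 𝒜] [DecidableEq 𝒜] {E : Type*} [NormedAddCommGroup E]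
  [NormedSpace ℝ E] {p : 𝒜 → ℝ}

/-- The expectation of `G N` where `N a` is the number of letters that are equal to `a` among `n`
independent letters with distribution `p`. -/
noncomputable def multi (p : 𝒜 → ℝ) : ℕ → ((𝒜 → ℕ) → E) → E
  | 0, G => G 0
  | n + 1, G => ∑ a, p a • multi p n (fun c => G (c + Pi.single a 1))

lemma multi_zero (G : (𝒜 → ℕ) → E) : multi p 0 G = G 0 := rfl

lemma multi_succ (n : ℕ) (G : (𝒜 → ℕ) → E) :
    multi p (n + 1) G = ∑ a, p a • multi p n (fun c => G (c + Pi.single a 1)) := rfl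

lemma multi_add (n : ℕ) (F G : (𝒜 → ℕ) → E) :
    multi p n (fun c => F c + G c) = multi p n F + multi p n G := by
  induction n generalizing F G with
  | zero => rfl
  | succ n ih => simp only [multi_succ, ih, smul_add, Finset.sum_add_distrib]

lemma multi_const_mul (n : ℕ) (r : ℝ) (G : (𝒜 → ℕ) → ℝ) :
    multi p n (fun c => r * G c) = r * multi p n G := by
  induction n generalizing G with
  | zero => rfl
  | succ n ih =>
    simp only [multi_succ, ih, smul_eq_mul, Finset.mul_sum]
    exact Finset.sum_congr rfl fun _ _ => by ring

lemma multi_const_mul' (n : ℕ) (r : ℂ) (G : (𝒜 → ℕ) → ℂ) :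
    multi p n (fun c => r * G c) = r * multi p n G := by
  induction n generalizing G with
  | zero => rfl
  | succ n ih =>
    simp only [multi_succ, ih, Finset.mul_sum]
    exact Finset.sum_congr rfl fun _ _ => by rw [mul_smul_comm]

lemma multi_neg (n : ℕ) (G : (𝒜 → ℕ) → E) :
    multi p n (fun c => -G c) = -multi p n G := by
  induction n generalizing G with
  | zero => rfl
  | succ n ih => simp only [multi_succ, ih, smul_neg, Finset.sum_neg_distrib]

lemma multi_sub (n : ℕ) (F G : (𝒜 → ℕ) → E) :
    multi p n (fun c => F c - G c) = multi p n F - multi p n G := by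
  simp only [sub_eq_add_neg, multi_add, multi_neg]

lemma multi_const (hs : ∑ a, p a = 1) (n : ℕ) (r : E) : multi p n (fun _ => r) = r := by
  induction n with
  | zero => rfl
  | succ n ih => rw [multi_succ, ih, ← Finset.sum_smul, hs, one_smul]

lemma multi_finset_sum {β : Type*} (s : Finset β) (n : ℕ) (G : β → (𝒜 → ℕ) → E) :
    multi p n (fun c => ∑ b ∈ s, G b c) = ∑ b ∈ s, multi p n (G b) := by
  induction n generalizing G with
  | zero => rfl
  | succ n ih =>
    simp only [multi_succ, ih, Finset.smul_sum]
    rw [Finset.sum_comm]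

lemma multi_congr (n : ℕ) {F G : (𝒜 → ℕ) → E} (h : ∀ c, ∑ a, c a = n → F c = G c) :
    multi p n F = multi p n G := by
  induction n generalizing F G with
  | zero => exact h 0 (by simp)
  | succ n ih =>
    rw [multi_succ, multi_succ]
    refine Finset.sum_congr rfl fun a _ => ?_
    rw [ih fun c hc => h _ ?_]
    simp [Finset.sum_add_distrib, hc]

lemma multi_mono (hp : ∀ a, 0 ≤ p a) (n : ℕ) {F G : (𝒜 → ℕ) → ℝ}
    (h : ∀ c, ∑ a, c a = n → F c ≤ G c) : multi p n F ≤ multi p n G := by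
  induction n generalizing F G with
  | zero => exact h 0 (by simp)
  | succ n ih =>
    rw [multi_succ, multi_succ]
    refine Finset.sum_le_sum fun a _ => ?_
    refine smul_le_smul_of_nonneg_left (ih fun c hc => h _ ?_) (hp a)
    simp [Finset.sum_add_distrib, hc]

lemma multi_nonneg (hp : ∀ a, 0 ≤ p a) (n : ℕ) {F : (𝒜 → ℕ) → ℝ} (h : ∀ c, 0 ≤ F c) :
    0 ≤ multi p n F := by
  induction n generalizing F with
  | zero => exact h 0
  | succ n ih =>
    rw [multi_succ]
    exact Finset.sum_nonneg fun a _ => mul_nonneg (hp a) (ih fun c => h _)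

lemma norm_multi_le (hp : ∀ a, 0 ≤ p a) (n : ℕ) (G : (𝒜 → ℕ) → E) :
    ‖multi p n G‖ ≤ multi p n (fun c => ‖G c‖) := by
  induction n generalizing G with
  | zero => exact le_rfl
  | succ n ih =>
    rw [multi_succ, multi_succ]
    refine (norm_sum_le _ _).trans (Finset.sum_le_sum fun a _ => ?_)
    rw [norm_smul, Real.norm_of_nonneg (hp a), smul_eq_mul]
    exact mul_le_mul_of_nonneg_left (ih _) (hp a)

lemma abs_multi_le (hp : ∀ a, 0 ≤ p a) (n : ℕ) (G : (𝒜 → ℕ) → ℝ) :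
    |multi p n G| ≤ multi p n (fun c => |G c|) := norm_multi_le hp n G

lemma multi_ofReal (n : ℕ) (G : (𝒜 → ℕ) → ℝ) :
    multi p n (fun c => (G c : ℂ)) = ((multi p n G : ℝ) : ℂ) := by
  induction n generalizing G with
  | zero => rfl
  | succ n ih => simp [multi_succ, ih]

/-- The marginals of the multinomial distribution are binomial. -/
lemma multi_apply (hs : ∑ a, p a = 1) (n : ℕ) (a : 𝒜) (g : ℕ → ℝ) :
    multi p n (fun c => g (c a)) = binom (p a) n g := by
  induction n generalizing g with
  | zero => rfl
  | succ n ih =>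
    rw [multi_succ, binom_succ, ← Finset.add_sum_erase _ _ (Finset.mem_univ a)]
    have h1 : ∑ b ∈ Finset.univ.erase a, p b • multi p n (fun c : 𝒜 → ℕ => g ((c + Pi.single b 1 : 𝒜 → ℕ) a))
        = ∑ b ∈ Finset.univ.erase a, p b • binom (p a) n g := by
      refine Finset.sum_congr rfl fun b hb => ?_
      have : a ≠ b := (Finset.ne_of_mem_erase hb).symm
      simp [this, ih]
    have h2 : ∑ b ∈ Finset.univ.erase a, p b = 1 - p a := by
      rw [← hs, ← Finset.add_sum_erase _ _ (Finset.mem_univ a)]; ring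
    rw [h1, ← Finset.sum_smul, h2]
    simp only [Pi.add_apply, Pi.single_eq_same, ih (fun k => g (k + 1)), smul_eq_mul]
    ring

/-- The characteristic function of a linear statistic. -/
lemma multi_prod_pow (n : ℕ) (z : 𝒜 → ℂ) :
    multi p n (fun c => ∏ a, z a ^ c a) = (∑ a, (p a : ℂ) * z a) ^ n := by
  induction n with
  | zero => simp [multi_zero]
  | succ n ih =>
    rw [multi_succ, pow_succ, Finset.mul_sum]
    refine Finset.sum_congr rfl fun a _ => ?_
    have : (fun c : 𝒜 → ℕ => ∏ b, z b ^ (c + Pi.single a 1 : 𝒜 → ℕ) b)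
        = fun c => z a * ∏ b, z b ^ c b := by
      ext c
      simp only [Pi.add_apply, pow_add, Finset.prod_mul_distrib]
      rw [mul_comm]
      congr 1
      rw [Finset.prod_eq_single a] <;> simp +contextual
    rw [this, multi_const_mul', ih]
    simp only [Complex.real_smul]
    ring

/-- Cauchy–Schwarz: the expectation of `(G * x + F) ^ 2` is a nonnegative quadratic in `x`, so its
discriminant is not positive. -/
lemma multi_mul_sq_le (hp : ∀ a, 0 ≤ p a) (n : ℕ) (F G : (𝒜 → ℕ) → ℝ) :
    multi p n (fun c => F c * G c) ^ 2 ≤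
      multi p n (fun c => F c ^ 2) * multi p n (fun c => G c ^ 2) := by
  have h : ∀ x : ℝ, 0 ≤ multi p n (fun c => G c ^ 2) * (x * x)
      + (2 * multi p n (fun c => F c * G c)) * x + multi p n (fun c => F c ^ 2) := by
    intro x
    have h1 := multi_nonneg hp n (F := fun c => (G c * x + F c) ^ 2) fun c => sq_nonneg _
    have h2 : (fun c => (G c * x + F c) ^ 2) = fun c => (x * x) * G c ^ 2
        + (2 * x) * (F c * G c) + F c ^ 2 := by ext c; ring
    rw [h2, multi_add, multi_add, multi_const_mul, multi_const_mul] at h1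
    linarith
  have := discrim_le_zero h
  unfold discrim at this
  nlinarith

lemma multi_abs_mul_le (hp : ∀ a, 0 ≤ p a) (n : ℕ) (F G : (𝒜 → ℕ) → ℝ) :
    multi p n (fun c => |F c| * |G c|) ≤
      √(multi p n (fun c => F c ^ 2)) * √(multi p n (fun c => G c ^ 2)) := by
  rw [← Real.sqrt_mul (multi_nonneg hp n fun c => sq_nonneg _)]
  apply Real.le_sqrt_of_sq_le
  simpa using multi_mul_sq_le hp n (fun c => |F c|) (fun c => |G c|)

lemma multi_abs_le_sqrt (hp : ∀ a, 0 ≤ p a) (hs : ∑ a, p a = 1) (n : ℕ) (F : (𝒜 → ℕ) → ℝ) :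
    multi p n (fun c => |F c|) ≤ √(multi p n (fun c => F c ^ 2)) := by
  have := multi_abs_mul_le hp n F (fun _ => 1)
  simpa [multi_const hs] using this

/-- The variance of `G N` for a multinomial vector `N`. -/
noncomputable def multiVar (p : 𝒜 → ℝ) (n : ℕ) (G : (𝒜 → ℕ) → ℝ) : ℝ :=
  multi p n (fun c => (G c - multi p n G) ^ 2)

lemma multiVar_nonneg (hp : ∀ a, 0 ≤ p a) (n : ℕ) (G : (𝒜 → ℕ) → ℝ) : 0 ≤ multiVar p n G :=
  multi_nonneg hp n fun _ => sq_nonneg _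

lemma multiVar_eq (hs : ∑ a, p a = 1) (n : ℕ) (G : (𝒜 → ℕ) → ℝ) :
    multiVar p n G = multi p n (fun c => G c ^ 2) - multi p n G ^ 2 := by
  unfold multiVar
  set m := multi p n G with hm
  have h2 : (fun c => (G c - m) ^ 2) = fun c => G c ^ 2 + (-(2 * m)) * G c + m ^ 2 := by
    ext c; ring
  rw [h2, multi_add, multi_add, multi_const_mul, multi_const hs, ← hm]
  ring

lemma multi_sub_sq_eq (hs : ∑ a, p a = 1) (n : ℕ) (G : (𝒜 → ℕ) → ℝ) (r : ℝ) :
    multi p n (fun c => (G c - r) ^ 2) = multiVar p n G + (multi p n G - r) ^ 2 := by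
  rw [multiVar_eq hs]
  have h2 : (fun c => (G c - r) ^ 2) = fun c => G c ^ 2 + (-(2 * r)) * G c + r ^ 2 := by
    ext c; ring
  rw [h2, multi_add, multi_add, multi_const_mul, multi_const hs]
  ring

lemma multiVar_le (hs : ∑ a, p a = 1) (n : ℕ) (G : (𝒜 → ℕ) → ℝ) (r : ℝ) :
    multiVar p n G ≤ multi p n (fun c => (G c - r) ^ 2) := by
  rw [multi_sub_sq_eq hs]
  nlinarith [sq_nonneg (multi p n G - r)]

end Multinomial


/-- The hypotheses on the letter probabilities in the non-explosive case. -/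
structure NonExplosive {𝒜 : Type*} [Fintype 𝒜] (p : 𝒜 → ℝ) (M : ℕ) : Prop where
  pos : ∀ a, 0 < p a
  lt_one : ∀ a, p a < 1
  sum_eq : ∑ a, p a = 1
  one_le : 1 ≤ M
  sum_sq_lt : M * ∑ a, p a ^ 2 < 1

/-! ### Growth of the expected size -/

section Mean

variable {𝒜 : Type*} [Fintype 𝒜] {p : 𝒜 → ℝ} {M : ℕ}

/-- A sequence that solves a contracting recursive inequality is dominated by the supersolution. -/
lemma le_of_contraction (hp : NonExplosive p M) {u : ℕ → ℕ → ℝ} {K : ℕ → ℝ} {w r : 𝒜 → ℝ}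
    {T l : ℝ} (hw : ∀ a, 0 ≤ w a) (hK : ∀ n, 0 ≤ K n)
    (hB : ∀ a n, binom (p a) n K ≤ r a * K n) (hl : M * ∑ a, w a * r a ≤ l) (hl1 : l < 1)
    (hT : 0 ≤ T) (h0 : ∀ n, u 0 n ≤ 0)
    (hu : ∀ h n, u (h + 1) n ≤ T * K n + M * ∑ a, w a * binom (p a) n (u h)) (h n : ℕ) :
    u h n ≤ T / (1 - l) * K n := by
  have hl' : 0 < 1 - l := by linarith
  have hC : 0 ≤ T / (1 - l) := by positivity
  induction h generalizing n with
  | zero => exact (h0 n).trans (mul_nonneg hC (hK n))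
  | succ h ih =>
    have h1 : ∀ a, binom (p a) n (u h) ≤ T / (1 - l) * (r a * K n) := fun a => by
      calc binom (p a) n (u h) ≤ binom (p a) n (fun k => T / (1 - l) * K k) :=
            binom_mono (hp.pos a).le (hp.lt_one a).le n fun k _ => ih k
        _ = T / (1 - l) * binom (p a) n K := binom_const_mul _ _ _
        _ ≤ _ := by gcongr; exact hB a n
    calc u (h + 1) n ≤ T * K n + M * ∑ a, w a * binom (p a) n (u h) := hu h n
      _ ≤ T * K n + M * ∑ a, w a * (T / (1 - l) * (r a * K n)) := by
          gcongr with a; exacts [hw a, h1 a]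
      _ = T * K n + (M * ∑ a, w a * r a) * (T / (1 - l) * K n) := by
          rw [Finset.mul_sum, Finset.mul_sum, Finset.sum_mul]
          congr 1
          exact Finset.sum_congr rfl fun a _ => by ring
      _ ≤ T * K n + l * (T / (1 - l) * K n) := by
          gcongr
          exact mul_nonneg hC (hK n)
      -- The constant is the fixed point of `C ↦ T + l * C`, hence the same for all heights.
      _ = T / (1 - l) * K n := by field_simp; ring

variable [DecidableEq 𝒜]

/-- The expected number of nodes at depth `< h` of the G-trie built from `n` random labelings. -/
noncomputable def meanSize (p : 𝒜 → ℝ) (M : ℕ) : ℕ → ℕ → ℝ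
  | 0, _ => 0
  | h + 1, n => (if 2 ≤ n then 1 else 0) + M * multi p n (fun c => ∑ a, meanSize p M h (c a))

/-- The expected number of new nodes that are created by an additional labeling. -/
noncomputable def meanDiff (p : 𝒜 → ℝ) (M : ℕ) (h n : ℕ) : ℝ :=
  meanSize p M h (n + 1) - meanSize p M h n

lemma meanSize_succ (hs : ∑ a, p a = 1) (h n : ℕ) : meanSize p M (h + 1) n =
    (if 2 ≤ n then 1 else 0) + M * ∑ a, binom (p a) n (meanSize p M h) := by
  rw [meanSize, multi_finset_sum]
  simp only [multi_apply hs]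

lemma meanDiff_zero (n : ℕ) : meanDiff p M 0 n = 0 := by simp [meanDiff, meanSize]

/-- An additional labeling creates the root exactly when it is the second one. Below each root edge
it joins the group of its letter `a`, which has a binomial number of members. -/
lemma meanDiff_succ (hs : ∑ a, p a = 1) (h n : ℕ) : meanDiff p M (h + 1) n =
    (if n = 1 then 1 else 0) + M * ∑ a, p a * binom (p a) n (meanDiff p M h) := by
  unfold meanDiff
  simp only [meanSize_succ hs, ← binom_succ_sub, Finset.sum_sub_distrib]
  have : (if n = 1 then (1 : ℝ) else 0) = (if 2 ≤ n + 1 then 1 else 0) - if 2 ≤ n then 1 else 0 := by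
    rcases n with _ | _ | n <;> simp
  rw [this]
  ring

lemma meanDiff_nonneg (hp : NonExplosive p M) (h n : ℕ) : 0 ≤ meanDiff p M h n := by
  induction h generalizing n with
  | zero => rw [meanDiff_zero]
  | succ h ih =>
    rw [meanDiff_succ hp.sum_eq]
    have : ∀ a, 0 ≤ p a * binom (p a) n (meanDiff p M h) := fun a =>
      mul_nonneg (hp.pos a).le (binom_nonneg (hp.pos a).le (hp.lt_one a).le n fun k _ => ih k)
    have := Finset.sum_nonneg fun a (_ : a ∈ Finset.univ) => this a
    positivity

lemma meanSize_eq_zero (hs : ∑ a, p a = 1) (h n : ℕ) (hn : n ≤ 1) : meanSize p M h n = 0 := by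
  induction h generalizing n with
  | zero => rfl
  | succ h ih =>
    rw [meanSize_succ hs, if_neg (by omega)]
    have : ∀ a, binom (p a) n (meanSize p M h) = 0 := fun a => by
      rw [binom_congr (g := fun _ => 0) n fun k hk => ih k (by omega), binom_const]
    simp [this]

/-- The recursion has weights `p a`, and thinning contracts `n ^ (y - 1)` by `p a ^ (y - 1)`;
together they give the rate `M * ∑ a, p a ^ y`. -/
lemma meanDiff_le (hp : NonExplosive p M) {y : ℝ} (hy1 : 1 ≤ y) (hy2 : y ≤ 2)
    (hy : M * ∑ a, p a ^ y < 1) :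
    ∃ C > 0, ∀ h n : ℕ, meanDiff p M h n ≤ C * (n : ℝ) ^ (y - 1) := by
  refine ⟨1 / (1 - M * ∑ a, p a ^ y), div_pos one_pos (by linarith), fun h n => ?_⟩
  refine le_of_contraction hp (u := meanDiff p M) (K := fun n => (n : ℝ) ^ (y - 1)) (w := p) (r := fun a => p a ^ (y - 1))
    (fun a => (hp.pos a).le) (fun n => by positivity) (fun a n => ?_) (le_of_eq ?_) hy zero_le_one
    (fun n => (meanDiff_zero n).le) (fun h n => ?_) h n
  · have := binom_natCast_rpow_le (hp.pos a) (hp.lt_one a).le n (θ := y - 1) (by linarith)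
    rwa [min_eq_left (by linarith)] at this
  · congr 1
    refine Finset.sum_congr rfl fun a _ => ?_
    rw [mul_comm, ← Real.rpow_add_one (hp.pos a).ne', sub_add_cancel]
  · rw [meanDiff_succ hp.sum_eq]
    gcongr
    rw [one_mul]
    split_ifs with h1
    · simp [h1]
    · positivity

/-- Differencing again produces weights `p a ^ 2`, while thinning expands the decaying power by `p a
^ (-s)`. The rate is therefore `M * ∑ a, p a ^ (2 - s)`, below one for some positive `s` precisely
because `ρ < 2`. -/
lemma abs_meanDiff_sub_succ_le (hp : NonExplosive p M) {s : ℝ} (hs0 : 0 ≤ s) (hs1 : s ≤ 1)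
    (hy : M * ∑ a, p a ^ (2 - s) < 1) :
    ∃ C > 0, ∀ h n : ℕ,
      |meanDiff p M h (n + 1) - meanDiff p M h n| ≤ C * ((n : ℝ) + 1) ^ (-s) := by
  refine ⟨2 / (1 - M * ∑ a, p a ^ (2 - s)), div_pos two_pos (by linarith), fun h n => ?_⟩
  refine le_of_contraction hp (u := fun h n => |meanDiff p M h (n + 1) - meanDiff p M h n|)
    (K := fun n => ((n : ℝ) + 1) ^ (-s))
    (w := fun a => p a ^ 2) (r := fun a => p a ^ (-s))
    (fun a => by positivity) (fun n => by positivity)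
    (fun a n => binom_rpow_neg_le (hp.pos a) (hp.lt_one a).le n hs0 hs1) (le_of_eq ?_) hy
    zero_le_two (fun n => by simp [meanDiff_zero]) (fun h n => ?_) h n
  · congr 1
    refine Finset.sum_congr rfl fun a _ => ?_
    rw [← Real.rpow_natCast, ← Real.rpow_add (hp.pos a)]
    norm_num [sub_eq_add_neg]
  · have e : meanDiff p M (h + 1) (n + 1) - meanDiff p M (h + 1) n =
        ((if n + 1 = 1 then 1 else 0) - if n = 1 then 1 else 0) + M * ∑ a, p a ^ 2 *
          binom (p a) n (fun k => meanDiff p M h (k + 1) - meanDiff p M h k) := by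
      have : ∀ a, p a ^ 2 * binom (p a) n (fun k => meanDiff p M h (k + 1) - meanDiff p M h k)
          = p a * binom (p a) (n + 1) (meanDiff p M h) - p a * binom (p a) n (meanDiff p M h) := by
        intro a
        rw [← mul_sub, binom_succ_sub]; ring
      simp only [this, Finset.sum_sub_distrib]
      rw [meanDiff_succ hp.sum_eq, meanDiff_succ hp.sum_eq]
      ring
    rw [e]
    refine (abs_add_le _ _).trans (add_le_add ?_ ?_)
    -- The toll is `1` at `n = 0`, `-1` at `n = 1` and `0` afterwards. The constant `2` is needed at
    -- `n = 1`, where the bounding power is `2 ^ (-s) ≥ 1 / 2`.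
    · rcases n with _ | _ | n
      · norm_num
      · have h2 : (2 : ℝ) ^ s ≤ 2 ^ (1 : ℝ) := Real.rpow_le_rpow_of_exponent_le one_le_two hs1
        norm_num at h2 ⊢
        rw [Real.rpow_neg (by norm_num), ← div_eq_mul_inv, le_div_iff₀ (by positivity)]
        linarith
      · simp
        positivity
    · rw [abs_mul, Nat.abs_cast]
      gcongr
      refine (Finset.abs_sum_le_sum_abs _ _).trans (Finset.sum_le_sum fun a _ => ?_)
      rw [abs_mul, abs_of_nonneg (by positivity : 0 ≤ p a ^ 2)]
      gcongr
      exact abs_binom_le (hp.pos a).le (hp.lt_one a).le _ _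

/-- The tangent of `x ^ (1 - s)` at `j + 1`; it lets sums of `(j + 1) ^ (-s)` telescope. -/
lemma rpow_neg_le_sub {s : ℝ} (hs0 : 0 ≤ s) (hs1 : s < 1) (j : ℕ) :
    ((j : ℝ) + 1) ^ (-s) ≤ (1 - s)⁻¹ * (((j : ℝ) + 1) ^ (1 - s) - (j : ℝ) ^ (1 - s)) := by
  have hj : (0 : ℝ) < (j : ℝ) + 1 := by positivity
  have h := rpow_le_tangent (x := (j : ℝ)) (c := (j : ℝ) + 1) (θ := 1 - s) (by positivity) hj
    (by linarith) (by linarith)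
  rw [← div_eq_inv_mul, le_div_iff₀ (by linarith)]
  have e : ((j : ℝ) + 1) ^ (1 - s) = ((j : ℝ) + 1) ^ (-s) * (j + 1) := by
    rw [← Real.rpow_add_one hj.ne']; ring_nf
  have e2 : 1 - s - 1 = -s := by ring
  rw [e2] at h
  rw [e] at h ⊢
  linarith

lemma rpow_sub_le {s : ℝ} (hs0 : 0 ≤ s) {a b : ℝ} (ha : 0 ≤ a) (hab : a ≤ b) (hb : 0 < b) (hs1 : s < 1) :
    b ^ (1 - s) - a ^ (1 - s) ≤ (b - a) * b ^ (-s) := by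
  have e : b ^ (1 - s) = b ^ (-s) * b := by
    rw [← Real.rpow_add_one hb.ne']; ring_nf
  rcases ha.eq_or_lt with rfl | ha
  · rw [Real.zero_rpow (by linarith), e]; linarith
  have e' : a ^ (1 - s) = a ^ (-s) * a := by
    rw [← Real.rpow_add_one ha.ne']; ring_nf
  have : b ^ (-s) ≤ a ^ (-s) := Real.rpow_le_rpow_of_nonpos ha hab (by linarith)
  rw [e, e']
  nlinarith

/-- Sum the second differences between `a` and `b`. The decay is stated at `b` alone, which later is
a deterministic point near the mean of the random count `a`. -/
lemma abs_meanDiff_sub_le (hp : NonExplosive p M) {s : ℝ} (hs0 : 0 ≤ s) (hs1 : s < 1)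
    (hy : M * ∑ a, p a ^ (2 - s) < 1) :
    ∃ C > 0, ∀ h a b : ℕ,
      |meanDiff p M h a - meanDiff p M h b| ≤ C * |(a : ℝ) - b| * ((b : ℝ) + 1) ^ (-s) := by
  obtain ⟨C, hC, h2⟩ := abs_meanDiff_sub_succ_le hp hs0 hs1.le hy
  have hs' : 0 < 1 - s := by linarith
  have hs'' : 1 ≤ (1 - s)⁻¹ := (one_le_inv₀ hs').2 (by linarith)
  refine ⟨2 * C * (1 - s)⁻¹, by positivity, fun h a b => ?_⟩
  rcases le_total b a with hab | hab
  · have key : |meanDiff p M h a - meanDiff p M h b| ≤ C * ((a : ℝ) - b) * ((b : ℝ) + 1) ^ (-s) := by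
      induction a, hab using Nat.le_induction with
      | base => simp
      | succ a hab ih =>
        have h3 : ((a : ℝ) + 1) ^ (-s) ≤ ((b : ℝ) + 1) ^ (-s) := by
          refine Real.rpow_le_rpow_of_nonpos (by positivity) ?_ (by linarith)
          have : (b : ℝ) ≤ a := by exact_mod_cast hab
          linarith
        calc |meanDiff p M h (a + 1) - meanDiff p M h b|
            = |(meanDiff p M h (a + 1) - meanDiff p M h a)
              + (meanDiff p M h a - meanDiff p M h b)| := by congr 1; ring
          _ ≤ C * ((a : ℝ) + 1) ^ (-s) + C * ((a : ℝ) - b) * ((b : ℝ) + 1) ^ (-s) :=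
            (abs_add_le _ _).trans (add_le_add (h2 h a) ih)
          _ ≤ C * ((b : ℝ) + 1) ^ (-s) + C * ((a : ℝ) - b) * ((b : ℝ) + 1) ^ (-s) := by gcongr
          _ = _ := by push_cast; ring
    have hab' : (0 : ℝ) ≤ (a : ℝ) - b := by
      have : (b : ℝ) ≤ a := by exact_mod_cast hab
      linarith
    rw [abs_of_nonneg hab']
    refine key.trans ?_
    gcongr
    nlinarith
  · rcases Nat.eq_zero_or_pos b with rfl | hb
    · have : a = 0 := by omega
      simp [this]
    have hb' : (0 : ℝ) < b := by exact_mod_cast hb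
    have hb1 : (1 : ℝ) ≤ b := by exact_mod_cast hb
    -- Below `b` the second differences may be larger than at `b`, but their sum telescopes to `b ^
    -- (1 - s) - a ^ (1 - s)`, at most `(b - a) * b ^ (-s)`.
    have key : |meanDiff p M h b - meanDiff p M h a| ≤
        C * (1 - s)⁻¹ * ((b : ℝ) ^ (1 - s) - (a : ℝ) ^ (1 - s)) := by
      clear hb hb' hb1
      induction b, hab using Nat.le_induction with
      | base => simp
      | succ b hab ih =>
        calc |meanDiff p M h (b + 1) - meanDiff p M h a|
            = |(meanDiff p M h (b + 1) - meanDiff p M h b)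
              + (meanDiff p M h b - meanDiff p M h a)| := by congr 1; ring
          _ ≤ C * ((b : ℝ) + 1) ^ (-s) + C * (1 - s)⁻¹ * ((b : ℝ) ^ (1 - s) - (a : ℝ) ^ (1 - s)) :=
            (abs_add_le _ _).trans (add_le_add (h2 h b) ih)
          _ ≤ C * ((1 - s)⁻¹ * (((b : ℝ) + 1) ^ (1 - s) - (b : ℝ) ^ (1 - s)))
              + C * (1 - s)⁻¹ * ((b : ℝ) ^ (1 - s) - (a : ℝ) ^ (1 - s)) := by
            gcongr; exact rpow_neg_le_sub hs0 hs1 b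
          _ = _ := by push_cast; ring
    have hab' : (a : ℝ) ≤ b := by exact_mod_cast hab
    have h4 : (b : ℝ) ^ (-s) ≤ 2 * ((b : ℝ) + 1) ^ (-s) := by
      have h5 : ((b : ℝ) + 1) ^ s ≤ 2 * (b : ℝ) ^ s := by
        calc ((b : ℝ) + 1) ^ s ≤ (2 * b) ^ s := by gcongr; linarith
          _ = 2 ^ s * (b : ℝ) ^ s := Real.mul_rpow (by norm_num) hb'.le
          _ ≤ 2 ^ (1 : ℝ) * (b : ℝ) ^ s := by gcongr; norm_num
          _ = _ := by norm_num
      rw [Real.rpow_neg hb'.le, Real.rpow_neg (by positivity), ← div_eq_mul_inv,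
        le_div_iff₀ (by positivity), inv_mul_le_iff₀ (by positivity)]
      linarith
    rw [abs_sub_comm, abs_sub_comm (a : ℝ), abs_of_nonneg (sub_nonneg.2 hab')]
    calc |meanDiff p M h b - meanDiff p M h a|
        ≤ C * (1 - s)⁻¹ * ((b : ℝ) ^ (1 - s) - (a : ℝ) ^ (1 - s)) := key
      _ ≤ C * (1 - s)⁻¹ * (((b : ℝ) - a) * (b : ℝ) ^ (-s)) := by
          gcongr; exact rpow_sub_le hs0 (by positivity) hab' hb' hs1
      _ ≤ C * (1 - s)⁻¹ * (((b : ℝ) - a) * (2 * ((b : ℝ) + 1) ^ (-s))) := by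
          gcongr
      _ = _ := by ring

/-- Second-order Taylor estimate for the expected size. -/
lemma abs_meanSize_sub_le {C s : ℝ} (h : ℕ) (H : ∀ a b : ℕ,
      |meanDiff p M h a - meanDiff p M h b| ≤ C * |(a : ℝ) - b| * ((b : ℝ) + 1) ^ (-s))
    (hC : 0 < C) (k a : ℕ) :
    |meanSize p M h a - meanSize p M h k - meanDiff p M h k * ((a : ℝ) - k)| ≤
      C * ((a : ℝ) - k) ^ 2 * ((k : ℝ) + 1) ^ (-s) := by
  have hpos : 0 ≤ C * ((k : ℝ) + 1) ^ (-s) := by positivity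
  rcases le_total k a with hka | hka
  · induction a, hka using Nat.le_induction with
    | base => simp
    | succ a hka ih =>
      have hka' : (0 : ℝ) ≤ (a : ℝ) - k := by
        have : (k : ℝ) ≤ a := by exact_mod_cast hka
        linarith
      have h1 := H a k
      rw [abs_of_nonneg hka'] at h1
      have e : meanSize p M h (a + 1) - meanSize p M h k
          - meanDiff p M h k * (((a + 1 : ℕ) : ℝ) - k) =
          (meanSize p M h a - meanSize p M h k - meanDiff p M h k * ((a : ℝ) - k))
          + (meanDiff p M h a - meanDiff p M h k) := by
        push_cast; unfold meanDiff; ring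
      rw [e]
      refine (abs_add_le _ _).trans ((add_le_add ih h1).trans ?_)
      push_cast
      nlinarith
  · induction hka using Nat.decreasingInduction with
    | self => simp
    | of_succ a hka ih =>
      have hka' : (1 : ℝ) ≤ (k : ℝ) - a := by
        have : ((a + 1 : ℕ) : ℝ) ≤ k := by exact_mod_cast hka
        push_cast at this
        linarith
      have h1 := H a k
      rw [abs_sub_comm (a : ℝ), abs_of_nonneg (by linarith : (0 : ℝ) ≤ (k : ℝ) - a)] at h1
      have e : meanSize p M h a - meanSize p M h k
          - meanDiff p M h k * ((a : ℝ) - k) =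
          (meanSize p M h (a + 1) - meanSize p M h k
            - meanDiff p M h k * (((a + 1 : ℕ) : ℝ) - k))
          - (meanDiff p M h a - meanDiff p M h k) := by
        push_cast; unfold meanDiff; ring
      rw [e]
      refine (abs_sub _ _).trans ((add_le_add ih h1).trans ?_)
      push_cast
      nlinarith

end Mean


/-! ### Variance of one level and regularity of the variance -/

section Level

variable {𝒜 : Type*} [Fintype 𝒜] [DecidableEq 𝒜] {p : 𝒜 → ℝ} {M : ℕ}

/-- The slope of the expected size at the expected number of labelings with first letter `a`. -/
noncomputable def slope (p : 𝒜 → ℝ) (M h n : ℕ) (a : 𝒜) : ℝ := meanDiff p M h ⌊n * p a⌋₊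

/-- The expected total size of the G-tries that are rooted at the endpoints of one of the
root's edges, given the numbers of labelings with the different letters on this edge. -/
noncomputable def levelMean (p : 𝒜 → ℝ) (M h : ℕ) (c : 𝒜 → ℕ) : ℝ := ∑ a, meanSize p M h (c a)

/-- The linear part of `levelMean` around its mean. -/
noncomputable def levelLin (p : 𝒜 → ℝ) (M h n : ℕ) (c : 𝒜 → ℕ) : ℝ :=
  ∑ a, slope p M h n a * ((c a : ℝ) - n * p a)

/-- The nonlinear part of `levelMean` around its mean. -/
noncomputable def levelRem (p : 𝒜 → ℝ) (M h n : ℕ) (c : 𝒜 → ℕ) : ℝ :=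
  levelMean p M h c - multi p n (levelMean p M h) - levelLin p M h n c

/-- The variance of the number of nodes at depth `< h` of the G-trie built from `n` random
labelings. -/
noncomputable def varSize (p : 𝒜 → ℝ) (M : ℕ) : ℕ → ℕ → ℝ
  | 0, _ => 0
  | h + 1, n => M * (multi p n (fun c => ∑ a, varSize p M h (c a))
      + multiVar p n (levelMean p M h))

/-- Exponents `s` and `r` that control the second differences of the expected size, and the
spread of the slopes. -/
structure SpreadBound (p : 𝒜 → ℝ) (M : ℕ) (s r D : ℝ) : Prop extends NonExplosive p M where
  s_pos : 0 < s
  s_lt : s < 1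
  sum_lt : M * ∑ a, p a ^ (2 - s) < 1
  le_r : 1 / 2 - s ≤ r
  r_le : r ≤ 1 - s
  D_nonneg : 0 ≤ D
  spread : ∀ h n : ℕ, 1 ≤ n → ∀ a b, |slope p M h n a - slope p M h n b| ≤ D * (n : ℝ) ^ r

lemma sq_sub_floor_le {x t : ℝ} (ht : 0 ≤ t) :
    (x - (⌊t⌋₊ : ℝ)) ^ 2 ≤ 2 * (x - t) ^ 2 + 2 := by
  have h1 := Nat.floor_le ht
  have h2 := Nat.lt_floor_add_one t
  have h3 : (t - (⌊t⌋₊ : ℝ)) ^ 2 ≤ 1 := by nlinarith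
  nlinarith [sq_nonneg ((x - t) - (t - (⌊t⌋₊ : ℝ)))]

lemma pow_four_sub_floor_le {x t : ℝ} (ht : 0 ≤ t) :
    (x - (⌊t⌋₊ : ℝ)) ^ 4 ≤ 8 * (x - t) ^ 4 + 8 := by
  have h := sq_sub_floor_le (x := x) ht
  have h0 : 0 ≤ (x - (⌊t⌋₊ : ℝ)) ^ 2 := sq_nonneg _
  nlinarith [sq_nonneg ((x - t) ^ 2 - 1)]

lemma multi_sq_sub_floor_le (hp : NonExplosive p M) {n : ℕ} (hn : 1 ≤ n) (a : 𝒜) :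
    multi p n (fun c => ((c a : ℝ) - (⌊n * p a⌋₊ : ℝ)) ^ 2) ≤ 4 * n := by
  have hn' : (1 : ℝ) ≤ n := by exact_mod_cast hn
  have hpa := (hp.pos a).le
  rw [multi_apply hp.sum_eq n a (fun k => ((k : ℝ) - (⌊n * p a⌋₊ : ℝ)) ^ 2)]
  calc _ ≤ binom (p a) n (fun k => 2 * ((k : ℝ) - n * p a) ^ 2 + 2) :=
        binom_mono hpa (hp.lt_one a).le n fun k _ => sq_sub_floor_le (by positivity)
    _ ≤ 4 * n := by
        rw [binom_add, binom_const, binom_const_mul]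
        linarith [binom_sq_centered_le hpa (hp.lt_one a).le n]

lemma multi_pow_four_sub_floor_le (hp : NonExplosive p M) {n : ℕ} (hn : 1 ≤ n) (a : 𝒜) :
    multi p n (fun c => ((c a : ℝ) - (⌊n * p a⌋₊ : ℝ)) ^ 4) ≤ 16 * (n : ℝ) ^ 2 := by
  have hn' : (1 : ℝ) ≤ n := by exact_mod_cast hn
  have hpa := (hp.pos a).le
  rw [multi_apply hp.sum_eq n a (fun k => ((k : ℝ) - (⌊n * p a⌋₊ : ℝ)) ^ 4)]
  calc _ ≤ binom (p a) n (fun k => 8 * ((k : ℝ) - n * p a) ^ 4 + 8) :=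
        binom_mono hpa (hp.lt_one a).le n fun k _ => pow_four_sub_floor_le (by positivity)
    _ ≤ 16 * (n : ℝ) ^ 2 := by
        rw [binom_add, binom_const, binom_const_mul]
        nlinarith [binom_fourth_centered_le hpa (hp.lt_one a).le n]

omit [DecidableEq 𝒜] in
lemma floor_add_one_rpow_le (hp : NonExplosive p M) {s : ℝ} (hs : 0 ≤ s) {n : ℕ} (hn : 1 ≤ n)
    (a : 𝒜) : ((⌊n * p a⌋₊ : ℝ) + 1) ^ (-s) ≤ (∑ b, p b ^ (-s)) * (n : ℝ) ^ (-s) := by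
  have hn' : (0 : ℝ) < n := by exact_mod_cast hn
  have hpa := hp.pos a
  calc ((⌊n * p a⌋₊ : ℝ) + 1) ^ (-s) ≤ (n * p a) ^ (-s) :=
        Real.rpow_le_rpow_of_nonpos (by positivity) (Nat.lt_floor_add_one _).le (by linarith)
    _ = p a ^ (-s) * (n : ℝ) ^ (-s) := by rw [Real.mul_rpow hn'.le hpa.le, mul_comm]
    _ ≤ _ := by
        gcongr
        exact Finset.single_le_sum (f := fun b => p b ^ (-s))
          (fun b _ => Real.rpow_nonneg (hp.pos b).le _) (Finset.mem_univ a)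

lemma multi_mono_of_le_mul_sq {F G : (𝒜 → ℕ) → ℝ} (hp : ∀ a, 0 ≤ p a) {n : ℕ} {K x : ℝ}
    (h : ∀ c, |F c| ≤ K * |G c|) (hG : multi p n (fun c => G c ^ 2) ≤ x) :
    multi p n (fun c => F c ^ 2) ≤ K ^ 2 * x := by
  calc multi p n (fun c => F c ^ 2) ≤ multi p n (fun c => K ^ 2 * G c ^ 2) := by
        refine multi_mono hp n fun c _ => ?_
        rw [← sq_abs, ← sq_abs (G c), ← mul_pow]
        gcongr
        exact h c
    _ = K ^ 2 * multi p n (fun c => G c ^ 2) := multi_const_mul _ _ _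
    _ ≤ _ := by gcongr

/-- The slopes of the expected size are concentrated. -/
lemma multi_sq_meanDiff_sub_slope_le (hp : NonExplosive p M) {s : ℝ} (hs0 : 0 ≤ s) (hs1 : s < 1)
    (hy : M * ∑ a, p a ^ (2 - s) < 1) :
    ∃ C > 0, ∀ h n : ℕ, 1 ≤ n → ∀ a,
      multi p n (fun c => (meanDiff p M h (c a) - slope p M h n a) ^ 2)
        ≤ C * (n : ℝ) ^ (1 - 2 * s) := by
  obtain ⟨C, hC, H⟩ := abs_meanDiff_sub_le hp hs0 hs1 hy
  have hP : 0 ≤ ∑ b, p b ^ (-s) := Finset.sum_nonneg fun b _ => Real.rpow_nonneg (hp.pos b).le _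
  refine ⟨(C * (∑ b, p b ^ (-s))) ^ 2 * 4 + 1, by positivity, fun h n hn a => ?_⟩
  have hn' : (0 : ℝ) < n := by exact_mod_cast hn
  have h1 := multi_mono_of_le_mul_sq (p := p) (n := n) (fun b => (hp.pos b).le)
    (F := fun c => meanDiff p M h (c a) - slope p M h n a)
    (G := fun c => (c a : ℝ) - (⌊n * p a⌋₊ : ℝ))
    (K := C * (∑ b, p b ^ (-s)) * (n : ℝ) ^ (-s)) (fun c => ?_)
    (multi_sq_sub_floor_le hp hn a)
  · refine h1.trans ?_
    have e : (n : ℝ) ^ (1 - 2 * s) = ((n : ℝ) ^ (-s)) ^ 2 * n := by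
      rw [← Real.rpow_natCast, ← Real.rpow_mul hn'.le, ← Real.rpow_add_one hn'.ne']
      congr 1; push_cast; ring
    rw [e]
    nlinarith [(by positivity : 0 ≤ ((n : ℝ) ^ (-s)) ^ 2 * n)]
  · refine (H h (c a) ⌊n * p a⌋₊).trans ?_
    have := floor_add_one_rpow_le hp hs0 hn a
    calc C * |(c a : ℝ) - (⌊n * p a⌋₊ : ℝ)| * ((⌊n * p a⌋₊ : ℝ) + 1) ^ (-s)
        ≤ C * |(c a : ℝ) - (⌊n * p a⌋₊ : ℝ)| * ((∑ b, p b ^ (-s)) * (n : ℝ) ^ (-s)) := by gcongr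
      _ = _ := by ring

lemma multi_levelLin (hp : NonExplosive p M) (h n : ℕ) :
    multi p n (levelLin p M h n) = 0 := by
  unfold levelLin
  rw [multi_finset_sum]
  refine Finset.sum_eq_zero fun a _ => ?_
  rw [multi_const_mul, multi_apply hp.sum_eq n a (fun k => (k : ℝ) - n * p a), binom_centered,
    mul_zero]

lemma multi_levelRem (hp : NonExplosive p M) (h n : ℕ) :
    multi p n (levelRem p M h n) = 0 := by
  unfold levelRem
  rw [multi_sub, multi_sub, multi_levelLin hp, multi_const hp.sum_eq]
  ring

lemma multi_sum_sq_le (hp : ∀ a, 0 ≤ p a) (n : ℕ) (F : 𝒜 → (𝒜 → ℕ) → ℝ) :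
    multi p n (fun c => (∑ a, F a c) ^ 2) ≤
      Fintype.card 𝒜 * ∑ a, multi p n (fun c => F a c ^ 2) := by
  rw [← multi_finset_sum, ← multi_const_mul]
  exact multi_mono hp n fun c _ => sq_sum_le_card_mul_sum_sq

/-- The nonlinear part of `levelMean` is small. -/
lemma multi_sq_levelRem_le (hp : NonExplosive p M) {s : ℝ} (hs0 : 0 ≤ s) (hs1 : s < 1)
    (hy : M * ∑ a, p a ^ (2 - s) < 1) :
    ∃ C > 0, ∀ h n : ℕ, 1 ≤ n →
      multi p n (fun c => levelRem p M h n c ^ 2) ≤ C * (n : ℝ) ^ (2 - 2 * s) := by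
  obtain ⟨C, hC, H⟩ := abs_meanDiff_sub_le hp hs0 hs1 hy
  have hP : 0 ≤ ∑ b, p b ^ (-s) := Finset.sum_nonneg fun b _ => Real.rpow_nonneg (hp.pos b).le _
  have hp0 : ∀ b, 0 ≤ p b := fun b => (hp.pos b).le
  set A : ℝ := (Fintype.card 𝒜 : ℝ) with hA
  refine ⟨A * (A * ((C * (∑ b, p b ^ (-s))) ^ 2 * 16)) + 1, by positivity, fun h n hn => ?_⟩
  have hn' : (0 : ℝ) < n := by exact_mod_cast hn
  let R : 𝒜 → (𝒜 → ℕ) → ℝ := fun a c => meanSize p M h (c a) - meanSize p M h ⌊n * p a⌋₊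
    - meanDiff p M h ⌊n * p a⌋₊ * ((c a : ℝ) - (⌊n * p a⌋₊ : ℝ))
  have hR : ∀ a, multi p n (fun c => R a c ^ 2) ≤
      (C * (∑ b, p b ^ (-s)) * (n : ℝ) ^ (-s)) ^ 2 * (16 * (n : ℝ) ^ 2) := fun a => by
    refine multi_mono_of_le_mul_sq hp0 (G := fun c => ((c a : ℝ) - (⌊n * p a⌋₊ : ℝ)) ^ 2)
      (fun c => ?_) ?_
    · have h1 := abs_meanSize_sub_le h (H h) hC ⌊n * p a⌋₊ (c a)
      have h2 := floor_add_one_rpow_le hp hs0 hn a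
      rw [abs_of_nonneg (sq_nonneg ((c a : ℝ) - (⌊n * p a⌋₊ : ℝ)))]
      refine h1.trans ?_
      calc C * ((c a : ℝ) - (⌊n * p a⌋₊ : ℝ)) ^ 2 * ((⌊n * p a⌋₊ : ℝ) + 1) ^ (-s)
          ≤ C * ((c a : ℝ) - (⌊n * p a⌋₊ : ℝ)) ^ 2 * ((∑ b, p b ^ (-s)) * (n : ℝ) ^ (-s)) := by
            gcongr
        _ = _ := by ring
    · simpa only [← pow_mul] using multi_pow_four_sub_floor_le hp hn a
  let S : (𝒜 → ℕ) → ℝ := fun c => ∑ a, R a c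
  have hconst : ∃ r : ℝ, ∀ c, levelMean p M h c = S c + levelLin p M h n c + r := by
    refine ⟨∑ a, (meanSize p M h ⌊n * p a⌋₊ + slope p M h n a * (n * p a - (⌊n * p a⌋₊ : ℝ))),
      fun c => ?_⟩
    simp only [levelMean, S, R, levelLin, ← Finset.sum_add_distrib, slope]
    exact Finset.sum_congr rfl fun a _ => by ring
  obtain ⟨r, hr⟩ := hconst
  -- The second-order Taylor remainders sum to `S`; the linear part is centered and constants drop
  -- out, so `levelRem` is `S` minus its mean.
  have hrem : multi p n (fun c => levelRem p M h n c ^ 2) = multiVar p n S := by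
    unfold multiVar levelRem
    have : multi p n (levelMean p M h) = multi p n S + r := by
      rw [show levelMean p M h = fun c => S c + levelLin p M h n c + r from funext hr, multi_add,
        multi_add, multi_levelLin hp, multi_const hp.sum_eq, add_zero]
    rw [this]
    refine multi_congr n fun c _ => ?_
    rw [hr]; ring
  rw [hrem]
  refine (multiVar_le hp.sum_eq n S 0).trans ?_
  simp only [sub_zero]
  refine (multi_sum_sq_le hp0 n R).trans ?_
  have e : (n : ℝ) ^ (2 - 2 * s) = ((n : ℝ) ^ (-s)) ^ 2 * (n : ℝ) ^ 2 := by
    rw [← Real.rpow_natCast, ← Real.rpow_mul hn'.le, ← Real.rpow_natCast (n : ℝ),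
      ← Real.rpow_add hn']
    congr 1; push_cast; ring
  calc A * ∑ a, multi p n (fun c => R a c ^ 2)
      ≤ A * ∑ _a : 𝒜, (C * (∑ b, p b ^ (-s)) * (n : ℝ) ^ (-s)) ^ 2 * (16 * (n : ℝ) ^ 2) := by
        gcongr with a; exact hR a
    _ = A * (A * ((C * (∑ b, p b ^ (-s))) ^ 2 * 16)) * (n : ℝ) ^ (2 - 2 * s) := by
        rw [Finset.sum_const, Finset.card_univ, nsmul_eq_mul, ← hA, e]; ring
    _ ≤ _ := by gcongr; linarith

variable {s r D : ℝ}

omit [DecidableEq 𝒜] in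
lemma NonExplosive.nonempty (hp : NonExplosive p M) : Nonempty 𝒜 := by
  by_contra h
  rw [not_nonempty_iff] at h
  have := hp.sum_eq
  simp at this

/-- The centered counts sum to zero, so the slope at a fixed letter `b` may be subtracted from all
slopes. Only their spread `D * n ^ r` matters, and it is zero for uniform letters. -/
lemma multi_sq_levelLin_le (hp : SpreadBound p M s r D) :
    ∃ C > 0, ∀ h n : ℕ, 1 ≤ n →
      multi p n (fun c => levelLin p M h n c ^ 2) ≤ C * (n : ℝ) ^ (2 * r + 1) := by
  obtain ⟨b⟩ := hp.nonempty
  set A : ℝ := (Fintype.card 𝒜 : ℝ) with hA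
  have hp0 : ∀ b, 0 ≤ p b := fun b => (hp.pos b).le
  refine ⟨A * (A * D ^ 2) + 1, by positivity, fun h n hn => ?_⟩
  have hn' : (0 : ℝ) < n := by exact_mod_cast hn
  have e : (n : ℝ) ^ (2 * r + 1) = ((n : ℝ) ^ r) ^ 2 * n := by
    rw [← Real.rpow_natCast, ← Real.rpow_mul hn'.le, ← Real.rpow_add_one hn'.ne']
    congr 1; push_cast; ring
  have e1 : multi p n (fun c => levelLin p M h n c ^ 2) = multi p n (fun c =>
      (∑ a, (slope p M h n a - slope p M h n b) * ((c a : ℝ) - n * p a)) ^ 2) := by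
    refine multi_congr n fun c hc => ?_
    congr 1
    have h0 : ∑ a, ((c a : ℝ) - n * p a) = 0 := by
      rw [Finset.sum_sub_distrib, ← Finset.mul_sum, hp.sum_eq, ← Nat.cast_sum, hc]; ring
    simp only [sub_mul, Finset.sum_sub_distrib (f := fun a => slope p M h n a * ((c a : ℝ) - n * p a)),
      ← Finset.mul_sum, h0, mul_zero, sub_zero, levelLin]
  rw [e1]
  refine (multi_sum_sq_le hp0 n _).trans ?_
  calc A * ∑ a, multi p n (fun c => ((slope p M h n a - slope p M h n b) * ((c a : ℝ) - n * p a)) ^ 2)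
      ≤ A * ∑ _a : 𝒜, (D * (n : ℝ) ^ r) ^ 2 * n := by
        gcongr with a
        refine multi_mono_of_le_mul_sq hp0 (G := fun c => (c a : ℝ) - n * p a)
          (fun c => ?_) ?_
        · rw [abs_mul]
          gcongr
          exact hp.spread h n hn a b
        · rw [multi_apply hp.sum_eq n a (fun k => ((k : ℝ) - n * p a) ^ 2)]
          exact binom_sq_centered_le (hp0 a) (hp.lt_one a).le n
    _ = A * (A * D ^ 2) * (n : ℝ) ^ (2 * r + 1) := by
        rw [Finset.sum_const, Finset.card_univ, nsmul_eq_mul, ← hA, e]; ring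
    _ ≤ _ := by gcongr; linarith

/-- The linear part contributes `n ^ (2 * r + 1)` and the remainder `n ^ (2 - 2 * s)`. The condition
`1 / 2 - s ≤ r` says that the linear bound is the larger one. -/
lemma multiVar_levelMean_le (hp : SpreadBound p M s r D) :
    ∃ C > 0, ∀ h n : ℕ, 1 ≤ n →
      multiVar p n (levelMean p M h) ≤ C * (n : ℝ) ^ (2 * r + 1) := by
  obtain ⟨C₁, hC₁, H₁⟩ := multi_sq_levelLin_le hp
  obtain ⟨C₂, hC₂, H₂⟩ := multi_sq_levelRem_le hp.toNonExplosive hp.s_pos.le hp.s_lt hp.sum_lt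
  have hp0 : ∀ b, 0 ≤ p b := fun b => (hp.pos b).le
  refine ⟨2 * C₁ + 2 * C₂, by positivity, fun h n hn => ?_⟩
  have hn' : (1 : ℝ) ≤ n := by exact_mod_cast hn
  calc multiVar p n (levelMean p M h)
      ≤ multi p n (fun c => 2 * levelLin p M h n c ^ 2 + 2 * levelRem p M h n c ^ 2) := by
        refine multi_mono hp0 n fun c _ => ?_
        have : levelMean p M h c - multi p n (levelMean p M h)
            = levelLin p M h n c + levelRem p M h n c := by unfold levelRem; ring
        rw [this]
        nlinarith [sq_nonneg (levelLin p M h n c - levelRem p M h n c)]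
    _ ≤ 2 * (C₁ * (n : ℝ) ^ (2 * r + 1)) + 2 * (C₂ * (n : ℝ) ^ (2 - 2 * s)) := by
        rw [multi_add, multi_const_mul, multi_const_mul]
        linarith [H₁ h n hn, H₂ h n hn]
    _ ≤ 2 * (C₁ * (n : ℝ) ^ (2 * r + 1)) + 2 * (C₂ * (n : ℝ) ^ (2 * r + 1)) := by
        gcongr
        linarith [hp.le_r]
    _ = _ := by ring

lemma levelMean_add_single (h : ℕ) (c : 𝒜 → ℕ) (a : 𝒜) :
    levelMean p M h (c + Pi.single a 1) = levelMean p M h c + meanDiff p M h (c a) := by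
  unfold levelMean meanDiff
  rw [← Finset.add_sum_erase _ _ (Finset.mem_univ a),
    ← Finset.add_sum_erase _ (fun b => meanSize p M h (c b)) (Finset.mem_univ a)]
  have : ∑ b ∈ Finset.univ.erase a, meanSize p M h ((c + Pi.single a 1 : 𝒜 → ℕ) b)
      = ∑ b ∈ Finset.univ.erase a, meanSize p M h (c b) := by
    refine Finset.sum_congr rfl fun b hb => ?_
    simp [Finset.ne_of_mem_erase hb]
  rw [this]
  simp
  ring

lemma multi_succ_levelMean (h n : ℕ) (φ : ℝ → ℝ) :
    multi p (n + 1) (fun c => φ (levelMean p M h c)) =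
      multi p n (fun c => ∑ a, p a * φ (levelMean p M h c + meanDiff p M h (c a))) := by
  rw [multi_succ, multi_finset_sum]
  simp only [levelMean_add_single, multi_const_mul, smul_eq_mul]

/-- An additional labeling with letter `a` adds `meanDiff p M h (c a)`. The variance changes by
twice the covariance of `levelMean` with the conditional mean `U` of this increment, plus the
variance of the increment. Cauchy–Schwarz bounds the covariance by the root of `n ^ (2 * r + 1) * n
^ (1 - 2 * s)`. -/
lemma abs_multiVar_levelMean_sub_le (hp : SpreadBound p M s r D) :
    ∃ C > 0, ∀ h n : ℕ, 1 ≤ n →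
      |multiVar p (n + 1) (levelMean p M h) - multiVar p n (levelMean p M h)|
        ≤ C * (n : ℝ) ^ (r + 1 - s) := by
  obtain ⟨C₁, hC₁, H₁⟩ := multiVar_levelMean_le hp
  obtain ⟨C₂, hC₂, H₂⟩ :=
    multi_sq_meanDiff_sub_slope_le hp.toNonExplosive hp.s_pos.le hp.s_lt hp.sum_lt
  have hp0 : ∀ b, 0 ≤ p b := fun b => (hp.pos b).le
  obtain ⟨a₀⟩ := hp.nonempty
  set A : ℝ := (Fintype.card 𝒜 : ℝ) with hA
  refine ⟨2 * (√C₁ * √(A * (A * C₂))) + (A * (2 * C₂) + 2 * D ^ 2) + 1, by positivity,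
    fun h n hn => ?_⟩
  have hn' : (1 : ℝ) ≤ n := by exact_mod_cast hn
  have hn0 : (0 : ℝ) < n := by linarith
  set G := levelMean p M h with hG
  set U : (𝒜 → ℕ) → ℝ := fun c => ∑ a, p a * meanDiff p M h (c a) with hU
  set W : (𝒜 → ℕ) → ℝ := fun c => ∑ a, p a * meanDiff p M h (c a) ^ 2 with hW
  set m := multi p n G with hm
  set u := multi p n U with hu
  have e1 : multi p (n + 1) G = m + u := by
    have := multi_succ_levelMean (p := p) (M := M) h n (fun x => x)
    simp only [mul_add, Finset.sum_add_distrib, ← Finset.sum_mul, hp.sum_eq, one_mul] at this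
    rw [multi_add] at this
    exact this
  have e2 : multi p (n + 1) (fun c => G c ^ 2) =
      multi p n (fun c => G c ^ 2) + 2 * multi p n (fun c => G c * U c) + multi p n W := by
    have := multi_succ_levelMean (p := p) (M := M) h n (fun x => x ^ 2)
    rw [hG, this, ← multi_const_mul, ← multi_add, ← multi_add]
    refine multi_congr n fun c _ => ?_
    simp only [hU, hW, Finset.mul_sum]
    rw [← one_mul (levelMean p M h c ^ 2), ← hp.sum_eq, Finset.sum_mul, ← Finset.sum_add_distrib,
      ← Finset.sum_add_distrib]
    exact Finset.sum_congr rfl fun a _ => by ring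
  have hcov : multi p n (fun c => (G c - m) * (U c - u)) = multi p n (fun c => G c * U c) - m * u := by
    have : (fun c => (G c - m) * (U c - u)) =
        fun c => G c * U c + (-u) * G c + (-m) * U c + m * u := by ext c; ring
    rw [this, multi_add, multi_add, multi_add, multi_const_mul, multi_const_mul,
      multi_const hp.sum_eq, ← hm, ← hu]
    ring
  have e3 : multiVar p (n + 1) G - multiVar p n G =
      2 * multi p n (fun c => (G c - m) * (U c - u)) + (multi p n W - u ^ 2) := by
    rw [multiVar_eq hp.sum_eq, multiVar_eq hp.sum_eq, e1, e2, hcov]; ring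
  have hVU : multiVar p n U ≤ A * (A * C₂) * (n : ℝ) ^ (1 - 2 * s) := by
    refine (multiVar_le hp.sum_eq n U (∑ a, p a * slope p M h n a)).trans ?_
    have : ∀ c, U c - ∑ a, p a * slope p M h n a
        = ∑ a, p a * (meanDiff p M h (c a) - slope p M h n a) := fun c => by
      rw [hU, ← Finset.sum_sub_distrib]
      exact Finset.sum_congr rfl fun a _ => by ring
    simp only [this]
    refine (multi_sum_sq_le hp0 n _).trans ?_
    calc A * ∑ a, multi p n (fun c => (p a * (meanDiff p M h (c a) - slope p M h n a)) ^ 2)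
        ≤ A * ∑ _a : 𝒜, 1 ^ 2 * (C₂ * (n : ℝ) ^ (1 - 2 * s)) := by
          gcongr with a
          refine multi_mono_of_le_mul_sq hp0
            (G := fun c => meanDiff p M h (c a) - slope p M h n a) (fun c => ?_)
            (H₂ h n hn a)
          rw [abs_mul, abs_of_nonneg (hp0 a)]
          gcongr
          exact (hp.lt_one a).le
      _ = _ := by
          rw [Finset.sum_const, Finset.card_univ, nsmul_eq_mul, ← hA]; ring
  have hcov_le : |multi p n (fun c => (G c - m) * (U c - u))| ≤
      √C₁ * √(A * (A * C₂)) * (n : ℝ) ^ (r + 1 - s) := by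
    rw [← Real.sqrt_sq_eq_abs]
    have h1 := multi_mul_sq_le hp0 n (fun c => G c - m) (fun c => U c - u)
    have h2 : multi p n (fun c => (G c - m) * (U c - u)) ^ 2 ≤
        (C₁ * (n : ℝ) ^ (2 * r + 1)) * (A * (A * C₂) * (n : ℝ) ^ (1 - 2 * s)) :=
      h1.trans (mul_le_mul (H₁ h n hn) hVU (multiVar_nonneg hp0 n U) (by positivity))
    refine (Real.sqrt_le_sqrt h2).trans (le_of_eq ?_)
    have h3 : (C₁ * (n : ℝ) ^ (2 * r + 1)) * (A * (A * C₂) * (n : ℝ) ^ (1 - 2 * s))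
        = C₁ * (A * (A * C₂)) * ((n : ℝ) ^ (r + 1 - s)) ^ 2 := by
      have : (n : ℝ) ^ (2 * r + 1) * (n : ℝ) ^ (1 - 2 * s) = ((n : ℝ) ^ (r + 1 - s)) ^ 2 := by
        rw [← Real.rpow_natCast, ← Real.rpow_mul hn0.le, ← Real.rpow_add hn0]
        congr 1; push_cast; ring
      rw [← this]; ring
    rw [h3, Real.sqrt_mul (by positivity), Real.sqrt_sq (by positivity),
      Real.sqrt_mul hC₁.le]
  -- Second moment of the increment about `b`. The choice `b = u` gives nonnegativity, and the slope
  -- at a fixed letter gives the upper bound.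
  have hW_eq : ∀ b : ℝ, multi p n (fun c => ∑ a, p a * (meanDiff p M h (c a) - b) ^ 2)
      = (multi p n W - u ^ 2) + (u - b) ^ 2 := fun b => by
    have : ∀ c : 𝒜 → ℕ, ∑ a, p a * (meanDiff p M h (c a) - b) ^ 2
        = W c + (-(2 * b)) * U c + b ^ 2 := fun c => by
      rw [hW, hU]
      simp only [Finset.mul_sum]
      rw [← one_mul (b ^ 2), ← hp.sum_eq, Finset.sum_mul, ← Finset.sum_add_distrib,
        ← Finset.sum_add_distrib]
      exact Finset.sum_congr rfl fun a _ => by ring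
    simp only [this]
    rw [multi_add, multi_add, multi_const_mul, multi_const hp.sum_eq, ← hu]
    ring
  have hW0 : 0 ≤ multi p n W - u ^ 2 := by
    have h1 := hW_eq u
    rw [sub_self, zero_pow two_ne_zero, add_zero] at h1
    rw [← h1]
    exact multi_nonneg hp0 n fun c => Finset.sum_nonneg fun a _ =>
      mul_nonneg (hp0 a) (sq_nonneg _)
  have hW1 : multi p n W - u ^ 2 ≤
      (A * (2 * C₂) + 2 * D ^ 2) * (n : ℝ) ^ (r + 1 - s) := by
    have h1 := hW_eq (slope p M h n a₀)
    have h2 : multi p n W - u ^ 2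
        ≤ multi p n (fun c => ∑ a, p a * (meanDiff p M h (c a) - slope p M h n a₀) ^ 2) := by
      rw [h1]; linarith [sq_nonneg (u - slope p M h n a₀)]
    have h3 : ∀ a, multi p n (fun c => p a * (meanDiff p M h (c a) - slope p M h n a₀) ^ 2)
        ≤ 2 * (C₂ * (n : ℝ) ^ (1 - 2 * s)) + p a * (2 * (D * (n : ℝ) ^ r) ^ 2) := fun a => by
      calc multi p n (fun c => p a * (meanDiff p M h (c a) - slope p M h n a₀) ^ 2)
          ≤ multi p n (fun c => 2 * (meanDiff p M h (c a) - slope p M h n a) ^ 2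
              + p a * (2 * (D * (n : ℝ) ^ r) ^ 2)) := by
            refine multi_mono hp0 n fun c _ => ?_
            have h4 := hp.spread h n hn a a₀
            have h5 : (slope p M h n a - slope p M h n a₀) ^ 2 ≤ (D * (n : ℝ) ^ r) ^ 2 := by
              rw [← sq_abs]; gcongr
            have h6 : (meanDiff p M h (c a) - slope p M h n a₀) ^ 2 ≤
                2 * (meanDiff p M h (c a) - slope p M h n a) ^ 2
                  + 2 * (D * (n : ℝ) ^ r) ^ 2 := by
              nlinarith [sq_nonneg ((meanDiff p M h (c a) - slope p M h n a)
                - (slope p M h n a - slope p M h n a₀))]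
            have h7 := mul_le_mul_of_nonneg_left h6 (hp0 a)
            have h8 := mul_le_mul_of_nonneg_right (hp.lt_one a).le
              (by positivity : 0 ≤ 2 * (meanDiff p M h (c a) - slope p M h n a) ^ 2)
            linarith
        _ ≤ _ := by
            rw [multi_add, multi_const_mul, multi_const hp.sum_eq]
            linarith [H₂ h n hn a]
    refine (h2.trans_eq (multi_finset_sum _ _ _)).trans ((Finset.sum_le_sum fun a _ => h3 a).trans ?_)
    rw [Finset.sum_add_distrib, ← Finset.sum_mul (f := p), hp.sum_eq, Finset.sum_const,
      Finset.card_univ, nsmul_eq_mul, ← hA]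
    have h9 : (n : ℝ) ^ (1 - 2 * s) ≤ (n : ℝ) ^ (r + 1 - s) :=
      Real.rpow_le_rpow_of_exponent_le hn' (by linarith [hp.le_r, hp.s_lt])
    -- The spread of the slopes is absorbed because `r ≤ 1 - s`.
    have h10 : ((n : ℝ) ^ r) ^ 2 ≤ (n : ℝ) ^ (r + 1 - s) := by
      rw [← Real.rpow_natCast, ← Real.rpow_mul hn0.le]
      refine Real.rpow_le_rpow_of_exponent_le hn' ?_
      push_cast
      linarith [hp.r_le]
    calc A * (2 * (C₂ * (n : ℝ) ^ (1 - 2 * s))) + 1 * (2 * (D * (n : ℝ) ^ r) ^ 2)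
        = A * (2 * C₂) * (n : ℝ) ^ (1 - 2 * s) + 2 * D ^ 2 * ((n : ℝ) ^ r) ^ 2 := by ring
      _ ≤ A * (2 * C₂) * (n : ℝ) ^ (r + 1 - s) + 2 * D ^ 2 * (n : ℝ) ^ (r + 1 - s) := by gcongr
      _ = _ := by ring
  rw [e3]
  refine (abs_add_le _ _).trans ?_
  rw [abs_mul, abs_of_nonneg hW0, abs_two]
  have hpos : 0 < (n : ℝ) ^ (r + 1 - s) := by positivity
  nlinarith

lemma varSize_eq_zero (hp : NonExplosive p M) (h n : ℕ) (hn : n ≤ 1) : varSize p M h n = 0 := by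
  induction h generalizing n with
  | zero => rfl
  | succ h ih =>
    have h1 : multi p n (fun c => ∑ a, varSize p M h (c a)) = 0 := by
      rw [← multi_const hp.sum_eq n (0 : ℝ)]
      refine multi_congr n fun c hc => Finset.sum_eq_zero fun a _ => ih _ ?_
      exact (Finset.single_le_sum (fun b _ => Nat.zero_le (c b)) (Finset.mem_univ a)).trans
        (hc.le.trans hn)
    have h2 : ∀ c : 𝒜 → ℕ, ∑ a, c a = n → levelMean p M h c = 0 := fun c hc =>
      Finset.sum_eq_zero fun a _ => meanSize_eq_zero hp.sum_eq h _
        ((Finset.single_le_sum (fun b _ => Nat.zero_le (c b)) (Finset.mem_univ a)).trans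
          (hc.le.trans hn))
    have h3 : multiVar p n (levelMean p M h) = 0 := by
      rw [multiVar_eq hp.sum_eq, multi_congr (G := fun _ => 0) n h2, multi_const hp.sum_eq,
        multi_congr (G := fun _ => 0) n fun c hc => by rw [h2 c hc, zero_pow two_ne_zero],
        multi_const hp.sum_eq]
      ring
    rw [varSize, h1, h3]
    ring

lemma varSize_nonneg (hp : NonExplosive p M) (h n : ℕ) : 0 ≤ varSize p M h n := by
  induction h generalizing n with
  | zero => exact le_rfl
  | succ h ih =>
    have hp0 : ∀ b, 0 ≤ p b := fun b => (hp.pos b).le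
    rw [varSize]
    refine mul_nonneg (Nat.cast_nonneg _) (add_nonneg ?_ (multiVar_nonneg hp0 n _))
    exact multi_nonneg hp0 n fun c => Finset.sum_nonneg fun a _ => ih _

/-- Regularity of the variance of the size in the number of labelings. -/
lemma abs_varSize_succ_sub_le (hp : SpreadBound p M s r D) {w : ℝ} (hw : r + 1 - s ≤ w)
    (hw' : 1 - s ≤ w) :
    ∃ C > 0, ∀ h n : ℕ, |varSize p M h (n + 1) - varSize p M h n| ≤ C * (n : ℝ) ^ w := by
  obtain ⟨C₁, hC₁, H₁⟩ := abs_multiVar_levelMean_sub_le hp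
  have hM : (0 : ℝ) < M := by exact_mod_cast hp.one_le
  have hw0 : 0 < w := by linarith [hp.s_lt]
  have hsum : M * ∑ a, p a ^ (2 - s) < 1 := hp.sum_lt
  refine ⟨M * C₁ / (1 - M * ∑ a, p a ^ (2 - s)), div_pos (by positivity) (by linarith),
    fun h n => ?_⟩
  refine le_of_contraction hp.toNonExplosive
    (u := fun h n => |varSize p M h (n + 1) - varSize p M h n|) (K := fun n => (n : ℝ) ^ w)
    (w := p) (r := fun a => p a ^ (min w 1))
    (fun a => (hp.pos a).le) (fun n => by positivity)
    (fun a n => binom_natCast_rpow_le (hp.pos a) (hp.lt_one a).le n hw0.le) ?_ hsum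
    (by positivity) (fun n => by simp [varSize]) (fun h n => ?_) h n
  -- Since `w` and `1` are both at least `1 - s`, the rate is at most `M * ∑ a, p a ^ (2 - s)`.
  · gcongr with a
    rw [mul_comm, ← Real.rpow_add_one (hp.pos a).ne']
    refine Real.rpow_le_rpow_of_exponent_ge (hp.pos a) (hp.lt_one a).le ?_
    have : 1 - s ≤ min w 1 := le_min hw' (by linarith [hp.s_pos])
    linarith
  · have e : varSize p M (h + 1) (n + 1) - varSize p M (h + 1) n =
        M * (multiVar p (n + 1) (levelMean p M h) - multiVar p n (levelMean p M h))
        + M * ∑ a, p a * binom (p a) n (fun k => varSize p M h (k + 1) - varSize p M h k) := by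
      simp only [← binom_succ_sub, Finset.sum_sub_distrib]
      simp only [varSize, multi_finset_sum, multi_apply hp.sum_eq]
      ring
    have e2 : |M * (multiVar p (n + 1) (levelMean p M h) - multiVar p n (levelMean p M h))|
        ≤ M * C₁ * (n : ℝ) ^ w := by
      rw [abs_mul, Nat.abs_cast, mul_assoc]
      gcongr
      -- The bound `n ^ w` vanishes at `n = 0`, so the toll has to vanish there too; it does, since
      -- a G-trie built from at most one labeling is empty.
      rcases Nat.eq_zero_or_pos n with rfl | hn
      · have h1 := varSize_eq_zero hp.toNonExplosive (h + 1) 0 (by norm_num)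
        have h2 := varSize_eq_zero hp.toNonExplosive (h + 1) 1 (by norm_num)
        have hz : ∀ m ≤ 1, multiVar p m (levelMean p M h) = 0 := fun m hm => by
          have h3 := varSize_eq_zero hp.toNonExplosive (h + 1) m hm
          rw [varSize] at h3
          have h4 := multiVar_nonneg (fun b => (hp.pos b).le) m (levelMean p M h)
          have h5 : 0 ≤ multi p m (fun c => ∑ a, varSize p M h (c a)) :=
            multi_nonneg (fun b => (hp.pos b).le) m fun c => Finset.sum_nonneg fun a _ =>
              varSize_nonneg hp.toNonExplosive h _
          rcases mul_eq_zero.1 h3 with h6 | h6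
          · exact absurd h6 hM.ne'
          · linarith
        rw [hz _ (by norm_num), hz _ (by norm_num)]
        simp [Real.zero_rpow hw0.ne']
      · refine (H₁ h n hn).trans ?_
        gcongr
        exact_mod_cast hn
    rw [e]
    refine (abs_add_le _ _).trans (add_le_add e2 ?_)
    rw [abs_mul, Nat.abs_cast]
    gcongr
    refine (Finset.abs_sum_le_sum_abs _ _).trans (Finset.sum_le_sum fun a _ => ?_)
    rw [abs_mul, abs_of_nonneg (hp.pos a).le]
    exact mul_le_mul_of_nonneg_left (abs_binom_le (hp.pos a).le (hp.lt_one a).le _ _) (hp.pos a).le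

end Level


/-! ### Elementary estimates for exponentials and products -/

/-- The point `exp (i x)` of the unit circle. -/
noncomputable def expI (x : ℝ) : ℂ := Complex.exp (Complex.I * x)

lemma norm_expI (x : ℝ) : ‖expI x‖ = 1 := Complex.norm_exp_I_mul_ofReal x

lemma expI_zero : expI 0 = 1 := by simp [expI]

lemma expI_add (x y : ℝ) : expI (x + y) = expI x * expI y := by
  unfold expI
  rw [← Complex.exp_add]
  congr 1; push_cast; ring

lemma expI_sum {β : Type*} (s : Finset β) (x : β → ℝ) :
    expI (∑ b ∈ s, x b) = ∏ b ∈ s, expI (x b) := by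
  unfold expI
  rw [← Complex.exp_sum, Complex.ofReal_sum, Finset.mul_sum]

lemma expI_mul_natCast (x : ℝ) (n : ℕ) : expI (x * n) = expI x ^ n := by
  unfold expI
  rw [← Complex.exp_nat_mul]
  congr 1; push_cast; ring

lemma norm_expI_sub_one_le (x : ℝ) : ‖expI x - 1‖ ≤ |x| := by
  simpa [expI] using Real.norm_exp_I_mul_ofReal_sub_one_le (x := x)

lemma norm_expI_sub_two_le (x : ℝ) : ‖expI x - 1 - Complex.I * x‖ ≤ 3 * x ^ 2 := by
  have hx : ‖Complex.I * x‖ = |x| := by simp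
  rcases le_total |x| 1 with h | h
  · have := Complex.norm_exp_sub_one_sub_id_le (x := Complex.I * x) (by rwa [hx])
    rw [hx, sq_abs] at this
    exact this.trans (by nlinarith [sq_nonneg x])
  · calc ‖expI x - 1 - Complex.I * x‖ ≤ ‖expI x - 1‖ + ‖Complex.I * x‖ := norm_sub_le _ _
      _ ≤ |x| + |x| := add_le_add (norm_expI_sub_one_le x) hx.le
      _ ≤ 3 * x ^ 2 := by rw [← sq_abs]; nlinarith

lemma norm_expI_sub_three_le (x : ℝ) :
    ‖expI x - 1 - Complex.I * x + (x ^ 2 / 2 : ℝ)‖ ≤ 4 * |x| ^ 3 := by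
  have hx : ‖Complex.I * x‖ = |x| := by simp
  rcases le_total |x| 1 with h | h
  · have := Complex.norm_exp_sub_sum_le_norm_mul_exp (Complex.I * x) 3
    rw [hx] at this
    have e : expI x - 1 - Complex.I * x + (x ^ 2 / 2 : ℝ) = Complex.exp (Complex.I * x)
        - ∑ m ∈ Finset.range 3, (Complex.I * x) ^ m / (m.factorial : ℂ) := by
      simp only [Finset.sum_range_succ, expI]
      simp [mul_pow]
      ring
    rw [e]
    refine this.trans ?_
    have h3 : Real.exp |x| ≤ 4 := by
      have h4 := Real.exp_le_exp.2 h
      have := Real.exp_one_lt_d9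
      linarith
    nlinarith [(by positivity : 0 ≤ |x| ^ 3)]
  · calc ‖expI x - 1 - Complex.I * x + (x ^ 2 / 2 : ℝ)‖
        ≤ ‖expI x - 1 - Complex.I * x‖ + ‖((x ^ 2 / 2 : ℝ) : ℂ)‖ := norm_add_le _ _
      _ ≤ 3 * x ^ 2 + x ^ 2 / 2 := by
          refine add_le_add (norm_expI_sub_two_le x) ?_
          rw [Complex.norm_real, Real.norm_of_nonneg (by positivity)]
      _ ≤ 4 * |x| ^ 3 := by rw [← sq_abs]; nlinarith [sq_nonneg |x|]

lemma abs_exp_neg_sub_exp_neg_le {x y : ℝ} (hx : 0 ≤ x) (hy : 0 ≤ y) :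
    |Real.exp (-x) - Real.exp (-y)| ≤ |x - y| := by
  wlog h : x ≤ y generalizing x y
  · rw [abs_sub_comm, abs_sub_comm x]
    exact this hy hx (le_of_not_ge h)
  have h1 : Real.exp (-y) ≤ Real.exp (-x) := Real.exp_le_exp.2 (by linarith)
  rw [abs_of_nonneg (by linarith), abs_sub_comm, abs_of_nonneg (by linarith)]
  have h2 : Real.exp (-y) = Real.exp (-x) * Real.exp (-(y - x)) := by
    rw [← Real.exp_add]; congr 1; ring
  have h3 := Real.one_sub_le_exp_neg (y - x)
  have h4 : Real.exp (-x) ≤ 1 := Real.exp_le_one_iff.2 (by linarith)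
  have h5 := Real.exp_pos (-x)
  rw [h2]
  nlinarith

lemma abs_exp_neg_sub_two_le {x : ℝ} (hx : 0 ≤ x) : |Real.exp (-x) - 1 + x| ≤ x ^ 2 := by
  rcases le_total x 1 with h | h
  · have := Real.abs_exp_sub_one_sub_id_le (x := -x) (by rwa [abs_neg, abs_of_nonneg hx])
    simpa using this
  · have h1 := Real.one_sub_le_exp_neg x
    have h4 : Real.exp (-x) ≤ 1 := Real.exp_le_one_iff.2 (by linarith)
    rw [abs_of_nonneg (by linarith)]
    nlinarith

lemma norm_pow_sub_pow_le {z w : ℂ} (hz : ‖z‖ ≤ 1) (hw : ‖w‖ ≤ 1) (n : ℕ) :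
    ‖z ^ n - w ^ n‖ ≤ n * ‖z - w‖ := by
  induction n with
  | zero => simp
  | succ n ih =>
    have e : z ^ (n + 1) - w ^ (n + 1) = (z ^ n - w ^ n) * z + w ^ n * (z - w) := by ring
    rw [e]
    refine (norm_add_le _ _).trans ?_
    rw [norm_mul, norm_mul, norm_pow]
    have h1 : ‖w‖ ^ n ≤ 1 := pow_le_one₀ (norm_nonneg _) hw
    have h2 := mul_le_of_le_one_right (norm_nonneg (z ^ n - w ^ n)) hz
    have h3 := mul_le_of_le_one_left (norm_nonneg (z - w)) h1
    push_cast
    linarith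

lemma norm_prod_sub_prod_le {β : Type*} (s : Finset β) {z w : β → ℂ}
    (hz : ∀ b, ‖z b‖ ≤ 1) (hw : ∀ b, ‖w b‖ ≤ 1) :
    ‖∏ b ∈ s, z b - ∏ b ∈ s, w b‖ ≤ ∑ b ∈ s, ‖z b - w b‖ := by
  classical
  induction s using Finset.induction_on with
  | empty => simp
  | insert b s hb ih =>
    rw [Finset.prod_insert hb, Finset.prod_insert hb, Finset.sum_insert hb]
    have e : z b * ∏ b ∈ s, z b - w b * ∏ b ∈ s, w b =
        (z b - w b) * ∏ b ∈ s, z b + w b * (∏ b ∈ s, z b - ∏ b ∈ s, w b) := by ring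
    rw [e]
    refine (norm_add_le _ _).trans ?_
    rw [norm_mul, norm_mul, norm_prod]
    have h1 : ∏ b ∈ s, ‖z b‖ ≤ 1 := Finset.prod_le_one (fun _ _ => norm_nonneg _) fun b _ => hz b
    have h2 := mul_le_of_le_one_right (norm_nonneg (z b - w b)) h1
    have h3 := mul_le_of_le_one_left (norm_nonneg (∏ b ∈ s, z b - ∏ b ∈ s, w b)) (hw b)
    linarith

/-! ### Gaussian approximation of a function of multinomial counts -/

section Toll

variable {𝒜 : Type*} [Fintype 𝒜] [DecidableEq 𝒜] {p : 𝒜 → ℝ} {M : ℕ}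

lemma multi_linear (hs : ∑ a, p a = 1) {ξ : 𝒜 → ℝ} (hξ : ∑ a, p a * ξ a = 0) (n : ℕ) :
    multi p n (fun c => ∑ a, ξ a * (c a : ℝ)) = 0 := by
  rw [multi_finset_sum]
  have : ∀ a, multi p n (fun c => ξ a * (c a : ℝ)) = n * (p a * ξ a) := fun a => by
    rw [multi_const_mul, multi_apply hs n a (fun k => (k : ℝ)), binom_id]; ring
  simp only [this, ← Finset.mul_sum, hξ, mul_zero]

lemma multi_sq_linear (hs : ∑ a, p a = 1) {ξ : 𝒜 → ℝ} (hξ : ∑ a, p a * ξ a = 0) (n : ℕ) :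
    multi p n (fun c => (∑ a, ξ a * (c a : ℝ)) ^ 2) = n * ∑ a, p a * ξ a ^ 2 := by
  induction n with
  | zero => simp [multi_zero]
  | succ n ih =>
    have e : ∀ (c : 𝒜 → ℕ) (b : 𝒜), (∑ a, ξ a * (((c + Pi.single b 1 : 𝒜 → ℕ) a : ℕ) : ℝ)) ^ 2 =
        (∑ a, ξ a * (c a : ℝ)) ^ 2 + (2 * ξ b) * (∑ a, ξ a * (c a : ℝ)) + ξ b ^ 2 := fun c b => by
      have : ∑ a, ξ a * (((c + Pi.single b 1 : 𝒜 → ℕ) a : ℕ) : ℝ)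
          = (∑ a, ξ a * (c a : ℝ)) + ξ b := by
        simp [mul_add, Finset.sum_add_distrib, Pi.single_apply]
      rw [this]; ring
    rw [multi_succ]
    simp only [e]
    have e2 : ∀ b, multi p n (fun c => (∑ a, ξ a * (c a : ℝ)) ^ 2
        + (2 * ξ b) * (∑ a, ξ a * (c a : ℝ)) + ξ b ^ 2) = n * (∑ a, p a * ξ a ^ 2) + ξ b ^ 2 :=
      fun b => by
        rw [multi_add, multi_add, multi_const_mul, multi_const hs, multi_linear hs hξ, ih]; ring
    simp only [e2, smul_eq_mul, mul_add, Finset.sum_add_distrib, ← Finset.sum_mul, hs]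
    push_cast
    ring

/-- The characteristic function of a linear statistic with small coefficients is almost Gaussian. -/
lemma norm_multi_expI_linear_sub_le (hp0 : ∀ a, 0 ≤ p a) (hs : ∑ a, p a = 1) {ξ : 𝒜 → ℝ}
    (hξ : ∑ a, p a * ξ a = 0) {δ : ℝ} (hδ : ∀ a, |ξ a| ≤ δ) (t : ℝ) (n : ℕ) :
    ‖multi p n (fun c => expI (t * ∑ a, ξ a * (c a : ℝ)))
      - (Real.exp (-(t ^ 2 / 2 * (n * ∑ a, p a * ξ a ^ 2))) : ℝ)‖ ≤ 6 * n * (|t| * δ) ^ 3 := by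
  set v := ∑ a, p a * ξ a ^ 2 with hv
  have hp1 : ∀ a, p a ≤ 1 := fun a => by
    rw [← hs]; exact Finset.single_le_sum (fun b _ => hp0 b) (Finset.mem_univ a)
  have hv0 : 0 ≤ v := Finset.sum_nonneg fun a _ => mul_nonneg (hp0 a) (sq_nonneg _)
  have e1 : multi p n (fun c => expI (t * ∑ a, ξ a * (c a : ℝ)))
      = (∑ a, (p a : ℂ) * expI (t * ξ a)) ^ n := by
    rw [← multi_prod_pow]
    refine multi_congr n fun c _ => ?_
    rw [Finset.mul_sum, expI_sum]
    refine Finset.prod_congr rfl fun a _ => ?_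
    rw [← mul_assoc, expI_mul_natCast]
  have e2 : ((Real.exp (-(t ^ 2 / 2 * (n * v))) : ℝ) : ℂ)
      = ((Real.exp (-(t ^ 2 / 2 * v)) : ℝ) : ℂ) ^ n := by
    rw [← Complex.ofReal_pow, ← Real.exp_nat_mul]
    congr 2; ring
  rw [e1, e2]
  have hx0 : 0 ≤ t ^ 2 / 2 * v := by positivity
  have hn1 : ‖∑ a, (p a : ℂ) * expI (t * ξ a)‖ ≤ 1 := by
    refine (norm_sum_le _ _).trans (le_of_eq ?_)
    rw [← hs]
    refine Finset.sum_congr rfl fun a _ => ?_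
    rw [norm_mul, norm_expI, Complex.norm_real, Real.norm_of_nonneg (hp0 a), mul_one]
  have hn2 : ‖((Real.exp (-(t ^ 2 / 2 * v)) : ℝ) : ℂ)‖ ≤ 1 := by
    rw [Complex.norm_real, Real.norm_of_nonneg (Real.exp_pos _).le]
    exact Real.exp_le_one_iff.2 (by linarith)
  refine (norm_pow_sub_pow_le hn1 hn2 n).trans ?_
  rw [mul_comm (6 : ℝ), mul_assoc]
  gcongr
  have hδ0 : 0 ≤ |t| * δ := by
    by_cases hA : Nonempty 𝒜
    · obtain ⟨a⟩ := hA
      exact mul_nonneg (abs_nonneg _) ((abs_nonneg _).trans (hδ a))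
    · rw [not_nonempty_iff] at hA
      simp at hs
  have hvδ : t ^ 2 / 2 * v ≤ (|t| * δ) ^ 2 / 2 := by
    have : v ≤ δ ^ 2 := by
      calc v ≤ ∑ a, p a * δ ^ 2 := by
            refine Finset.sum_le_sum fun a _ => mul_le_mul_of_nonneg_left ?_ (hp0 a)
            rw [← sq_abs]
            exact pow_le_pow_left₀ (abs_nonneg _) (hδ a) 2
        _ = δ ^ 2 := by rw [← Finset.sum_mul, hs, one_mul]
    rw [mul_pow, sq_abs]
    nlinarith [sq_nonneg t]
  -- For large coefficients the trivial bound `2` suffices. For small ones expand to third order: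
  -- the first-order term vanishes by centering, and the second-order terms agree.
  rcases le_total 1 (|t| * δ) with hlarge | hsmall
  · refine (norm_sub_le _ _).trans ((add_le_add hn1 hn2).trans ?_)
    have : 1 ≤ (|t| * δ) ^ 3 := one_le_pow₀ hlarge
    linarith
  · have e3 : (∑ a, (p a : ℂ) * expI (t * ξ a)) - (Real.exp (-(t ^ 2 / 2 * v)) : ℝ) =
        ∑ a, (p a : ℂ) * (expI (t * ξ a) - 1 - Complex.I * (t * ξ a : ℝ) + ((t * ξ a) ^ 2 / 2 : ℝ))
        - ((Real.exp (-(t ^ 2 / 2 * v)) - 1 + t ^ 2 / 2 * v : ℝ) : ℂ) := by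
      have h1 : ∑ a, (p a : ℂ) * (expI (t * ξ a) - 1 - Complex.I * (t * ξ a : ℝ)
          + ((t * ξ a) ^ 2 / 2 : ℝ)) = ∑ a, (p a : ℂ) * expI (t * ξ a) - ((∑ a, p a : ℝ) : ℂ)
          - Complex.I * t * ((∑ a, p a * ξ a : ℝ) : ℂ) + (t ^ 2 / 2 : ℂ) * ((v : ℝ) : ℂ) := by
        rw [hv]
        push_cast
        rw [Finset.mul_sum, Finset.mul_sum, ← Finset.sum_sub_distrib, ← Finset.sum_sub_distrib,
          ← Finset.sum_add_distrib]
        exact Finset.sum_congr rfl fun a _ => by ring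
      rw [h1, hs, hξ]
      push_cast
      ring
    rw [e3]
    refine (norm_sub_le _ _).trans ?_
    have h2 : ‖∑ a, (p a : ℂ) * (expI (t * ξ a) - 1 - Complex.I * (t * ξ a : ℝ)
        + ((t * ξ a) ^ 2 / 2 : ℝ))‖ ≤ 4 * (|t| * δ) ^ 3 := by
      calc _ ≤ ∑ a, p a * (4 * (|t| * δ) ^ 3) := by
            refine (norm_sum_le _ _).trans (Finset.sum_le_sum fun a _ => ?_)
            rw [norm_mul, Complex.norm_real, Real.norm_of_nonneg (hp0 a)]
            refine mul_le_mul_of_nonneg_left ?_ (hp0 a)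
            refine (norm_expI_sub_three_le _).trans ?_
            rw [abs_mul]
            gcongr
            exact hδ a
        _ = _ := by rw [← Finset.sum_mul, hs, one_mul]
    have h3 : ‖((Real.exp (-(t ^ 2 / 2 * v)) - 1 + t ^ 2 / 2 * v : ℝ) : ℂ)‖ ≤ (|t| * δ) ^ 3 := by
      rw [Complex.norm_real, Real.norm_eq_abs]
      refine (abs_exp_neg_sub_two_le hx0).trans ?_
      have h5 : (t ^ 2 / 2 * v) ^ 2 ≤ ((|t| * δ) ^ 2 / 2) ^ 2 := by gcongr
      have h6 : (|t| * δ) ^ 4 ≤ (|t| * δ) ^ 3 :=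
        pow_le_pow_of_le_one hδ0 hsmall (by norm_num)
      nlinarith [(by positivity : 0 ≤ (|t| * δ) ^ 4)]
    have h7 : 0 ≤ (|t| * δ) ^ 3 := by positivity
    linarith

lemma norm_exp_neg_le_one {x : ℝ} (hx : 0 ≤ x) : ‖((Real.exp (-x) : ℝ) : ℂ)‖ ≤ 1 := by
  rw [Complex.norm_real, Real.norm_of_nonneg (Real.exp_pos _).le]
  exact Real.exp_le_one_iff.2 (by linarith)

/-- One-level comparison with the Gaussian characteristic function, for a statistic that is the sum
of a linear part and of a small remainder. -/
lemma norm_multi_toll_le (hp0 : ∀ a, 0 ≤ p a) (hs : ∑ a, p a = 1) {ξ : 𝒜 → ℝ}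
    (hξ : ∑ a, p a * ξ a = 0) {δ : ℝ} (hδ : ∀ a, |ξ a| ≤ δ) (t : ℝ) (n : ℕ)
    {g lin R v : (𝒜 → ℕ) → ℝ} (hlin : ∀ c, ∑ a, c a = n → lin c = ∑ a, ξ a * (c a : ℝ))
    (hg : ∀ c, g c = lin c + R c) (hR : multi p n R = 0)
    (hv : ∀ c, 0 ≤ v c) :
    ‖multi p n (fun c => expI (t * g c) * (Real.exp (-(t ^ 2 / 2 * v c)) : ℝ))
      - (Real.exp (-(t ^ 2 / 2 * (multi p n v + multi p n (fun c => g c ^ 2)))) : ℝ)‖ ≤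
    t ^ 2 * (multi p n (fun c => |v c - multi p n v|)
      + 4 * (√(multi p n (fun c => lin c ^ 2)) * √(multi p n (fun c => R c ^ 2)))
      + 4 * multi p n (fun c => R c ^ 2)) + 6 * n * (|t| * δ) ^ 3 := by
  set m := multi p n v with hm
  set G2 := multi p n (fun c => g c ^ 2) with hG2
  set X := multi p n (fun c => |lin c| * |R c|) with hX
  set R2 := multi p n (fun c => R c ^ 2) with hR2
  have hX0 : 0 ≤ X := multi_nonneg hp0 n fun c => by positivity
  have hR20 : 0 ≤ R2 := multi_nonneg hp0 n fun c => by positivity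
  have hXle := multi_abs_mul_le hp0 n lin R
  rw [← hX, ← hR2] at hXle
  have hm0 : 0 ≤ m := multi_nonneg hp0 n hv
  have hG20 : 0 ≤ G2 := multi_nonneg hp0 n fun c => sq_nonneg _
  have hlin2 : multi p n (fun c => lin c ^ 2) = n * ∑ a, p a * ξ a ^ 2 := by
    rw [← multi_sq_linear hs hξ]
    exact multi_congr n fun c hc => by rw [hlin c hc]
  have s1 : ‖multi p n (fun c => expI (t * g c) * (Real.exp (-(t ^ 2 / 2 * v c)) : ℝ))
      - multi p n (fun c => expI (t * g c) * (Real.exp (-(t ^ 2 / 2 * m)) : ℝ))‖ ≤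
      t ^ 2 / 2 * multi p n (fun c => |v c - m|) := by
    rw [← multi_sub, ← multi_const_mul n (t ^ 2 / 2) (fun c => |v c - m|)]
    refine (norm_multi_le hp0 n _).trans (multi_mono hp0 n fun c _ => ?_)
    rw [← mul_sub, norm_mul, norm_expI, one_mul, ← Complex.ofReal_sub, Complex.norm_real,
      Real.norm_eq_abs]
    refine (abs_exp_neg_sub_exp_neg_le (mul_nonneg (by positivity) (hv c)) (by positivity)).trans ?_
    rw [← mul_sub, abs_mul, abs_of_nonneg (by positivity)]
  -- As `R` has mean zero, `I * t * R` can be subtracted for free. It then comes multiplied by `expI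
  -- (t * lin) - 1`, so the error is quadratic in `t`.
  have s2 : ‖multi p n (fun c => expI (t * g c)) - multi p n (fun c => expI (t * lin c))‖ ≤
      t ^ 2 * (X + 3 * R2) := by
    have e : multi p n (fun c => expI (t * g c)) - multi p n (fun c => expI (t * lin c)) =
        multi p n (fun c => expI (t * lin c) * (expI (t * R c) - 1 - Complex.I * (t * R c : ℝ))
          + (expI (t * lin c) - 1) * (Complex.I * (t * R c : ℝ))) := by
      have h0 : multi p n (fun c => (Complex.I * t) * (R c : ℂ)) = 0 := by
        rw [multi_const_mul', multi_ofReal, hR]; simp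
      rw [← multi_sub, ← add_zero (multi p n (fun c => expI (t * lin c)
        * (expI (t * R c) - 1 - Complex.I * (t * R c : ℝ))
          + (expI (t * lin c) - 1) * (Complex.I * (t * R c : ℝ)))), ← h0, ← multi_add]
      refine multi_congr n fun c _ => ?_
      rw [hg, mul_add, expI_add]
      push_cast
      ring
    rw [e]
    calc _ ≤ multi p n (fun c => t ^ 2 * (|lin c| * |R c|) + (3 * t ^ 2) * R c ^ 2) := by
          refine (norm_multi_le hp0 n _).trans (multi_mono hp0 n fun c _ => ?_)
          refine (norm_add_le _ _).trans ?_
          rw [norm_mul, norm_mul, norm_expI, one_mul, norm_mul, Complex.norm_I, one_mul,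
            Complex.norm_real, Real.norm_eq_abs]
          have h1 := norm_expI_sub_two_le (t * R c)
          have h2 := norm_expI_sub_one_le (t * lin c)
          have h3 := mul_le_mul_of_nonneg_right h2 (abs_nonneg (t * R c))
          have h4 : |t * lin c| * |t * R c| = t ^ 2 * (|lin c| * |R c|) := by
            rw [abs_mul, abs_mul, ← sq_abs t]; ring
          rw [h4] at h3
          have h5 : 3 * (t * R c) ^ 2 = (3 * t ^ 2) * R c ^ 2 := by ring
          linarith
      _ = _ := by rw [multi_add, multi_const_mul, multi_const_mul]; ring
  have s3 : ‖multi p n (fun c => expI (t * lin c))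
      - (Real.exp (-(t ^ 2 / 2 * (n * ∑ a, p a * ξ a ^ 2))) : ℝ)‖ ≤ 6 * n * (|t| * δ) ^ 3 := by
    rw [multi_congr (F := fun c => expI (t * lin c))
      (G := fun c => expI (t * ∑ a, ξ a * (c a : ℝ))) n fun c hc => by rw [hlin c hc]]
    exact norm_multi_expI_linear_sub_le hp0 hs hξ hδ t n
  -- Exchange the variance of the linear part for the second moment of `g`.
  have s4 : ‖((Real.exp (-(t ^ 2 / 2 * (n * ∑ a, p a * ξ a ^ 2))) : ℝ) : ℂ)
      - ((Real.exp (-(t ^ 2 / 2 * G2)) : ℝ) : ℂ)‖ ≤ t ^ 2 / 2 * (2 * X + R2) := by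
    rw [← hlin2, ← Complex.ofReal_sub, Complex.norm_real, Real.norm_eq_abs]
    refine (abs_exp_neg_sub_exp_neg_le (mul_nonneg (by positivity)
      (multi_nonneg hp0 n fun c => sq_nonneg _)) (by positivity)).trans ?_
    rw [← mul_sub, abs_mul, abs_of_nonneg (by positivity : 0 ≤ t ^ 2 / 2)]
    gcongr
    rw [hG2, ← multi_sub]
    calc _ ≤ multi p n (fun c => 2 * (|lin c| * |R c|) + R c ^ 2) := by
          refine (abs_multi_le hp0 n _).trans (multi_mono hp0 n fun c _ => ?_)
          rw [hg, ← abs_mul]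
          have : lin c ^ 2 - (lin c + R c) ^ 2 = -(2 * (lin c * R c)) - R c ^ 2 := by ring
          rw [this]
          refine (abs_sub _ _).trans ?_
          rw [abs_neg, abs_mul, abs_two, abs_of_nonneg (sq_nonneg (R c))]
      _ = _ := by rw [multi_add, multi_const_mul]
  have s5 : ‖multi p n (fun c => expI (t * g c)) - ((Real.exp (-(t ^ 2 / 2 * G2)) : ℝ) : ℂ)‖ ≤
      t ^ 2 * (X + 3 * R2) + 6 * n * (|t| * δ) ^ 3 + t ^ 2 / 2 * (2 * X + R2) := by
    refine (norm_sub_le_norm_sub_add_norm_sub _ _ _).trans (add_le_add ?_ s4)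
    exact (norm_sub_le_norm_sub_add_norm_sub _ _ _).trans (add_le_add s2 s3)
  have s6 : ‖multi p n (fun c => expI (t * g c) * (Real.exp (-(t ^ 2 / 2 * m)) : ℝ))
      - (Real.exp (-(t ^ 2 / 2 * (m + G2))) : ℝ)‖ ≤
      t ^ 2 * (X + 3 * R2) + 6 * n * (|t| * δ) ^ 3 + t ^ 2 / 2 * (2 * X + R2) := by
    have h1 : multi p n (fun c => expI (t * g c) * ((Real.exp (-(t ^ 2 / 2 * m)) : ℝ) : ℂ))
        = ((Real.exp (-(t ^ 2 / 2 * m)) : ℝ) : ℂ) * multi p n (fun c => expI (t * g c)) := by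
      rw [← multi_const_mul']
      exact multi_congr n fun c _ => mul_comm _ _
    have h2 : ((Real.exp (-(t ^ 2 / 2 * (m + G2))) : ℝ) : ℂ) =
        ((Real.exp (-(t ^ 2 / 2 * m)) : ℝ) : ℂ) * ((Real.exp (-(t ^ 2 / 2 * G2)) : ℝ) : ℂ) := by
      rw [← Complex.ofReal_mul, ← Real.exp_add]
      congr 2; ring
    rw [h1, h2, ← mul_sub, norm_mul]
    exact (mul_le_of_le_one_left (norm_nonneg _) (norm_exp_neg_le_one (by positivity))).trans s5
  refine (norm_sub_le_norm_sub_add_norm_sub _ _ _).trans ((add_le_add s1 s6).trans ?_)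
  have hV0 : 0 ≤ multi p n (fun c => |v c - m|) := multi_nonneg hp0 n fun c => abs_nonneg _
  have ht2 : 0 ≤ t ^ 2 := sq_nonneg t
  have f1 := mul_le_mul_of_nonneg_left hXle ht2
  have f2 := mul_nonneg ht2 hV0
  have f3 := mul_nonneg ht2 hR20
  have f4 := mul_nonneg ht2 hX0
  linarith

/-- One-level comparison with the Gaussian characteristic function: crude third-order bound. -/
lemma norm_multi_toll_le_crude (hp0 : ∀ a, 0 ≤ p a) (hs : ∑ a, p a = 1) {t : ℝ} (ht : |t| ≤ 1)
    (n : ℕ) {g v : (𝒜 → ℕ) → ℝ} (hg0 : multi p n g = 0) (hv : ∀ c, 0 ≤ v c) {A B : ℝ}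
    (hA : ∀ c, ∑ a, c a = n → |g c| ≤ A) (hB : ∀ c, ∑ a, c a = n → v c ≤ B)
    (hA0 : 0 ≤ A) (hB0 : 0 ≤ B) :
    ‖multi p n (fun c => expI (t * g c) * (Real.exp (-(t ^ 2 / 2 * v c)) : ℝ))
      - (Real.exp (-(t ^ 2 / 2 * (multi p n v + multi p n (fun c => g c ^ 2)))) : ℝ)‖ ≤
    |t| ^ 3 * (B ^ 2 + 4 * A ^ 3 + A * B + (B + A ^ 2) ^ 2) := by
  set m := multi p n v with hm
  set G2 := multi p n (fun c => g c ^ 2) with hG2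
  have hm0 : 0 ≤ m := multi_nonneg hp0 n hv
  have hG20 : 0 ≤ G2 := multi_nonneg hp0 n fun c => sq_nonneg _
  have hmB : m ≤ B := by
    rw [← multi_const hs n B]
    exact multi_mono hp0 n hB
  have hGA : G2 ≤ A ^ 2 := by
    rw [← multi_const hs n (A ^ 2)]
    refine multi_mono hp0 n fun c hc => ?_
    rw [← sq_abs]
    have := hA c hc
    gcongr
  have ht0 := abs_nonneg t
  have ht4 : |t| ^ 4 ≤ |t| ^ 3 := pow_le_pow_of_le_one ht0 ht (by norm_num)
  -- Subtract the Taylor polynomials of degree two in `t`. They agree on both sides because `g` is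
  -- centered, so only terms of order `|t| ^ 3` and higher remain.
  have e : multi p n (fun c => expI (t * g c) * (Real.exp (-(t ^ 2 / 2 * v c)) : ℝ))
      - (Real.exp (-(t ^ 2 / 2 * (m + G2))) : ℝ) =
      multi p n (fun c => expI (t * g c) * ((Real.exp (-(t ^ 2 / 2 * v c)) - 1 + t ^ 2 / 2 * v c : ℝ) : ℂ)
        + (expI (t * g c) - 1 - Complex.I * (t * g c : ℝ) + ((t * g c) ^ 2 / 2 : ℝ))
        - ((t ^ 2 / 2 * v c : ℝ) : ℂ) * (expI (t * g c) - 1))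
      - ((Real.exp (-(t ^ 2 / 2 * (m + G2))) - 1 + t ^ 2 / 2 * (m + G2) : ℝ) : ℂ) := by
    have h1 : multi p n (fun c => (1 + (Complex.I * t) * (g c : ℂ))
        - ((t ^ 2 / 2 : ℝ) : ℂ) * ((v c + g c ^ 2 : ℝ) : ℂ)) = 1 - ((t ^ 2 / 2 * (m + G2) : ℝ) : ℂ) := by
      rw [multi_sub, multi_add, multi_const hs, multi_const_mul', multi_const_mul', multi_ofReal,
        multi_ofReal, multi_add, hg0, ← hm, ← hG2]
      push_cast
      ring
    have h2 : (fun c => expI (t * g c) * ((Real.exp (-(t ^ 2 / 2 * v c)) : ℝ) : ℂ)) = fun c =>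
      (expI (t * g c) * ((Real.exp (-(t ^ 2 / 2 * v c)) - 1 + t ^ 2 / 2 * v c : ℝ) : ℂ)
        + (expI (t * g c) - 1 - Complex.I * (t * g c : ℝ) + ((t * g c) ^ 2 / 2 : ℝ))
        - ((t ^ 2 / 2 * v c : ℝ) : ℂ) * (expI (t * g c) - 1)) +
        ((1 + (Complex.I * t) * (g c : ℂ))
        - ((t ^ 2 / 2 : ℝ) : ℂ) * ((v c + g c ^ 2 : ℝ) : ℂ)) := by
      ext c
      push_cast
      ring
    rw [h2, multi_add, h1]
    push_cast
    ring
  rw [e]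
  have f1 : ‖multi p n (fun c => expI (t * g c) * ((Real.exp (-(t ^ 2 / 2 * v c)) - 1 + t ^ 2 / 2 * v c : ℝ) : ℂ)
        + (expI (t * g c) - 1 - Complex.I * (t * g c : ℝ) + ((t * g c) ^ 2 / 2 : ℝ))
        - ((t ^ 2 / 2 * v c : ℝ) : ℂ) * (expI (t * g c) - 1))‖ ≤
        |t| ^ 3 * (B ^ 2 + 4 * A ^ 3 + A * B) := by
    rw [← multi_const hs n (|t| ^ 3 * (B ^ 2 + 4 * A ^ 3 + A * B))]
    refine (norm_multi_le hp0 n _).trans (multi_mono hp0 n fun c hc => ?_)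
    refine (norm_sub_le _ _).trans ((add_le_add_left (norm_add_le _ _) _).trans ?_)
    have hvc := hv c
    have hx0 : 0 ≤ t ^ 2 / 2 * v c := by positivity
    rw [norm_mul, norm_expI, one_mul, norm_mul, Complex.norm_real, Complex.norm_real,
      Real.norm_eq_abs, Real.norm_of_nonneg hx0]
    have k1 := abs_exp_neg_sub_two_le hx0
    have k2 := norm_expI_sub_three_le (t * g c)
    have k3 := norm_expI_sub_one_le (t * g c)
    have hAc := hA c hc
    have hBc := hB c hc
    have k4 : (t ^ 2 / 2 * v c) ^ 2 ≤ |t| ^ 3 * B ^ 2 := by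
      calc (t ^ 2 / 2 * v c) ^ 2 = |t| ^ 4 * (v c ^ 2 / 4) := by
            rw [← sq_abs t]; ring
        _ ≤ |t| ^ 3 * B ^ 2 := by
            have : v c ^ 2 ≤ B ^ 2 := by gcongr
            gcongr
            nlinarith [sq_nonneg (v c)]
    have k5 : 4 * |t * g c| ^ 3 ≤ |t| ^ 3 * (4 * A ^ 3) := by
      rw [abs_mul, mul_pow]
      have : |g c| ^ 3 ≤ A ^ 3 := by gcongr
      nlinarith [(by positivity : 0 ≤ |t| ^ 3)]
    have k6 : t ^ 2 / 2 * v c * ‖expI (t * g c) - 1‖ ≤ |t| ^ 3 * (A * B) := by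
      calc t ^ 2 / 2 * v c * ‖expI (t * g c) - 1‖ ≤ t ^ 2 / 2 * v c * |t * g c| := by gcongr
        _ = |t| ^ 3 * (|g c| * (v c / 2)) := by rw [abs_mul, ← sq_abs t]; ring
        _ ≤ |t| ^ 3 * (A * B) := by
            gcongr
            linarith
    linarith
  have f2 : ‖((Real.exp (-(t ^ 2 / 2 * (m + G2))) - 1 + t ^ 2 / 2 * (m + G2) : ℝ) : ℂ)‖ ≤
      |t| ^ 3 * (B + A ^ 2) ^ 2 := by
    have hx0 : 0 ≤ t ^ 2 / 2 * (m + G2) := by positivity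
    rw [Complex.norm_real, Real.norm_eq_abs]
    refine (abs_exp_neg_sub_two_le hx0).trans ?_
    calc (t ^ 2 / 2 * (m + G2)) ^ 2 = |t| ^ 4 * ((m + G2) ^ 2 / 4) := by rw [← sq_abs t]; ring
      _ ≤ |t| ^ 3 * (B + A ^ 2) ^ 2 := by
          have : (m + G2) ^ 2 ≤ (B + A ^ 2) ^ 2 := by gcongr
          gcongr
          nlinarith [sq_nonneg (m + G2)]
  refine (norm_sub_le _ _).trans ((add_le_add f1 f2).trans (le_of_eq ?_))
  ring

end Toll


/-! ### Gaussian comparison for the truncated size -/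

section CharFun

variable {𝒜 : Type*} [Fintype 𝒜] [DecidableEq 𝒜] {p : 𝒜 → ℝ} {M : ℕ} {s r D w : ℝ}

/-- The sum of the variances of the sizes of the subtries. -/
noncomputable def levelVar (p : 𝒜 → ℝ) (M h : ℕ) (c : 𝒜 → ℕ) : ℝ := ∑ a, varSize p M h (c a)

lemma levelVar_nonneg (hp : NonExplosive p M) (h : ℕ) (c : 𝒜 → ℕ) : 0 ≤ levelVar p M h c :=
  Finset.sum_nonneg fun _ _ => varSize_nonneg hp h _

/-- The characteristic function of the number of nodes at depth `< h` of the G-trie built from `n`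
random labelings. -/
noncomputable def charSize (p : 𝒜 → ℝ) (M : ℕ) : ℕ → ℕ → ℝ → ℂ
  | 0, _, _ => 1
  | h + 1, n, t => expI (t * if 2 ≤ n then 1 else 0) *
      multi p n (fun c => ∏ a, charSize p M h (c a) t) ^ M

/-- The difference of the characteristic function of a Gaussian variable and of the
corresponding mixture over one level of the G-trie. -/
noncomputable def levelToll (p : 𝒜 → ℝ) (M h n : ℕ) (t : ℝ) : ℂ :=
  multi p n (fun c => expI (t * (levelMean p M h c - multi p n (levelMean p M h)))
      * (Real.exp (-(t ^ 2 / 2 * levelVar p M h c)) : ℝ))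
    - (Real.exp (-(t ^ 2 / 2 * (multi p n (levelVar p M h)
      + multiVar p n (levelMean p M h)))) : ℝ)

lemma abs_sub_le_of_abs_succ_sub_le {u : ℕ → ℝ} {C w : ℝ} (hC : 0 ≤ C) (hw : 0 ≤ w)
    (hu : ∀ n, |u (n + 1) - u n| ≤ C * (n : ℝ) ^ w) {n a b : ℕ} (ha : a ≤ n) (hb : b ≤ n) :
    |u a - u b| ≤ C * |(a : ℝ) - b| * (n : ℝ) ^ w := by
  wlog hab : b ≤ a generalizing a b
  · rw [abs_sub_comm, abs_sub_comm (a : ℝ)]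
    exact this hb ha (by omega)
  induction a, hab using Nat.le_induction with
  | base => simp
  | succ a hab ih =>
    have hab' : (0 : ℝ) ≤ (a : ℝ) - b := by
      have : (b : ℝ) ≤ a := by exact_mod_cast hab
      linarith
    have ih' := ih (by omega)
    have h1 : (a : ℝ) ^ w ≤ (n : ℝ) ^ w := by
      gcongr; omega
    have h2 := hu a
    rw [abs_of_nonneg hab'] at ih'
    push_cast
    rw [abs_of_nonneg (by linarith : 0 ≤ (a : ℝ) + 1 - b)]
    have e : u (a + 1) - u b = (u (a + 1) - u a) + (u a - u b) := by ring
    rw [e]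
    refine (abs_add_le _ _).trans ((add_le_add h2 ih').trans ?_)
    have := mul_le_mul_of_nonneg_left h1 hC
    linarith

lemma floor_mul_le {x : ℝ} (hx : x ≤ 1) (n : ℕ) : ⌊n * x⌋₊ ≤ n := by
  refine Nat.floor_le_of_le ?_
  exact mul_le_of_le_one_right (Nat.cast_nonneg n) hx

/-- `varSize` has increments of order `n ^ w`, and the counts deviate from their means by about
`√n`. -/
lemma multi_abs_levelVar_sub_le (hp : SpreadBound p M s r D) (hw : r + 1 - s ≤ w)
    (hw' : 1 - s ≤ w) :
    ∃ C > 0, ∀ h n : ℕ, 1 ≤ n →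
      multi p n (fun c => |levelVar p M h c - multi p n (levelVar p M h)|)
        ≤ C * (n : ℝ) ^ (w + 1 / 2) := by
  obtain ⟨C, hC, H⟩ := abs_varSize_succ_sub_le hp hw hw'
  have hp0 : ∀ b, 0 ≤ p b := fun b => (hp.pos b).le
  have hw0 : 0 ≤ w := by linarith [hp.s_lt]
  set A : ℝ := (Fintype.card 𝒜 : ℝ) with hA
  refine ⟨2 * (A * (C * 2)) + 1, by positivity, fun h n hn => ?_⟩
  have hn' : (0 : ℝ) < n := by exact_mod_cast hn
  set v₀ := ∑ a, varSize p M h ⌊n * p a⌋₊ with hv₀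
  have h1 : multi p n (fun c => |levelVar p M h c - v₀|) ≤ A * (C * 2) * (n : ℝ) ^ (w + 1 / 2) := by
    have h2 : ∀ a, multi p n (fun c => C * (n : ℝ) ^ w * |(c a : ℝ) - (⌊n * p a⌋₊ : ℝ)|)
        ≤ C * 2 * (n : ℝ) ^ (w + 1 / 2) := fun a => by
      rw [multi_const_mul]
      have h3 := (multi_abs_le_sqrt hp0 hp.sum_eq n
        (fun c => (c a : ℝ) - (⌊n * p a⌋₊ : ℝ))).trans
        (Real.sqrt_le_sqrt (multi_sq_sub_floor_le hp.toNonExplosive hn a))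
      have h4 : √(4 * (n : ℝ)) = 2 * (n : ℝ) ^ (1 / 2 : ℝ) := by
        rw [Real.sqrt_mul (by norm_num), Real.sqrt_eq_rpow (n : ℝ)]
        congr 1
        rw [show (4 : ℝ) = 2 ^ 2 by norm_num, Real.sqrt_sq (by norm_num)]
      rw [h4] at h3
      calc _ ≤ C * (n : ℝ) ^ w * (2 * (n : ℝ) ^ (1 / 2 : ℝ)) := by gcongr
        _ = _ := by rw [Real.rpow_add hn']; ring
    calc multi p n (fun c => |levelVar p M h c - v₀|)
        ≤ multi p n (fun c => ∑ a, C * (n : ℝ) ^ w * |(c a : ℝ) - (⌊n * p a⌋₊ : ℝ)|) := by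
          refine multi_mono hp0 n fun c hc => ?_
          rw [levelVar, hv₀, ← Finset.sum_sub_distrib]
          refine (Finset.abs_sum_le_sum_abs _ _).trans (Finset.sum_le_sum fun a _ => ?_)
          refine (abs_sub_le_of_abs_succ_sub_le hC.le hw0 (H h) (n := n) ?_ ?_).trans
            (le_of_eq (by ring))
          · rw [← hc]; exact Finset.single_le_sum (fun b _ => Nat.zero_le (c b)) (Finset.mem_univ a)
          · exact floor_mul_le (hp.lt_one a).le n
      _ ≤ ∑ _a : 𝒜, C * 2 * (n : ℝ) ^ (w + 1 / 2) := by
          rw [multi_finset_sum]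
          exact Finset.sum_le_sum fun a _ => h2 a
      _ = _ := by
          rw [Finset.sum_const, Finset.card_univ, nsmul_eq_mul, ← hA]; ring
  have h5 : |multi p n (levelVar p M h) - v₀| ≤ multi p n (fun c => |levelVar p M h c - v₀|) := by
    have := abs_multi_le hp0 n (fun c => levelVar p M h c - v₀)
    rwa [multi_sub, multi_const hp.sum_eq] at this
  calc multi p n (fun c => |levelVar p M h c - multi p n (levelVar p M h)|)
      ≤ multi p n (fun c => |levelVar p M h c - v₀| + |multi p n (levelVar p M h) - v₀|) := by
        refine multi_mono hp0 n fun c _ => ?_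
        have := abs_sub (levelVar p M h c - v₀) (multi p n (levelVar p M h) - v₀)
        rwa [sub_sub_sub_cancel_right] at this
    _ ≤ 2 * (A * (C * 2)) * (n : ℝ) ^ (w + 1 / 2) := by
        rw [multi_add, multi_const hp.sum_eq]
        linarith
    _ ≤ _ := by gcongr; linarith

/-- The term in `t ^ 2` collects the fluctuation of the conditional variance, the product of the
linear part with the remainder, and the square of the remainder; the lower bounds on `w` and `r` put
all three below `n ^ (w + 1 / 2)`. The term in `|t| ^ 3` is the third-order error of `n` independent
summands of size `n ^ r`. -/
lemma norm_levelToll_le (hp : SpreadBound p M s r D) (hw : r + 1 - s ≤ w) (hw' : 1 - s ≤ w) :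
    ∃ C > 0, ∀ h n : ℕ, 1 ≤ n → ∀ t : ℝ,
      ‖levelToll p M h n t‖ ≤
        C * (t ^ 2 * (n : ℝ) ^ (w + 1 / 2) + |t| ^ 3 * (n : ℝ) ^ (3 * r + 1)) := by
  obtain ⟨C₁, hC₁, H₁⟩ := multi_abs_levelVar_sub_le hp hw hw'
  obtain ⟨C₂, hC₂, H₂⟩ := multi_sq_levelLin_le hp
  obtain ⟨C₃, hC₃, H₃⟩ := multi_sq_levelRem_le hp.toNonExplosive hp.s_pos.le hp.s_lt hp.sum_lt
  have hp0 : ∀ b, 0 ≤ p b := fun b => (hp.pos b).le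
  refine ⟨C₁ + 4 * (√C₂ * √C₃) + 4 * C₃ + 6 * D ^ 3, by have := hp.D_nonneg; positivity,
    fun h n hn t => ?_⟩
  have hn' : (1 : ℝ) ≤ n := by exact_mod_cast hn
  have hn0 : (0 : ℝ) < n := by linarith
  -- Subtracting the mean slope leaves the linear part unchanged, centers the coefficients, and
  -- bounds them by the spread.
  set b := ∑ a, p a * slope p M h n a with hb
  have hξ : ∑ a, p a * (slope p M h n a - b) = 0 := by
    simp only [mul_sub, Finset.sum_sub_distrib, ← Finset.sum_mul, hp.sum_eq, ← hb]
    ring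
  have hδ : ∀ a, |slope p M h n a - b| ≤ D * (n : ℝ) ^ r := fun a => by
    have e : slope p M h n a - b = ∑ a', p a' * (slope p M h n a - slope p M h n a') := by
      simp only [mul_sub, Finset.sum_sub_distrib, ← Finset.sum_mul, hp.sum_eq, ← hb]
      ring
    rw [e]
    calc _ ≤ ∑ a', p a' * (D * (n : ℝ) ^ r) := by
          refine (Finset.abs_sum_le_sum_abs _ _).trans (Finset.sum_le_sum fun a' _ => ?_)
          rw [abs_mul, abs_of_nonneg (hp0 a')]
          exact mul_le_mul_of_nonneg_left (hp.spread h n hn a a') (hp0 a')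
      _ = _ := by rw [← Finset.sum_mul, hp.sum_eq, one_mul]
  have hlin : ∀ c : 𝒜 → ℕ, ∑ a, c a = n →
      levelLin p M h n c = ∑ a, (slope p M h n a - b) * (c a : ℝ) := fun c hc => by
    have hc' : (∑ a, (c a : ℝ)) = n := by rw [← Nat.cast_sum, hc]
    simp only [levelLin, mul_sub, sub_mul, Finset.sum_sub_distrib, ← Finset.mul_sum, hc']
    rw [hb, Finset.sum_mul]
    congr 1
    exact Finset.sum_congr rfl fun a _ => by ring
  have h1 := norm_multi_toll_le hp0 hp.sum_eq hξ hδ t n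
    (g := fun c => levelMean p M h c - multi p n (levelMean p M h))
    (lin := levelLin p M h n) (R := levelRem p M h n) (v := levelVar p M h)
    hlin (fun c => by unfold levelRem; ring) (multi_levelRem hp.toNonExplosive h n)
    (levelVar_nonneg hp.toNonExplosive h)
  refine h1.trans ?_
  have k1 := H₁ h n hn
  have hβ : 2 - 2 * s ≤ w + 1 / 2 := by linarith [hp.le_r]
  have k3 : multi p n (fun c => levelRem p M h n c ^ 2) ≤ C₃ * (n : ℝ) ^ (w + 1 / 2) :=
    (H₃ h n hn).trans (by gcongr)
  have k2 : √(multi p n (fun c => levelLin p M h n c ^ 2))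
      * √(multi p n (fun c => levelRem p M h n c ^ 2)) ≤ √C₂ * √C₃ * (n : ℝ) ^ (w + 1 / 2) := by
    calc _ ≤ √(C₂ * (n : ℝ) ^ (2 * r + 1)) * √(C₃ * (n : ℝ) ^ (2 - 2 * s)) := by
          gcongr
          exacts [H₂ h n hn, H₃ h n hn]
      _ = √C₂ * √C₃ * ((n : ℝ) ^ ((2 * r + 1) / 2) * (n : ℝ) ^ ((2 - 2 * s) / 2)) := by
          rw [Real.sqrt_mul hC₂.le, Real.sqrt_mul hC₃.le, Real.sqrt_eq_rpow ((n : ℝ) ^ (2 * r + 1)),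
            Real.sqrt_eq_rpow ((n : ℝ) ^ (2 - 2 * s)), ← Real.rpow_mul hn0.le,
            ← Real.rpow_mul hn0.le]
          ring_nf
      _ ≤ _ := by
          rw [← Real.rpow_add hn0]
          refine mul_le_mul_of_nonneg_left (Real.rpow_le_rpow_of_exponent_le hn' ?_) (by positivity)
          linarith
  have k4 : 6 * n * (|t| * (D * (n : ℝ) ^ r)) ^ 3 = 6 * D ^ 3 * (|t| ^ 3 * (n : ℝ) ^ (3 * r + 1)) := by
    have : (n : ℝ) ^ (3 * r + 1) = ((n : ℝ) ^ r) ^ 3 * n := by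
      rw [← Real.rpow_natCast, ← Real.rpow_mul hn0.le, ← Real.rpow_add_one hn0.ne']
      congr 1; push_cast; ring
    rw [this]; ring
  rw [k4]
  have hD := hp.D_nonneg
  have q1 : 0 ≤ t ^ 2 * (n : ℝ) ^ (w + 1 / 2) := by positivity
  have q2 : 0 ≤ |t| ^ 3 * (n : ℝ) ^ (3 * r + 1) := by positivity
  have q3 : multi p n (fun c => |levelVar p M h c - multi p n (levelVar p M h)|)
      + 4 * (√(multi p n (fun c => levelLin p M h n c ^ 2))
        * √(multi p n (fun c => levelRem p M h n c ^ 2)))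
      + 4 * multi p n (fun c => levelRem p M h n c ^ 2) ≤
      (C₁ + 4 * (√C₂ * √C₃) + 4 * C₃) * (n : ℝ) ^ (w + 1 / 2) := by linarith
  calc _ ≤ t ^ 2 * ((C₁ + 4 * (√C₂ * √C₃) + 4 * C₃) * (n : ℝ) ^ (w + 1 / 2))
        + 6 * D ^ 3 * (|t| ^ 3 * (n : ℝ) ^ (3 * r + 1)) := by gcongr
    _ = (C₁ + 4 * (√C₂ * √C₃) + 4 * C₃) * (t ^ 2 * (n : ℝ) ^ (w + 1 / 2))
        + 6 * D ^ 3 * (|t| ^ 3 * (n : ℝ) ^ (3 * r + 1)) := by ring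
    _ ≤ _ := by
        have q4 : 0 ≤ C₁ + 4 * (√C₂ * √C₃) + 4 * C₃ := by positivity
        have q5 : 0 ≤ 6 * D ^ 3 := by positivity
        nlinarith [mul_nonneg q4 q2, mul_nonneg q5 q1]

lemma abs_meanSize_le (hp : SpreadBound p M s r D) :
    ∃ C > 0, ∀ h n : ℕ, |meanSize p M h n| ≤ C * (n : ℝ) ^ 2 := by
  obtain ⟨C, hC, H⟩ := meanDiff_le (y := 2 - s) hp.toNonExplosive (by linarith [hp.s_lt])
    (by linarith [hp.s_pos]) hp.sum_lt
  refine ⟨C, hC, fun h n => ?_⟩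
  have h1 := abs_sub_le_of_abs_succ_sub_le (u := meanSize p M h) (w := 2 - s - 1) (n := n) (a := n)
    (b := 0) hC.le (by linarith [hp.s_lt]) (fun k => by
      have h2 := meanDiff_nonneg hp.toNonExplosive h k
      have h3 := H h k
      unfold meanDiff at h2 h3
      rwa [abs_of_nonneg h2]) le_rfl (Nat.zero_le n)
  rw [meanSize_eq_zero hp.sum_eq h 0 (by norm_num)] at h1
  simp only [Nat.cast_zero, sub_zero, Nat.abs_cast] at h1
  refine h1.trans ?_
  rcases Nat.eq_zero_or_pos n with rfl | hn
  · simp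
  have hn' : (1 : ℝ) ≤ n := by exact_mod_cast hn
  have : (n : ℝ) ^ (2 - s - 1) ≤ (n : ℝ) ^ (1 : ℝ) :=
    Real.rpow_le_rpow_of_exponent_le hn' (by linarith [hp.s_pos])
  rw [Real.rpow_one] at this
  rw [sq, ← mul_assoc]
  gcongr

lemma varSize_le (hp : SpreadBound p M s r D) :
    ∃ C > 0, ∀ h n : ℕ, varSize p M h n ≤ C * (n : ℝ) ^ 3 := by
  have hw : r + 1 - s ≤ 2 := by linarith [hp.r_le, hp.s_pos]
  have hw' : 1 - s ≤ 2 := by linarith [hp.s_pos]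
  obtain ⟨C, hC, H⟩ := abs_varSize_succ_sub_le hp hw hw'
  refine ⟨C, hC, fun h n => ?_⟩
  have h1 := abs_sub_le_of_abs_succ_sub_le (n := n) (a := n) (b := 0) hC.le zero_le_two (H h) le_rfl
    (Nat.zero_le n)
  rw [varSize_eq_zero hp.toNonExplosive h 0 (by norm_num)] at h1
  simp only [Nat.cast_zero, sub_zero, Nat.abs_cast] at h1
  refine (le_abs_self _).trans (h1.trans (le_of_eq ?_))
  rw [Real.rpow_two]
  ring

/-- Here only the order in `t` matters. The exponent `8` comes from `(B + A ^ 2) ^ 2` with `A` of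
order `n ^ 2` for the mean and `B` of order `n ^ 3` for the variance. -/
lemma norm_levelToll_le_crude (hp : SpreadBound p M s r D) :
    ∃ C > 0, ∀ h n : ℕ, 1 ≤ n → ∀ t : ℝ, |t| ≤ 1 →
      ‖levelToll p M h n t‖ ≤ C * (|t| ^ 3 * (n : ℝ) ^ 8) := by
  obtain ⟨C₁, hC₁, H₁⟩ := abs_meanSize_le hp
  obtain ⟨C₂, hC₂, H₂⟩ := varSize_le hp
  have hp0 : ∀ b, 0 ≤ p b := fun b => (hp.pos b).le
  set A : ℝ := (Fintype.card 𝒜 : ℝ) with hA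
  set a₁ := 2 * (A * C₁) with ha₁
  set b₁ := A * C₂ with hb₁
  have hA0 : 0 ≤ A := Nat.cast_nonneg _
  have ha0 : 0 ≤ a₁ := by positivity
  have hb0 : 0 ≤ b₁ := by positivity
  refine ⟨b₁ ^ 2 + 4 * a₁ ^ 3 + a₁ * b₁ + (b₁ + a₁ ^ 2) ^ 2 + 1, by positivity,
    fun h n hn t ht => ?_⟩
  have hn' : (1 : ℝ) ≤ n := by exact_mod_cast hn
  have hcn : ∀ c : 𝒜 → ℕ, ∑ a, c a = n → ∀ a, (c a : ℝ) ≤ n := fun c hc a => by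
    rw [← hc]
    exact_mod_cast Finset.single_le_sum (fun b _ => Nat.zero_le (c b)) (Finset.mem_univ a)
  have hL : ∀ c : 𝒜 → ℕ, ∑ a, c a = n → |levelMean p M h c| ≤ A * C₁ * (n : ℝ) ^ 2 := fun c hc => by
    calc |levelMean p M h c| ≤ ∑ _a : 𝒜, C₁ * (n : ℝ) ^ 2 := by
          refine (Finset.abs_sum_le_sum_abs _ _).trans (Finset.sum_le_sum fun a _ => ?_)
          refine (H₁ h (c a)).trans ?_
          have := hcn c hc a
          gcongr
      _ = _ := by rw [Finset.sum_const, Finset.card_univ, nsmul_eq_mul, ← hA]; ring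
  have hm : |multi p n (levelMean p M h)| ≤ A * C₁ * (n : ℝ) ^ 2 := by
    rw [← multi_const hp.sum_eq n (A * C₁ * (n : ℝ) ^ 2)]
    exact (abs_multi_le hp0 n _).trans (multi_mono hp0 n hL)
  have h1 := norm_multi_toll_le_crude hp0 hp.sum_eq ht n
    (g := fun c => levelMean p M h c - multi p n (levelMean p M h)) (v := levelVar p M h)
    (A := a₁ * (n : ℝ) ^ 2) (B := b₁ * (n : ℝ) ^ 3)
    (by rw [multi_sub, multi_const hp.sum_eq, sub_self]) (levelVar_nonneg hp.toNonExplosive h)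
    (fun c hc => by
      have := (abs_sub (levelMean p M h c) (multi p n (levelMean p M h))).trans
        (add_le_add (hL c hc) hm)
      refine this.trans (le_of_eq ?_)
      rw [ha₁]; ring)
    (fun c hc => by
      calc levelVar p M h c ≤ ∑ _a : 𝒜, C₂ * (n : ℝ) ^ 3 := by
            refine Finset.sum_le_sum fun a _ => (H₂ h (c a)).trans ?_
            have := hcn c hc a
            gcongr
        _ = _ := by rw [Finset.sum_const, Finset.card_univ, nsmul_eq_mul, ← hA]; ring)
    (by positivity) (by positivity)
  refine h1.trans ?_
  have h6 : (n : ℝ) ^ 6 ≤ (n : ℝ) ^ 8 := pow_le_pow_right₀ hn' (by norm_num)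
  have h5 : (n : ℝ) ^ 5 ≤ (n : ℝ) ^ 8 := pow_le_pow_right₀ hn' (by norm_num)
  have h34 : (b₁ * (n : ℝ) ^ 3 + (a₁ * (n : ℝ) ^ 2) ^ 2) ^ 2 ≤ (b₁ + a₁ ^ 2) ^ 2 * (n : ℝ) ^ 8 := by
    have h3 : (n : ℝ) ^ 3 ≤ (n : ℝ) ^ 4 := pow_le_pow_right₀ hn' (by norm_num)
    calc _ ≤ (b₁ * (n : ℝ) ^ 4 + (a₁ * (n : ℝ) ^ 2) ^ 2) ^ 2 := by gcongr
      _ = _ := by ring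
  have ht3 : 0 ≤ |t| ^ 3 := by positivity
  rw [mul_left_comm (_ + _)]
  refine mul_le_mul_of_nonneg_left ?_ ht3
  have q1 := mul_le_mul_of_nonneg_left h6 (by positivity : 0 ≤ b₁ ^ 2 + 4 * a₁ ^ 3)
  have q2 := mul_le_mul_of_nonneg_left h5 (by positivity : 0 ≤ a₁ * b₁)
  have e : (b₁ * (n : ℝ) ^ 3) ^ 2 + 4 * (a₁ * (n : ℝ) ^ 2) ^ 3 + a₁ * (n : ℝ) ^ 2 * (b₁ * (n : ℝ) ^ 3)
      = (b₁ ^ 2 + 4 * a₁ ^ 3) * (n : ℝ) ^ 6 + a₁ * b₁ * (n : ℝ) ^ 5 := by ring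
  rw [e]
  have q3 : 0 ≤ (n : ℝ) ^ 8 := by positivity
  linarith

/-- Interpolation between the two bounds for the one-level error. -/
lemma norm_levelToll_le_interpolated (hp : SpreadBound p M s r D) (hw : r + 1 - s ≤ w)
    (hw' : 1 - s ≤ w) {θ x z : ℝ} (hθ : 0 < θ) (hθ1 : θ ≤ 1) (hx : w + 1 / 2 + 8 * θ ≤ x)
    (hz : 3 * r + 1 ≤ z) :
    ∃ C > 0, ∀ h n : ℕ, 1 ≤ n → ∀ t : ℝ, |t| ≤ 1 →
      ‖levelToll p M h n t‖ ≤ C * (|t| ^ (2 + θ) * (n : ℝ) ^ x + |t| ^ 3 * (n : ℝ) ^ z) := by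
  obtain ⟨C₁, hC₁, H₁⟩ := norm_levelToll_le hp hw hw'
  obtain ⟨C₂, hC₂, H₂⟩ := norm_levelToll_le_crude hp
  refine ⟨C₁ + C₂, by positivity, fun h n hn t ht => ?_⟩
  have hn' : (1 : ℝ) ≤ n := by exact_mod_cast hn
  have hn0 : (0 : ℝ) < n := by linarith
  have hw0 : 0 ≤ w := by linarith [hp.s_lt]
  rcases (abs_nonneg t).eq_or_lt with h0 | h0
  · have h1 := H₁ h n hn t
    have ht0 : t = 0 := abs_eq_zero.1 h0.symm
    rw [ht0] at h1 ⊢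
    refine h1.trans ?_
    norm_num
    rw [Real.zero_rpow (by linarith)]
    simp
  have q2 : 0 ≤ |t| ^ 3 * (n : ℝ) ^ z := by positivity
  have q1 : 0 ≤ |t| ^ (2 + θ) * (n : ℝ) ^ x := by positivity
  have e8 : (|t| * (n : ℝ) ^ 8) ^ θ = |t| ^ θ * (n : ℝ) ^ (8 * θ) := by
    rw [Real.mul_rpow h0.le (by positivity), ← Real.rpow_natCast, ← Real.rpow_mul hn0.le]
    norm_num
  have e2 : |t| ^ (2 + θ) = t ^ 2 * |t| ^ θ := by
    rw [Real.rpow_add h0, Real.rpow_two, sq_abs]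
  -- The bounds cross near `|t| * n ^ 8 = 1`. Multiplying by its power `θ` loses nothing above this
  -- point, and below it one full factor may be replaced by that power.
  rcases le_total 1 (|t| * (n : ℝ) ^ 8) with hl | hl
  · have k1 : t ^ 2 * (n : ℝ) ^ (w + 1 / 2) ≤ |t| ^ (2 + θ) * (n : ℝ) ^ x := by
      have h1 : 1 ≤ (|t| * (n : ℝ) ^ 8) ^ θ := Real.one_le_rpow hl hθ.le
      calc t ^ 2 * (n : ℝ) ^ (w + 1 / 2) ≤ t ^ 2 * (n : ℝ) ^ (w + 1 / 2) * (|t| * (n : ℝ) ^ 8) ^ θ :=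
            le_mul_of_one_le_right (by positivity) h1
        _ = |t| ^ (2 + θ) * (n : ℝ) ^ (w + 1 / 2 + 8 * θ) := by
            rw [e8, e2, Real.rpow_add hn0 (w + 1 / 2)]; ring
        _ ≤ _ := by gcongr
    have k2 : |t| ^ 3 * (n : ℝ) ^ (3 * r + 1) ≤ |t| ^ 3 * (n : ℝ) ^ z := by gcongr
    calc _ ≤ C₁ * (t ^ 2 * (n : ℝ) ^ (w + 1 / 2) + |t| ^ 3 * (n : ℝ) ^ (3 * r + 1)) := H₁ h n hn t
      _ ≤ C₁ * (|t| ^ (2 + θ) * (n : ℝ) ^ x + |t| ^ 3 * (n : ℝ) ^ z) := by gcongr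
      _ ≤ _ := by gcongr; linarith
  · have k1 : |t| ^ 3 * (n : ℝ) ^ 8 ≤ |t| ^ (2 + θ) * (n : ℝ) ^ x := by
      have h1 : |t| * (n : ℝ) ^ 8 ≤ (|t| * (n : ℝ) ^ 8) ^ θ := by
        have := Real.rpow_le_rpow_of_exponent_ge (by positivity) hl hθ1
        rwa [Real.rpow_one] at this
      calc |t| ^ 3 * (n : ℝ) ^ 8 = t ^ 2 * (|t| * (n : ℝ) ^ 8) := by rw [← sq_abs t]; ring
        _ ≤ t ^ 2 * (|t| * (n : ℝ) ^ 8) ^ θ := by gcongr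
        _ = |t| ^ (2 + θ) * (n : ℝ) ^ (8 * θ) := by rw [e8, e2]; ring
        _ ≤ _ := by
            refine mul_le_mul_of_nonneg_left (Real.rpow_le_rpow_of_exponent_le hn' (by linarith))
              (by positivity)
    calc _ ≤ C₂ * (|t| ^ 3 * (n : ℝ) ^ 8) := H₂ h n hn t ht
      _ ≤ C₂ * (|t| ^ (2 + θ) * (n : ℝ) ^ x + |t| ^ 3 * (n : ℝ) ^ z) := by gcongr; linarith
      _ ≤ _ := by gcongr; linarith

lemma norm_charSize_le (hp : NonExplosive p M) (h n : ℕ) (t : ℝ) : ‖charSize p M h n t‖ ≤ 1 := by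
  have hp0 : ∀ b, 0 ≤ p b := fun b => (hp.pos b).le
  induction h generalizing n with
  | zero => simp [charSize]
  | succ h ih =>
    rw [charSize, norm_mul, norm_expI, one_mul, norm_pow]
    refine pow_le_one₀ (norm_nonneg _) ((norm_multi_le hp0 n _).trans ?_)
    rw [← multi_const hp.sum_eq n (1 : ℝ)]
    refine multi_mono hp0 n fun c _ => ?_
    rw [norm_prod]
    exact Finset.prod_le_one (fun _ _ => norm_nonneg _) fun a _ => ih _

lemma charSize_eq_one (hp : NonExplosive p M) (h n : ℕ) (hn : n ≤ 1) (t : ℝ) :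
    charSize p M h n t = 1 := by
  induction h generalizing n with
  | zero => rfl
  | succ h ih =>
    rw [charSize, if_neg (by omega), mul_zero, expI_zero, one_mul]
    have : multi p n (fun c => ∏ a, charSize p M h (c a) t) = 1 := by
      rw [← multi_const hp.sum_eq n (1 : ℂ)]
      refine multi_congr n fun c hc => Finset.prod_eq_one fun a _ => ih _ ?_
      exact (Finset.single_le_sum (fun b _ => Nat.zero_le (c b)) (Finset.mem_univ a)).trans
        (hc.le.trans hn)
    rw [this, one_pow]

/-- The characteristic function of the centered size. -/
noncomputable def centeredChar (p : 𝒜 → ℝ) (M h n : ℕ) (t : ℝ) : ℂ :=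
  expI (-(t * meanSize p M h n)) * charSize p M h n t

lemma norm_centeredChar_le (hp : NonExplosive p M) (h n : ℕ) (t : ℝ) :
    ‖centeredChar p M h n t‖ ≤ 1 := by
  rw [centeredChar, norm_mul, norm_expI, one_mul]
  exact norm_charSize_le hp h n t

/-- Centering cancels the deterministic contribution of the root, and the `M` independent branches
give the power `M`. -/
lemma centeredChar_succ (h n : ℕ) (t : ℝ) :
    centeredChar p M (h + 1) n t =
      multi p n (fun c => expI (t * (levelMean p M h c - multi p n (levelMean p M h)))
        * ∏ a, centeredChar p M h (c a) t) ^ M := by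
  have e : ∀ c : 𝒜 → ℕ, expI (t * (levelMean p M h c - multi p n (levelMean p M h)))
        * ∏ a, centeredChar p M h (c a) t =
        expI (-(t * multi p n (levelMean p M h))) * ∏ a, charSize p M h (c a) t := fun c => by
    simp only [centeredChar, Finset.prod_mul_distrib]
    rw [← expI_sum, ← mul_assoc, ← expI_add, Finset.sum_neg_distrib, ← Finset.mul_sum, levelMean]
    congr 2
    ring
  simp only [e]
  rw [multi_const_mul', mul_pow, ← expI_mul_natCast, centeredChar, charSize, ← mul_assoc,
    ← expI_add, meanSize]
  congr 2
  unfold levelMean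
  ring

/-- The distance between the characteristic function of the centered size and that of a Gaussian
variable with the same variance. -/
noncomputable def gaussDist (p : 𝒜 → ℝ) (M h n : ℕ) (t : ℝ) : ℝ :=
  ‖centeredChar p M h n t - (Real.exp (-(t ^ 2 / 2 * varSize p M h n)) : ℝ)‖

/-- Numbers in the unit disc satisfy `‖z ^ M - y ^ M‖ ≤ M * ‖z - y‖`, and similarly for products. So
the distances of the subtries to their Gaussians add up, and what is left is the toll of a level of
exact Gaussians. -/
lemma gaussDist_succ_le (hp : NonExplosive p M) (h n : ℕ) (t : ℝ) :
    gaussDist p M (h + 1) n t ≤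
      M * ‖levelToll p M h n t‖ + M * ∑ a, 1 * binom (p a) n (fun k => gaussDist p M h k t) := by
  have hp0 : ∀ b, 0 ≤ p b := fun b => (hp.pos b).le
  set z := multi p n (fun c => expI (t * (levelMean p M h c - multi p n (levelMean p M h)))
        * ∏ a, centeredChar p M h (c a) t) with hz
  set y := ((Real.exp (-(t ^ 2 / 2 * (multi p n (levelVar p M h)
      + multiVar p n (levelMean p M h)))) : ℝ) : ℂ) with hy
  have hy' : ((Real.exp (-(t ^ 2 / 2 * varSize p M (h + 1) n)) : ℝ) : ℂ) = y ^ M := by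
    rw [hy, ← Complex.ofReal_pow, ← Real.exp_nat_mul, varSize]
    congr 2
    unfold levelVar
    ring
  have hz1 : ‖z‖ ≤ 1 := by
    refine (norm_multi_le hp0 n _).trans ?_
    rw [← multi_const hp.sum_eq n (1 : ℝ)]
    refine multi_mono hp0 n fun c _ => ?_
    rw [norm_mul, norm_expI, one_mul, norm_prod]
    exact Finset.prod_le_one (fun _ _ => norm_nonneg _) fun a _ => norm_centeredChar_le hp _ _ _
  have hy1 : ‖y‖ ≤ 1 := norm_exp_neg_le_one (mul_nonneg (by positivity)
    (add_nonneg (multi_nonneg hp0 n (levelVar_nonneg hp h)) (multiVar_nonneg hp0 n _)))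
  have h1 : gaussDist p M (h + 1) n t ≤ M * ‖z - y‖ := by
    rw [gaussDist, centeredChar_succ, hy']
    exact norm_pow_sub_pow_le hz1 hy1 M
  have h2 : ‖z - y‖ ≤ ‖levelToll p M h n t‖ + ∑ a, binom (p a) n (fun k => gaussDist p M h k t) := by
    have e : z - y = levelToll p M h n t + (z - multi p n (fun c =>
        expI (t * (levelMean p M h c - multi p n (levelMean p M h)))
          * (Real.exp (-(t ^ 2 / 2 * levelVar p M h c)) : ℝ))) := by
      rw [levelToll]; ring
    rw [e]
    refine (norm_add_le _ _).trans (add_le_add le_rfl ?_)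
    rw [hz, ← multi_sub]
    refine (norm_multi_le hp0 n _).trans ?_
    simp only [← multi_apply hp.sum_eq, ← multi_finset_sum]
    refine multi_mono hp0 n fun c _ => ?_
    rw [← mul_sub, norm_mul, norm_expI, one_mul]
    have e2 : ((Real.exp (-(t ^ 2 / 2 * levelVar p M h c)) : ℝ) : ℂ)
        = ∏ a, ((Real.exp (-(t ^ 2 / 2 * varSize p M h (c a))) : ℝ) : ℂ) := by
      rw [← Complex.ofReal_prod, ← Real.exp_sum, levelVar, Finset.mul_sum, Finset.sum_neg_distrib]
    rw [e2]
    exact norm_prod_sub_prod_le _ (fun a => norm_centeredChar_le hp _ _ _)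
      fun a => norm_exp_neg_le_one (mul_nonneg (by positivity) (varSize_nonneg hp _ _))
  refine h1.trans ?_
  rw [← mul_add]
  simp only [one_mul]
  gcongr

/-- Gaussian comparison for the size of the G-trie, uniformly in the height of truncation. -/
lemma gaussDist_le (hp : SpreadBound p M s r D) (hw : r + 1 - s ≤ w)
    (hw' : 1 - s ≤ w) {θ x z : ℝ} (hθ : 0 < θ) (hθ1 : θ ≤ 1) (hx : w + 1 / 2 + 8 * θ ≤ x)
    (hz : 3 * r + 1 ≤ z) (hx2 : 2 - s ≤ x) (hz2 : 2 - s ≤ z) :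
    ∃ C > 0, ∀ h n : ℕ, ∀ t : ℝ, |t| ≤ 1 →
      gaussDist p M h n t ≤ C * (|t| ^ (2 + θ) * (n : ℝ) ^ x + |t| ^ 3 * (n : ℝ) ^ z) := by
  obtain ⟨C, hC, H⟩ := norm_levelToll_le_interpolated hp hw hw' hθ hθ1 hx hz
  have hs1 := hp.s_lt
  have hs0 := hp.s_pos
  have hx1 : 1 ≤ x := by linarith
  have hz1 : 1 ≤ z := by linarith
  have hM : (0 : ℝ) < M := by exact_mod_cast hp.one_le
  set B : ℝ := 2 ^ (x - 1) + 2 ^ (z - 1) with hB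
  have hB0 : 0 < B := by positivity
  have hl := hp.sum_lt
  refine ⟨M * (C * B) / (1 - M * ∑ a, p a ^ (2 - s)), div_pos (by positivity) (by linarith),
    fun h n t ht => ?_⟩
  -- A supersolution built from `fallPow`, which thinning contracts without loss; at exponents at
  -- least `2 - s` the rate is `M * ∑ a, p a ^ (2 - s)`.
  set K : ℕ → ℝ := fun n => |t| ^ (2 + θ) * fallPow x n + |t| ^ 3 * fallPow z n with hK
  have hK0 : ∀ n, 0 ≤ K n := fun n => by
    have := fallPow_nonneg x n
    have := fallPow_nonneg z n
    positivity
  have hfall : ∀ y : ℝ, 2 - s ≤ y → ∀ a n, binom (p a) n (fallPow y) ≤ p a ^ (2 - s) * fallPow y n := by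
    intro y hy a n
    refine (binom_fallPow_le (hp.pos a) (hp.lt_one a).le n (by linarith)).trans ?_
    refine mul_le_mul_of_nonneg_right ?_ (fallPow_nonneg y n)
    exact Real.rpow_le_rpow_of_exponent_ge (hp.pos a) (hp.lt_one a).le (le_min hy (by linarith))
  have key : gaussDist p M h n t ≤ M * (C * B) / (1 - M * ∑ a, p a ^ (2 - s)) * K n := by
    refine le_of_contraction hp.toNonExplosive (u := fun h n => gaussDist p M h n t) (K := K)
      (w := fun _ => 1) (r := fun a => p a ^ (2 - s)) (fun a => zero_le_one) hK0 (fun a n => ?_)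
      (le_of_eq (by simp)) hl (by positivity) (fun n => ?_) (fun h n => ?_) h n
    · simp only [hK]
      rw [binom_add, binom_const_mul, binom_const_mul, mul_add]
      refine add_le_add ?_ ?_
      · rw [mul_left_comm]
        exact mul_le_mul_of_nonneg_left (hfall x hx2 a n) (by positivity)
      · rw [mul_left_comm]
        exact mul_le_mul_of_nonneg_left (hfall z hz2 a n) (by positivity)
    · simp [gaussDist, centeredChar, charSize, meanSize, varSize, expI_zero]
    -- `K` vanishes at `0` and `1`, where the distance vanishes as well; from `2` on it is
    -- comparable to the plain powers.
    · rcases le_or_gt n 1 with hn | hn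
      · have h0 : gaussDist p M (h + 1) n t = 0 := by
          rw [gaussDist, centeredChar, charSize_eq_one hp.toNonExplosive _ _ hn,
            meanSize_eq_zero hp.sum_eq _ _ hn, varSize_eq_zero hp.toNonExplosive _ _ hn]
          simp [expI_zero]
        simp only [h0]
        refine add_nonneg (mul_nonneg (by positivity) (hK0 n)) (mul_nonneg hM.le ?_)
        refine Finset.sum_nonneg fun a _ => ?_
        rw [one_mul]
        exact binom_nonneg (hp.pos a).le (hp.lt_one a).le n fun k _ => norm_nonneg _
      · refine (gaussDist_succ_le hp.toNonExplosive h n t).trans (add_le_add ?_ le_rfl)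
        rw [mul_assoc]
        refine mul_le_mul_of_nonneg_left ((H h n (by omega) t ht).trans ?_) hM.le
        rw [mul_assoc]
        refine mul_le_mul_of_nonneg_left ?_ hC.le
        have k1 := rpow_le_fallPow x hx1 n hn
        have k2 := rpow_le_fallPow z hz1 n hn
        have f1 := fallPow_nonneg x n
        have f2 := fallPow_nonneg z n
        have g1 : (2 : ℝ) ^ (x - 1) ≤ B := by rw [hB]; linarith [(by positivity : (0 : ℝ) < 2 ^ (z - 1))]
        have g2 : (2 : ℝ) ^ (z - 1) ≤ B := by rw [hB]; linarith [(by positivity : (0 : ℝ) < 2 ^ (x - 1))]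
        calc |t| ^ (2 + θ) * (n : ℝ) ^ x + |t| ^ 3 * (n : ℝ) ^ z
            ≤ |t| ^ (2 + θ) * (B * fallPow x n) + |t| ^ 3 * (B * fallPow z n) := by
              gcongr
              · exact k1.trans (by gcongr)
              · exact k2.trans (by gcongr)
          _ = B * K n := by rw [hK]; ring
  refine key.trans ?_
  have : 0 ≤ M * (C * B) / (1 - M * ∑ a, p a ^ (2 - s)) := by
    have : 0 < 1 - M * ∑ a, p a ^ (2 - s) := by linarith
    positivity
  simp only [hK]
  gcongr
  · exact fallPow_le x hx1 n
  · exact fallPow_le z hz1 n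

end CharFun


/-! ### Critical exponent and the general lower bound for the variance -/

section LowerBounds

variable {𝒜 : Type*} [Fintype 𝒜] {p : 𝒜 → ℝ} {M : ℕ}

/-- The strictly decreasing continuous function `y ↦ M * ∑ a, p a ^ y` is `M ≥ 1` at `1` and less
than `1` at `2`. -/
lemma exists_critical_exponent (hp : NonExplosive p M) :
    ∃ ρ : ℝ, 1 ≤ ρ ∧ ρ < 2 ∧ M * ∑ a, p a ^ ρ = 1 ∧ ∀ y, ρ < y → M * ∑ a, p a ^ y < 1 := by
  have := hp.nonempty
  have hM : (1 : ℝ) ≤ M := by exact_mod_cast hp.one_le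
  have hcont : Continuous fun y : ℝ => M * ∑ a, p a ^ y := by
    refine continuous_const.mul (continuous_finsetSum _ fun a _ => ?_)
    exact Real.continuous_const_rpow (hp.pos a).ne'
  have hanti : ∀ x y : ℝ, x < y → M * ∑ a, p a ^ y < M * ∑ a, p a ^ x := fun x y hxy => by
    refine mul_lt_mul_of_pos_left ?_ (by linarith)
    exact Finset.sum_lt_sum_of_nonempty Finset.univ_nonempty fun a _ =>
      Real.rpow_lt_rpow_of_exponent_gt (hp.pos a) (hp.lt_one a) hxy
  have h2 : M * ∑ a, p a ^ (2 : ℝ) < 1 := by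
    simpa only [Real.rpow_two] using hp.sum_sq_lt
  have h1 : 1 ≤ M * ∑ a, p a ^ (1 : ℝ) := by
    simpa only [Real.rpow_one, hp.sum_eq, mul_one] using hM
  obtain ⟨ρ, ⟨hρ1, hρ2⟩, hρ⟩ := intermediate_value_Icc' one_le_two hcont.continuousOn ⟨h2.le, h1⟩
  have hρ : M * ∑ a, p a ^ ρ = 1 := hρ
  refine ⟨ρ, hρ1, lt_of_le_of_ne hρ2 ?_, hρ, fun y hy => ?_⟩
  · rintro rfl
    linarith
  · linarith [hanti ρ y hy]

lemma exists_probability_bounds (hp : NonExplosive p M) :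
    ∃ q P : ℝ, 0 < q ∧ P < 1 ∧ ∀ a, q ≤ p a ∧ p a ≤ P := by
  have := hp.nonempty
  obtain ⟨a, ha⟩ := Finite.exists_min p
  obtain ⟨b, hb⟩ := Finite.exists_max p
  exact ⟨p a, p b, hp.pos a, hp.lt_one b, fun x => ⟨ha x, hb x⟩⟩

/-- Lower bounds of polynomial order for a recursion that scales a real parameter. -/
lemma rpow_le_of_recursion (hp : NonExplosive p M) {q P : ℝ} (hq0 : 0 < q)
    (hqP : ∀ a, q ≤ p a ∧ p a ≤ P) {u : ℕ → ℝ → ℝ} {w : 𝒜 → ℝ} {b c : ℝ}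
    (hb : 0 ≤ b) (hc : 0 ≤ c) (hw : ∀ a, 0 ≤ w a) (hsum : 1 ≤ ∑ a, w a * p a ^ b) (m : ℕ)
    (h1 : ∀ h x, 0 ≤ x → x ≤ 1 → q ≤ m * x → m * x ≤ 1 → c ≤ u (h + 1) x)
    (h2 : ∀ h x, 0 ≤ x → x ≤ 1 → ∑ a, w a * u h (x * p a) ≤ u (h + 1) x) (h : ℕ) (x : ℝ)
    (hx0 : 0 ≤ x) (hx1 : x ≤ 1) (hqx : q ≤ m * x) (hPx : m * x * P ^ h ≤ 1) :
    c * (m * x) ^ b ≤ u (h + 1) x := by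
  induction h generalizing x with
  | zero =>
    rw [pow_zero, mul_one] at hPx
    refine le_trans ?_ (h1 0 x hx0 hx1 hqx hPx)
    exact mul_le_of_le_one_right hc (Real.rpow_le_one (by linarith) hPx hb)
  | succ h ih =>
    -- Parameters with `q ≤ m * x ≤ 1` are the seed. Above it one step of the recursion leads to `m
    -- * x * p a ≥ q`, so the seed is never jumped over; the bound on `m * x * P ^ h` says that the
    -- height suffices to reach it.
    rcases le_or_gt (m * x) 1 with hmx | hmx
    · refine le_trans ?_ (h1 (h + 1) x hx0 hx1 hqx hmx)
      exact mul_le_of_le_one_right hc (Real.rpow_le_one (by linarith) hmx hb)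
    · refine le_trans ?_ (h2 (h + 1) x hx0 hx1)
      have h3 : ∀ a, c * (m * x) ^ b * (w a * p a ^ b) ≤ w a * u (h + 1) (x * p a) := fun a => by
        have hpa := hp.pos a
        have hP0 : 0 ≤ P := hpa.le.trans (hqP a).2
        have h4 : c * (m * (x * p a)) ^ b ≤ u (h + 1) (x * p a) := by
          refine ih _ (by positivity) (mul_le_one₀ hx1 hpa.le (hp.lt_one a).le) ?_ ?_
          · rw [← mul_assoc]
            exact (hqP a).1.trans (le_mul_of_one_le_left hpa.le hmx.le)
          · refine le_trans ?_ hPx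
            rw [← mul_assoc, mul_assoc _ (p a), pow_succ']
            have := (hqP a).2
            gcongr
        rw [← mul_assoc, Real.mul_rpow (by positivity) hpa.le] at h4
        calc _ = w a * (c * ((m * x) ^ b * p a ^ b)) := by ring
          _ ≤ _ := mul_le_mul_of_nonneg_left h4 (hw a)
      refine le_trans ?_ (Finset.sum_le_sum fun a _ => h3 a)
      rw [← Finset.mul_sum]
      exact le_mul_of_one_le_right (by positivity) hsum

lemma exp_neg_one_le_one_sub_pow {n : ℕ} {x : ℝ} (h : (n + 1) * x ≤ 1) :
    Real.exp (-1) ≤ (1 - x) ^ n := by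
  rcases Nat.eq_zero_or_pos n with rfl | hn
  · simp
  have hn' : (1 : ℝ) ≤ n := by exact_mod_cast hn
  have hx1 : 0 < 1 - x := by nlinarith
  have h1 : Real.exp (-(x / (1 - x))) ≤ 1 - x := by
    rw [Real.exp_neg]
    refine inv_le_of_inv_le₀ hx1 ?_
    have := Real.add_one_le_exp (x / (1 - x))
    have e : (1 - x)⁻¹ = x / (1 - x) + 1 := by field_simp; ring
    rwa [e]
  calc Real.exp (-1) ≤ Real.exp (-(x / (1 - x))) ^ n := by
        rw [← Real.exp_nat_mul]
        refine Real.exp_le_exp.2 ?_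
        have : n * (x / (1 - x)) ≤ 1 := by
          rw [← mul_div_assoc, div_le_one hx1]
          linarith
        linarith
    _ ≤ _ := pow_le_pow_left₀ (Real.exp_pos _).le h1 n

lemma binom_ite_zero (q : ℝ) (n : ℕ) :
    binom q n (fun k => if k = 0 then 1 else 0) = (1 - q) ^ n := by
  induction n with
  | zero => simp [binom_zero]
  | succ n ih =>
    rw [binom_succ, ih]
    simp only [Nat.add_eq_zero_iff, one_ne_zero, and_false, if_false, binom_const]
    ring

lemma binom_ite_one (q : ℝ) (n : ℕ) :
    binom q (n + 1) (fun k => if k = 1 then 1 else 0) = (n + 1) * q * (1 - q) ^ n := by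
  have h := binom_id_mul (q := q) n (fun k => if k = 1 then 1 else 0)
  have e : (fun k : ℕ => (k : ℝ) * if k = 1 then (1 : ℝ) else 0) = fun k => if k = 1 then 1 else 0 := by
    funext k
    split_ifs with hk <;> simp [hk]
  rw [e] at h
  rw [h]
  simp only [Nat.add_eq_right, binom_ite_zero]

lemma binom_ite_two (q : ℝ) (n : ℕ) :
    binom q (n + 2) (fun k => if k = 2 then 1 else 0) =
      (n + 2) * (n + 1) / 2 * q ^ 2 * (1 - q) ^ n := by
  have h := binom_id_mul (q := q) (n + 1) (fun k => if k = 2 then 1 else 0)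
  have e : (fun k : ℕ => (k : ℝ) * if k = 2 then (1 : ℝ) else 0)
      = fun k => 2 * if k = 2 then 1 else 0 := by
    funext k
    split_ifs with hk <;> simp [hk]
  rw [e, binom_const_mul] at h
  simp only [Nat.reduceEqDiff, binom_ite_one] at h
  push_cast at h
  linarith

omit [Fintype 𝒜] in
lemma binom_finset_sum (s : Finset 𝒜) (q : ℝ) (n : ℕ) (g : 𝒜 → ℕ → ℝ) :
    binom q n (fun k => ∑ a ∈ s, g a k) = ∑ a ∈ s, binom q n (g a) := by
  classical
  induction s using Finset.induction_on with
  | empty => simp [binom_const]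
  | insert a s ha ih => simp only [Finset.sum_insert ha, binom_add, ih]

lemma exists_pow_mul_le_one {P : ℝ} (hP0 : 0 ≤ P) (hP1 : P < 1) {x : ℝ} (hx : 0 < x) :
    ∃ h₀ : ℕ, ∀ h ≥ h₀, x * P ^ h ≤ 1 := by
  obtain ⟨k, hk⟩ := exists_pow_lt_of_lt_one (inv_pos.2 hx) hP1
  refine ⟨k, fun h hh => ?_⟩
  have h1 : P ^ h ≤ P ^ k := pow_le_pow_of_le_one hP0 hP1.le hh
  calc x * P ^ h ≤ x * x⁻¹ := by gcongr; linarith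
    _ = 1 := mul_inv_cancel₀ hx.ne'

variable [DecidableEq 𝒜]

lemma meanSize_nonneg (hp : NonExplosive p M) (h n : ℕ) : 0 ≤ meanSize p M h n := by
  induction n with
  | zero => exact (meanSize_eq_zero hp.sum_eq h 0 zero_le_one).ge
  | succ n ih =>
    have := meanDiff_nonneg hp h n
    unfold meanDiff at this
    linarith

lemma one_le_meanSize (hp : NonExplosive p M) (h n : ℕ) (hn : 2 ≤ n) :
    1 ≤ meanSize p M (h + 1) n := by
  rw [meanSize, if_pos hn]
  have := multi_nonneg (fun a => (hp.pos a).le) n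
    (F := fun c => ∑ a, meanSize p M h (c a)) fun c => Finset.sum_nonneg fun a _ =>
      meanSize_nonneg hp h _
  have : 0 ≤ (M : ℝ) * multi p n (fun c => ∑ a, meanSize p M h (c a)) := by positivity
  linarith

lemma levelMean_single_add_single (hs : ∑ a, p a = 1) (h : ℕ) (a b : 𝒜) :
    levelMean p M h (0 + Pi.single b 1 + Pi.single a 1) =
      if a = b then meanSize p M h 2 else 0 := by
  rw [levelMean]
  split_ifs with hab
  · subst hab
    rw [Finset.sum_eq_single a]
    · simp
    · intro b _ hb
      refine meanSize_eq_zero hs h _ ?_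
      simp [hb]
    · simp
  · refine Finset.sum_eq_zero fun x _ => meanSize_eq_zero hs h _ ?_
    simp only [zero_add, Pi.add_apply, Pi.single_apply]
    split_ifs <;> first | omega | (subst_vars; exact absurd rfl hab)

/-- With two labelings, `levelMean` is a fixed number `≥ 1` if the two letters agree and `0`
otherwise. The agreement has probability `b = ∑ a, p a ^ 2`, strictly between `0` and `1`. -/
lemma exists_le_multiVar_two (hp : NonExplosive p M) :
    ∃ c > 0, ∀ h, c ≤ multiVar p 2 (levelMean p M (h + 1)) := by
  have := hp.nonempty
  set b := ∑ a, p a ^ 2 with hb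
  have hb0 : 0 < b := Finset.sum_pos (fun a _ => pow_pos (hp.pos a) 2) Finset.univ_nonempty
  have hM : (1 : ℝ) ≤ M := by exact_mod_cast hp.one_le
  have hb1 : b < 1 := by nlinarith [hp.sum_sq_lt]
  have hb2 : 0 < 1 - b := by linarith
  refine ⟨b * (1 - b) ^ 2, by positivity, fun h => ?_⟩
  set f := meanSize p M (h + 1) 2 with hf
  have hf1 : 1 ≤ f := one_le_meanSize hp h 2 le_rfl
  have hm : multi p 2 (levelMean p M (h + 1)) = b * f := by
    simp only [multi_succ, multi_zero, levelMean_single_add_single hp.sum_eq, smul_eq_mul, mul_ite,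
      mul_zero, Finset.sum_ite_eq, Finset.mem_univ, if_true]
    rw [hb, Finset.sum_mul]
    exact Finset.sum_congr rfl fun a _ => by rw [← hf]; ring
  rw [multiVar, hm]
  simp only [multi_succ, multi_zero, levelMean_single_add_single hp.sum_eq, smul_eq_mul]
  calc b * (1 - b) ^ 2 ≤ b * (f - b * f) ^ 2 := by
        have e : (f - b * f) ^ 2 = f ^ 2 * (1 - b) ^ 2 := by ring
        rw [e]
        have : 1 ≤ f ^ 2 := one_le_pow₀ hf1
        refine mul_le_mul_of_nonneg_left (le_mul_of_one_le_left (by positivity) this) hb0.le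
    _ = ∑ a, p a * (p a * (f - b * f) ^ 2) := by
        rw [hb, Finset.sum_mul]
        exact Finset.sum_congr rfl fun a _ => by ring
    _ ≤ _ := by
        refine Finset.sum_le_sum fun a _ => mul_le_mul_of_nonneg_left ?_ (hp.pos a).le
        have := Finset.single_le_sum (f := fun x => p x *
          ((if a = x then f else 0) - b * f) ^ 2) (s := Finset.univ)
          (fun x _ => mul_nonneg (hp.pos x).le (sq_nonneg _)) (Finset.mem_univ a)
        simpa using this

lemma varSize_succ (hs : ∑ a, p a = 1) (h n : ℕ) : varSize p M (h + 1) n =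
    M * (∑ a, binom (p a) n (varSize p M h) + multiVar p n (levelMean p M h)) := by
  rw [varSize, multi_finset_sum]
  simp only [multi_apply hs]

/-- Average the variance over a binomial number of labelings with parameter `x`. Thinning then acts
by `x ↦ x * p a`, and dropping the toll leaves a recursion for which `x ^ ρ` is invariant. The seed
is the event that exactly two labelings survive while `n * x` is of order one. -/
lemma exists_rpow_le_varSize (hp : NonExplosive p M) {ρ : ℝ} (hρ0 : 1 ≤ ρ)
    (hρ : M * ∑ a, p a ^ ρ = 1) :
    ∃ c > 0, ∀ n : ℕ, 2 ≤ n → ∃ h₀ : ℕ, ∀ h ≥ h₀, c * (n : ℝ) ^ ρ ≤ varSize p M h n := by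
  obtain ⟨q, P, hq0, hP1, hqP⟩ := exists_probability_bounds hp
  obtain ⟨c₀, hc₀, H⟩ := exists_le_multiVar_two hp
  obtain ⟨a₀⟩ := hp.nonempty
  have hP0 : 0 ≤ P := hq0.le.trans ((hqP a₀).1.trans (hqP a₀).2)
  have hq1 : q ≤ 1 := (hqP a₀).1.trans (hp.lt_one a₀).le
  have hp0 : ∀ a, 0 ≤ p a := fun a => (hp.pos a).le
  have hM : (1 : ℝ) ≤ M := by exact_mod_cast hp.one_le
  refine ⟨c₀ * (q ^ 2 / 4 * Real.exp (-1)), by positivity, fun n hn => ?_⟩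
  have hn' : (2 : ℝ) ≤ n := by exact_mod_cast hn
  obtain ⟨h₀, hh₀⟩ := exists_pow_mul_le_one hP0 hP1 (by linarith : (0 : ℝ) < n)
  refine ⟨h₀ + 2, fun h hh => ?_⟩
  obtain ⟨k, rfl⟩ : ∃ k, h = k + 2 := ⟨h - 2, by omega⟩
  -- The heights are shifted because two labelings contribute variance only from height two on. At
  -- `x = 1` the average is the variance itself.
  have key := rpow_le_of_recursion hp hq0 hqP (u := fun h x => binom x n (varSize p M (h + 1)))
    (w := fun _ => M) (b := ρ) (c := c₀ * (q ^ 2 / 4 * Real.exp (-1))) (by linarith)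
    (by positivity) (fun _ => by positivity) (by rw [← Finset.mul_sum, hρ]) n
    (fun h x hx0 hx1 hqx hx => ?_) (fun h x hx0 hx1 => ?_) k 1 zero_le_one le_rfl (by linarith)
    (by rw [mul_one]; exact hh₀ k (by omega))
  · rwa [mul_one, binom_one] at key
  · obtain ⟨m, rfl⟩ : ∃ m, n = m + 2 := ⟨n - 2, by omega⟩
    have h1 : ∀ j, c₀ * (if j = 2 then 1 else 0) ≤ varSize p M (h + 1 + 1) j := fun j => by
      split_ifs with hj
      · rw [hj, mul_one, varSize_succ hp.sum_eq]
        have h2 : 0 ≤ ∑ a, binom (p a) 2 (varSize p M (h + 1)) := Finset.sum_nonneg fun a _ =>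
          binom_nonneg (hp0 a) (hp.lt_one a).le _ fun _ _ => varSize_nonneg hp _ _
        nlinarith [H h]
      · rw [mul_zero]; exact varSize_nonneg hp _ _
    refine le_trans ?_ (binom_mono hx0 hx1 _ fun j _ => h1 j)
    rw [binom_const_mul, binom_ite_two]
    push_cast at hqx hx
    have h3 := exp_neg_one_le_one_sub_pow (n := m) (x := x) (by nlinarith)
    have h4 : q ^ 2 / 4 ≤ (m + 2) * (m + 1) / 2 * x ^ 2 := by
      have : q ^ 2 ≤ ((m + 2) * x) ^ 2 := pow_le_pow_left₀ hq0.le hqx 2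
      have hm : (0 : ℝ) ≤ m := Nat.cast_nonneg m
      have : 0 ≤ (m + 2) * m * x ^ 2 := by positivity
      nlinarith
    gcongr
  · rw [← Finset.mul_sum]
    have h1 : ∀ j, M * ∑ a, binom (p a) j (varSize p M (h + 1)) ≤ varSize p M (h + 1 + 1) j :=
      fun j => by
        rw [varSize_succ hp.sum_eq _ j]
        have := multiVar_nonneg hp0 j (levelMean p M (h + 1))
        nlinarith
    refine le_trans (le_of_eq ?_) (binom_mono hx0 hx1 _ fun j _ => h1 j)
    rw [binom_const_mul]
    congr 1
    simp only [binom_finset_sum, binom_binom]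

end LowerBounds


/-! ### Sharp growth of the mean and covariance with an additive statistic -/

section Covariance

variable {𝒜 : Type*} [Fintype 𝒜] [DecidableEq 𝒜] {p : 𝒜 → ℝ} {M : ℕ}

/-- The left side is the chance of exactly one success in `n + 1` trials. It is at most `exp 1 * t *
exp (-t)` with `t = (n + 1) * x`, and `(1 + t ^ ε) ^ 2 ≤ (2 + t) ^ 2 ≤ 4 * exp t`. -/
lemma mul_one_sub_pow_le {n : ℕ} {x ε : ℝ} (hx0 : 0 ≤ x) (hx1 : x ≤ 1) (hε0 : 0 < ε) (hε1 : ε ≤ 1) :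
    (n + 1) * x * (1 - x) ^ n ≤
      4 * Real.exp 1 * ((n + 1) * x / (1 + ((n + 1) * x) ^ ε) ^ 2) := by
  set t := (n + 1) * x with ht
  have ht0 : 0 ≤ t := by positivity
  have h1 : (1 - x) ^ n ≤ Real.exp 1 * Real.exp (-t) := by
    calc (1 - x) ^ n ≤ Real.exp (-x) ^ n :=
          pow_le_pow_left₀ (by linarith) (Real.one_sub_le_exp_neg x) n
      _ ≤ Real.exp 1 * Real.exp (-t) := by
          rw [← Real.exp_nat_mul, ← Real.exp_add]
          refine Real.exp_le_exp.2 ?_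
          rw [ht]; linarith
  have h2 : t ^ ε ≤ 1 + t := by
    rcases le_total t 1 with h | h
    · exact (Real.rpow_le_one ht0 h hε0.le).trans (by linarith)
    · have := Real.rpow_le_rpow_of_exponent_le h hε1
      rw [Real.rpow_one] at this
      linarith
  have hT : 0 ≤ t ^ ε := Real.rpow_nonneg ht0 _
  have h3 : (1 + t ^ ε) ^ 2 ≤ 4 * Real.exp t := by
    have := Real.quadratic_le_exp_of_nonneg ht0
    nlinarith
  have h4 : Real.exp (-t) ≤ 4 / (1 + t ^ ε) ^ 2 := by
    rw [le_div_iff₀ (by positivity), Real.exp_neg, inv_mul_le_iff₀ (Real.exp_pos t)]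
    linarith
  calc t * (1 - x) ^ n ≤ t * (Real.exp 1 * (4 / (1 + t ^ ε) ^ 2)) := by
        refine mul_le_mul_of_nonneg_left (h1.trans ?_) ht0
        exact mul_le_mul_of_nonneg_left h4 (Real.exp_pos _).le
    _ = _ := by ring

/-- The upper bound of the exact order for the growth of the expected size. -/
lemma meanDiff_le_rpow (hp : NonExplosive p M) {ρ : ℝ} (hρ1 : 1 ≤ ρ) (hρ2 : ρ < 2)
    (hρ : M * ∑ a, p a ^ ρ = 1) :
    ∃ C > 0, ∀ h n : ℕ, meanDiff p M h n ≤ C * (n : ℝ) ^ (ρ - 1) := by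
  obtain ⟨q, P, hq0, hP1, hqP⟩ := exists_probability_bounds hp
  obtain ⟨a₀⟩ := hp.nonempty
  have hP0 : 0 ≤ P := hq0.le.trans ((hqP a₀).1.trans (hqP a₀).2)
  set ε := 2 - ρ with hε
  have hε0 : 0 < ε := by linarith
  set Z := P ^ ε with hZ
  have hZ0 : 0 ≤ Z := Real.rpow_nonneg hP0 _
  have hZ1 : Z < 1 := Real.rpow_lt_one hP0 hP1 hε0
  have hZ2 : 0 < 1 - Z := by linarith
  set K := 4 * Real.exp 1 with hK
  have hK0 : 0 < K := by positivity
  set C := K / (1 - Z) with hC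
  have hC0 : 0 < C := by positivity
  refine ⟨C, hC0, fun h n => ?_⟩
  rcases n with _ | n
  · have : meanDiff p M h 0 = 0 := by
      simp [meanDiff, meanSize_eq_zero hp.sum_eq]
    rw [this]; positivity
  -- At the exponent `ρ` itself there is no contraction. The correction `1 + t ^ ε` in the
  -- supersolution provides the room to absorb the toll; for large `t` it has the exact order `t ^
  -- (ρ - 1)`.
  have key : ∀ h x, 0 ≤ x → x ≤ 1 → binom x (n + 1) (meanDiff p M h) ≤
      C * ((n + 1) * x / (1 + ((n + 1) * x) ^ ε)) := by
    intro h
    induction h with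
    | zero =>
      intro x hx0 _
      rw [show meanDiff p M 0 = fun _ => 0 from funext meanDiff_zero, binom_const]
      positivity
    | succ h ih =>
      intro x hx0 hx1
      set t := (n + 1) * x with ht
      have ht0 : 0 ≤ t := by positivity
      have hT : 0 ≤ t ^ ε := Real.rpow_nonneg ht0 _
      have e : binom x (n + 1) (meanDiff p M (h + 1)) =
          t * (1 - x) ^ n + M * ∑ a, p a * binom (x * p a) (n + 1) (meanDiff p M h) := by
        rw [show meanDiff p M (h + 1) = fun k => (if k = 1 then 1 else 0)
          + M * ∑ a, p a * binom (p a) k (meanDiff p M h) from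
          funext fun k => meanDiff_succ hp.sum_eq h k, binom_add, binom_ite_one, binom_const_mul,
          binom_finset_sum]
        simp only [binom_const_mul, binom_binom, ht]
      have h1 : ∀ a, p a * binom (x * p a) (n + 1) (meanDiff p M h) ≤
          p a ^ ρ * (C * (t * (Z / (1 + Z * t ^ ε)))) := fun a => by
        have hpa := hp.pos a
        have h2 := ih (x * p a) (by positivity) (mul_le_one₀ hx1 hpa.le (hp.lt_one a).le)
        rw [← mul_assoc, ← ht, Real.mul_rpow ht0 hpa.le] at h2
        have hz : p a ^ ε ≤ Z := Real.rpow_le_rpow hpa.le (hqP a).2 hε0.le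
        have hz0 : 0 < p a ^ ε := Real.rpow_pos_of_pos hpa _
        have h3 : p a ^ ε / (1 + t ^ ε * p a ^ ε) ≤ Z / (1 + Z * t ^ ε) := by
          rw [div_le_div_iff₀ (by positivity) (by positivity)]
          nlinarith
        have h4 : p a * p a = p a ^ ρ * p a ^ ε := by
          rw [← Real.rpow_add hpa, hε, add_sub_cancel, Real.rpow_two, sq]
        calc p a * binom (x * p a) (n + 1) (meanDiff p M h)
            ≤ p a * (C * (t * p a / (1 + t ^ ε * p a ^ ε))) := by gcongr
          _ = C * (t * (p a * p a / (1 + t ^ ε * p a ^ ε))) := by ring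
          _ = p a ^ ρ * (C * (t * (p a ^ ε / (1 + t ^ ε * p a ^ ε)))) := by rw [h4]; ring
          _ ≤ _ := by gcongr
      have h2 : M * ∑ a, p a * binom (x * p a) (n + 1) (meanDiff p M h)
          ≤ C * (t * (Z / (1 + Z * t ^ ε))) := by
        calc _ ≤ M * ∑ a, p a ^ ρ * (C * (t * (Z / (1 + Z * t ^ ε)))) := by
              exact mul_le_mul_of_nonneg_left (Finset.sum_le_sum fun a _ => h1 a) (Nat.cast_nonneg _)
          _ = _ := by rw [← Finset.sum_mul, ← mul_assoc, hρ, one_mul]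
      have h3 := mul_one_sub_pow_le (n := n) hx0 hx1 hε0 (by linarith)
      rw [← ht, ← hK] at h3
      rw [e]
      refine (add_le_add h3 h2).trans ?_
      -- The room is `1 / (1 + T) - Z / (1 + Z * T) = (1 - Z) / ((1 + T) * (1 + Z * T))` with `T = t
      -- ^ ε`; this dictates `C = K / (1 - Z)`.
      have h4 : K * (t / (1 + t ^ ε) ^ 2) ≤ C * (t * ((1 - Z) / ((1 + t ^ ε) * (1 + Z * t ^ ε)))) := by
        have e2 : C * (t * ((1 - Z) / ((1 + t ^ ε) * (1 + Z * t ^ ε)))) =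
            K * (t / ((1 + t ^ ε) * (1 + Z * t ^ ε))) := by
          rw [hC]; field_simp
        rw [e2]
        gcongr
        rw [sq]
        gcongr
        nlinarith
      refine (add_le_add h4 le_rfl).trans (le_of_eq ?_)
      field_simp
      ring
  have := key h 1 zero_le_one le_rfl
  rw [binom_one, mul_one] at this
  push_cast
  refine this.trans (mul_le_mul_of_nonneg_left ?_ hC0.le)
  have hn : (0 : ℝ) < n + 1 := by positivity
  rw [div_le_iff₀ (by positivity)]
  have h5 : ((n : ℝ) + 1) ^ (ρ - 1) * ((n : ℝ) + 1) ^ ε = n + 1 := by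
    rw [← Real.rpow_add hn, hε]
    norm_num
  rw [mul_add, h5, mul_one]
  linarith [Real.rpow_nonneg hn.le (ρ - 1)]

lemma multi_natCast_mul (n : ℕ) (a : 𝒜) (F : (𝒜 → ℕ) → ℝ) :
    multi p (n + 1) (fun c => (c a : ℝ) * F c) =
      (n + 1) * p a * multi p n (fun c => F (c + Pi.single a 1)) := by
  have split : ∀ (k : ℕ) (F : (𝒜 → ℕ) → ℝ), multi p (k + 1) (fun c => (c a : ℝ) * F c) =
      ∑ b, p b * multi p k (fun c => (c a : ℝ) * F (c + Pi.single b 1))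
        + p a * multi p k (fun c => F (c + Pi.single a 1)) := fun k F => by
    have e : ∀ b, multi p k (fun c => (((c + Pi.single b 1 : 𝒜 → ℕ) a : ℕ) : ℝ)
        * F (c + Pi.single b 1)) = multi p k (fun c => (c a : ℝ) * F (c + Pi.single b 1))
          + if b = a then multi p k (fun c => F (c + Pi.single a 1)) else 0 := fun b => by
      split_ifs with hb
      · rw [hb, ← multi_add]
        congr 1
        funext c
        simp only [Pi.add_apply, Pi.single_eq_same]
        push_cast
        ring
      · rw [add_zero]
        congr 1
        funext c
        simp [Ne.symm hb]
    simp only [multi_succ, smul_eq_mul, e, mul_add, mul_ite, mul_zero, Finset.sum_add_distrib,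
      Finset.sum_ite_eq', Finset.mem_univ, if_true]
  induction n generalizing F with
  | zero =>
    rw [split]
    simp [multi_zero]
  | succ n ih =>
    rw [split]
    have e : ∀ b, multi p (n + 1) (fun c => (c a : ℝ) * F (c + Pi.single b 1)) =
        (n + 1) * p a * multi p n (fun c => F (c + Pi.single b 1 + Pi.single a 1)) := fun b => by
      refine (ih (fun c => F (c + Pi.single b 1))).trans ?_
      simp only [add_right_comm]
    simp only [e]
    rw [show multi p (n + 1) (fun c => F (c + Pi.single a 1)) = ∑ b, p b *
      multi p n (fun c => F (c + Pi.single b 1 + Pi.single a 1)) from rfl]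
    push_cast
    rw [Finset.mul_sum, Finset.mul_sum, ← Finset.sum_add_distrib]
    exact Finset.sum_congr rfl fun b _ => by ring

/-- The covariance of the size with a statistic that is additive over the labelings, and looks at
the letters of the first `J` levels. -/
noncomputable def covSize (p : 𝒜 → ℝ) (M : ℕ) (w : 𝒜 → ℝ) (h : ℕ) : ℕ → ℕ → ℝ
  | 0, _ => 0
  | J + 1, n => M * (multi p n (fun c => ∑ a, w a * covSize p M w h J (c a))
      + multi p n (fun c => (∑ a, (w a - 1) * (c a : ℝ))
        * (levelMean p M (h + J) c - multi p n (levelMean p M (h + J)))))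

/-- The variance, for a single labeling, of the statistic of `covSize`. -/
noncomputable def statVar (p : 𝒜 → ℝ) (M : ℕ) (w : 𝒜 → ℝ) : ℕ → ℝ
  | 0 => 0
  | J + 1 => M * (∑ a, w a ^ 2 * p a * statVar p M w J + ∑ a, p a * (w a - 1) ^ 2)

omit [DecidableEq 𝒜] in
lemma statVar_nonneg (hp : NonExplosive p M) (w : 𝒜 → ℝ) (J : ℕ) : 0 ≤ statVar p M w J := by
  induction J with
  | zero => exact le_rfl
  | succ J ih =>
    have := fun a => (hp.pos a).le
    rw [statVar]
    have h1 : 0 ≤ ∑ a, w a ^ 2 * p a * statVar p M w J := Finset.sum_nonneg fun a _ =>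
      mul_nonneg (mul_nonneg (sq_nonneg _) (this a)) ih
    have h2 : 0 ≤ ∑ a, p a * (w a - 1) ^ 2 := Finset.sum_nonneg fun a _ =>
      mul_nonneg (this a) (sq_nonneg _)
    positivity

/-- The quadratic form of the covariance matrix is nonnegative. -/
lemma varSize_add_covSize_nonneg (hp : NonExplosive p M) {w : 𝒜 → ℝ} (hw : ∑ a, p a * w a = 1)
    (h J n : ℕ) (x : ℝ) :
    0 ≤ varSize p M (h + J) n + 2 * x * covSize p M w h J n + x ^ 2 * (statVar p M w J * n) := by
  have hp0 : ∀ a, 0 ≤ p a := fun a => (hp.pos a).le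
  induction J generalizing n x with
  | zero => simpa [covSize, statVar] using varSize_nonneg hp h n
  | succ J ih =>
    have hξ : ∑ a, p a * (w a - 1) = 0 := by
      simp only [mul_sub, mul_one, Finset.sum_sub_distrib, hw, hp.sum_eq, sub_self]
    set m := multi p n (levelMean p M (h + J)) with hm
    set L : (𝒜 → ℕ) → ℝ := fun c => ∑ a, (w a - 1) * (c a : ℝ) with hL
    -- In the subtrie of letter `a` the statistic carries the weight `w a`, so the induction
    -- hypothesis is used at `x * w a`.
    have h1 : ∀ c : 𝒜 → ℕ, 0 ≤ ∑ a, (varSize p M (h + J) (c a)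
        + 2 * (x * w a) * covSize p M w h J (c a) + (x * w a) ^ 2 * (statVar p M w J * (c a : ℝ)))
        + (levelMean p M (h + J) c - m + x * L c) ^ 2 := fun c =>
      add_nonneg (Finset.sum_nonneg fun a _ => ih _ _) (sq_nonneg _)
    have h2 := mul_nonneg (Nat.cast_nonneg M : (0 : ℝ) ≤ M) (multi_nonneg hp0 n h1)
    refine h2.trans (le_of_eq ?_)
    have e1 : multi p n (fun c => ∑ a, w a ^ 2 * statVar p M w J * (c a : ℝ)) =
        n * ∑ a, w a ^ 2 * p a * statVar p M w J := by
      rw [multi_finset_sum, Finset.mul_sum]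
      refine Finset.sum_congr rfl fun a _ => ?_
      rw [multi_const_mul, multi_apply hp.sum_eq n a (fun k => (k : ℝ)), binom_id]
      ring
    have e2 : multi p n (fun c => L c ^ 2) = n * ∑ a, p a * (w a - 1) ^ 2 :=
      multi_sq_linear hp.sum_eq hξ n
    have e3 : (fun c : 𝒜 → ℕ => ∑ a, (varSize p M (h + J) (c a)
        + 2 * (x * w a) * covSize p M w h J (c a) + (x * w a) ^ 2 * (statVar p M w J * (c a : ℝ)))
        + (levelMean p M (h + J) c - m + x * L c) ^ 2) = fun c =>
        (∑ a, varSize p M (h + J) (c a) + (levelMean p M (h + J) c - m) ^ 2)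
        + (2 * x * (∑ a, w a * covSize p M w h J (c a) + L c * (levelMean p M (h + J) c - m))
        + x ^ 2 * (∑ a, w a ^ 2 * statVar p M w J * (c a : ℝ) + L c ^ 2)) := by
      funext c
      simp only [mul_add, Finset.mul_sum, Finset.sum_add_distrib]
      have f1 : ∀ a, 2 * (x * w a) * covSize p M w h J (c a)
        = 2 * x * (w a * covSize p M w h J (c a)) := fun a => by ring
      have f2 : ∀ a, (x * w a) ^ 2 * (statVar p M w J * (c a : ℝ))
        = x ^ 2 * (w a ^ 2 * statVar p M w J * (c a : ℝ)) := fun a => by ring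
      simp only [f1, f2]
      ring
    rw [e3]
    simp only [multi_add, multi_const_mul]
    rw [e1, e2, ← add_assoc h J 1, varSize, covSize, statVar, multiVar]
    ring

/-- The part of `covSize` that satisfies a linear recursion. -/
noncomputable def covGrowth (p : 𝒜 → ℝ) (M : ℕ) (w : 𝒜 → ℝ) (h : ℕ) : ℕ → ℕ → ℝ
  | 0, n => meanDiff p M h n
  | J + 1, n => (if n = 1 then 1 else 0)
      + M * ∑ a, p a * w a * binom (p a) n (covGrowth p M w h J)

/-- Size-biasing: each of the `n` labelings contributes equally to the covariance, namely the
expected number of nodes it adds to the other `n - 1` when its first `J` levels have the tilted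
letter law `p a * w a`, minus the same with the law `p`. The former is `covGrowth`. -/
lemma covSize_eq (hp : NonExplosive p M) {w : 𝒜 → ℝ} (hw : ∑ a, p a * w a = 1) (h J n : ℕ) :
    covSize p M w h J n = n * (covGrowth p M w h J (n - 1) - meanDiff p M (h + J) (n - 1)) := by
  induction J generalizing n with
  | zero => simp [covSize, covGrowth]
  | succ J ih =>
    have hξ : ∑ a, p a * (w a - 1) = 0 := by
      simp only [mul_sub, mul_one, Finset.sum_sub_distrib, hw, hp.sum_eq, sub_self]
    rcases n with _ | n
    · rw [covSize]
      simp [multi_zero, ih]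
    set G := levelMean p M (h + J) with hG
    set m := multi p (n + 1) G with hm
    have e1 : multi p (n + 1) (fun c => ∑ a, w a * covSize p M w h J (c a)) =
        (n + 1) * ∑ a, p a * w a * (binom (p a) n (covGrowth p M w h J)
          - binom (p a) n (meanDiff p M (h + J))) := by
      rw [multi_finset_sum, Finset.mul_sum]
      refine Finset.sum_congr rfl fun a _ => ?_
      rw [multi_const_mul, multi_apply hp.sum_eq, funext ih, binom_id_mul]
      simp only [Nat.add_sub_cancel, binom_sub]
      ring
    have e2 : multi p (n + 1) (fun c => (∑ a, (w a - 1) * (c a : ℝ)) * (G c - m)) =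
        (n + 1) * ∑ a, p a * (w a - 1) * binom (p a) n (meanDiff p M (h + J)) := by
      simp only [Finset.sum_mul]
      rw [multi_finset_sum]
      have e3 : ∀ a, multi p (n + 1) (fun c => (w a - 1) * (c a : ℝ) * (G c - m)) =
          (n + 1) * (p a * (w a - 1) * binom (p a) n (meanDiff p M (h + J)))
            + (n + 1) * (multi p n G - m) * (p a * (w a - 1)) := fun a => by
        simp only [mul_assoc (w a - 1)]
        rw [multi_const_mul, multi_natCast_mul n a (fun c => G c - m)]
        simp only [hG, levelMean_add_single]
        rw [multi_sub, multi_add, multi_const hp.sum_eq, multi_apply hp.sum_eq]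
        ring
      simp only [e3, Finset.sum_add_distrib, ← Finset.mul_sum, hξ, mul_zero, add_zero]
    rw [covSize, e1, e2, covGrowth, ← add_assoc h J 1, Nat.add_sub_cancel,
      meanDiff_succ hp.sum_eq]
    simp only [mul_sub, sub_mul, mul_one, Finset.sum_sub_distrib]
    push_cast
    ring

end Covariance


/-! ### Lower bound for non-uniform letters and choice of exponents -/

section LowerBoundsNonuniform

variable {𝒜 : Type*} [Fintype 𝒜] [DecidableEq 𝒜] {p : 𝒜 → ℝ} {M : ℕ} {ρ q P : ℝ}

/-- The recursion for the averaged `meanDiff` has `x ^ (ρ - 1)` as its invariant power. The seed is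
the event of exactly one success, where the additional labeling creates the root. -/
lemma exists_rpow_le_binom_meanDiff (hp : NonExplosive p M) (hρ1 : 1 ≤ ρ)
    (hρ : M * ∑ a, p a ^ ρ = 1) (hq0 : 0 < q) (hqP : ∀ a, q ≤ p a ∧ p a ≤ P) :
    ∃ c > 0, ∀ n : ℕ, 1 ≤ n → ∀ (h : ℕ) (x : ℝ), 0 ≤ x → x ≤ 1 → q ≤ n * x →
      n * x * P ^ h ≤ 1 → c * (n * x) ^ (ρ - 1) ≤ binom x n (meanDiff p M (h + 1)) := by
  refine ⟨q * Real.exp (-1), by positivity, fun n hn h x hx0 hx1 hqx hPx => ?_⟩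
  have hw : ∀ a, 0 ≤ M * p a := fun a => mul_nonneg (Nat.cast_nonneg _) (hp.pos a).le
  have e : ∀ h x, binom x n (meanDiff p M (h + 1)) = binom x n (fun k => if k = 1 then 1 else 0) +
      ∑ a, M * p a * binom (x * p a) n (meanDiff p M h) := fun h x => by
    rw [show meanDiff p M (h + 1) = fun k => (if k = 1 then 1 else 0)
      + M * ∑ a, p a * binom (p a) k (meanDiff p M h) from
      funext fun k => meanDiff_succ hp.sum_eq h k, binom_add, binom_const_mul, binom_finset_sum,
      Finset.mul_sum]
    simp only [binom_const_mul, binom_binom, mul_assoc]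
  obtain ⟨m, rfl⟩ : ∃ m, n = m + 1 := ⟨n - 1, by omega⟩
  refine rpow_le_of_recursion hp hq0 hqP (u := fun h x => binom x (m + 1) (meanDiff p M h))
    (w := fun a => M * p a) (b := ρ - 1) (by linarith) (by positivity) hw (le_of_eq ?_) (m + 1)
    (fun h x hx0 hx1 hqx hx => ?_) (fun h x hx0 hx1 => ?_) h x hx0 hx1 hqx hPx
  · refine hρ.symm.trans ?_
    rw [Finset.mul_sum]
    refine Finset.sum_congr rfl fun a _ => ?_
    rw [mul_assoc, ← Real.rpow_one_add' (hp.pos a).le (by linarith), add_sub_cancel]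
  · simp only [e, binom_ite_one]
    push_cast at hqx hx
    have h1 : 0 ≤ ∑ a, M * p a * binom (x * p a) (m + 1) (meanDiff p M h) :=
      Finset.sum_nonneg fun a _ => mul_nonneg (hw a) (binom_nonneg (mul_nonneg hx0 (hp.pos a).le)
        (mul_le_one₀ hx1 (hp.pos a).le (hp.lt_one a).le) _ fun _ _ => meanDiff_nonneg hp _ _)
    have h2 := exp_neg_one_le_one_sub_pow hx
    have h3 : q * Real.exp (-1) ≤ (m + 1) * x * (1 - x) ^ m := by gcongr
    linarith
  · simp only [e]
    have : 0 ≤ binom x (m + 1) (fun k => if k = 1 then 1 else 0) :=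
      binom_nonneg hx0 hx1 _ fun k _ => by split_ifs <;> norm_num
    linarith

/-- Every tilted level multiplies the power by `M * ∑ a, p a * w a * p a ^ b`. The factor `q ^ J`
keeps the mean count at least `q` after `J` levels. -/
lemma rpow_le_binom_covGrowth (hp : NonExplosive p M) {w : 𝒜 → ℝ} {b c : ℝ} (hw : ∀ a, 0 ≤ w a)
    (hq0 : 0 < q) (hqP : ∀ a, q ≤ p a ∧ p a ≤ P) {h n : ℕ}
    (h0 : ∀ x : ℝ, 0 ≤ x → x ≤ 1 → q ≤ n * x →
      n * x * P ^ h ≤ 1 → c * (n * x) ^ b ≤ binom x n (meanDiff p M (h + 1))) (J : ℕ) (x : ℝ)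
    (hx0 : 0 ≤ x) (hx1 : x ≤ 1) (hqx : q ≤ n * x * q ^ J) (hPx : n * x * P ^ h ≤ 1) :
    (M * ∑ a, p a * w a * p a ^ b) ^ J * (c * (n * x) ^ b) ≤
      binom x n (covGrowth p M w (h + 1) J) := by
  have hnx : 0 ≤ n * x := by positivity
  induction J generalizing x with
  | zero =>
    rw [pow_zero, one_mul]
    exact h0 x hx0 hx1 (by simpa using hqx) hPx
  | succ J ih =>
    have e : binom x n (covGrowth p M w (h + 1) (J + 1)) =
        binom x n (fun k => if k = 1 then 1 else 0) +
        M * ∑ a, p a * w a * binom (x * p a) n (covGrowth p M w (h + 1) J) := by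
      rw [show covGrowth p M w (h + 1) (J + 1) = fun k => (if k = 1 then 1 else 0)
        + M * ∑ a, p a * w a * binom (p a) k (covGrowth p M w (h + 1) J) from rfl,
        binom_add, binom_const_mul, binom_finset_sum]
      simp only [binom_const_mul, binom_binom]
    have h1 : 0 ≤ binom x n (fun k => if k = 1 then 1 else 0) :=
      binom_nonneg hx0 hx1 _ fun k _ => by split_ifs <;> norm_num
    have h2 : ∀ a, (M * ∑ a, p a * w a * p a ^ b) ^ J * (c * (n * x) ^ b) * (p a * w a * p a ^ b) ≤
        p a * w a * binom (x * p a) n (covGrowth p M w (h + 1) J) := fun a => by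
      have hpa := hp.pos a
      have h3 := ih (x * p a) (by positivity) (mul_le_one₀ hx1 hpa.le (hp.lt_one a).le) ?_ ?_
        (by positivity)
      · rw [← mul_assoc (n : ℝ), Real.mul_rpow hnx hpa.le] at h3
        calc _ = p a * w a * ((M * ∑ a, p a * w a * p a ^ b) ^ J *
              (c * ((n * x) ^ b * p a ^ b))) := by ring
          _ ≤ _ := mul_le_mul_of_nonneg_left h3 (mul_nonneg hpa.le (hw a))
      · refine hqx.trans ?_
        rw [pow_succ', ← mul_assoc, ← mul_assoc]
        have := (hqP a).1
        gcongr
      · refine le_trans ?_ hPx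
        rw [← mul_assoc]
        have : n * x * p a ≤ n * x := mul_le_of_le_one_right hnx (hp.lt_one a).le
        have hP0 : 0 ≤ P := hpa.le.trans (hqP a).2
        gcongr
    rw [e]
    have h3 := mul_le_mul_of_nonneg_left (Finset.sum_le_sum fun a (_ : a ∈ Finset.univ) => h2 a)
      (Nat.cast_nonneg M : (0 : ℝ) ≤ M)
    rw [← Finset.mul_sum] at h3
    rw [pow_succ]
    linarith

/-- If the letter probabilities are not uniform, the letters close to the root make the variance
larger than the expectation. -/
lemma exists_rpow_le_varSize_of_ne (hp : NonExplosive p M) (hρ1 : 1 ≤ ρ) (hρ2 : ρ < 2)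
    (hρ : M * ∑ a, p a ^ ρ = 1) (hne : ∃ a, M * p a ^ (ρ - 1) ≠ 1) :
    ∃ c > 0, ∀ n : ℕ, 2 ≤ n → ∃ h₀ : ℕ, ∀ h ≥ h₀, c * (n : ℝ) ^ (2 * ρ - 1) ≤ varSize p M h n := by
  obtain ⟨q, P, hq0, hP1, hqP⟩ := exists_probability_bounds hp
  obtain ⟨a₀⟩ := hp.nonempty
  have hP0 : 0 ≤ P := hq0.le.trans ((hqP a₀).1.trans (hqP a₀).2)
  obtain ⟨c₁, hc₁, H₁⟩ := exists_rpow_le_varSize hp hρ1 hρ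
  obtain ⟨c₂, hc₂, H₂⟩ := exists_rpow_le_binom_meanDiff hp hρ1 hρ hq0 hqP
  obtain ⟨C, hC, H₃⟩ := meanDiff_le_rpow hp hρ1 hρ2 hρ
  have hγ : 0 ≤ ρ - 1 := by linarith
  -- This tilt is a probability density with respect to `p` by the definition of `ρ`. It makes the
  -- gain per level `κ` equal to its second moment, so `κ - 1` is its variance, positive unless the
  -- tilt is constant.
  set w : 𝒜 → ℝ := fun a => M * p a ^ (ρ - 1) with hw
  have hw0 : ∀ a, 0 ≤ w a := fun a =>
    mul_nonneg (Nat.cast_nonneg _) (Real.rpow_nonneg (hp.pos a).le _)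
  have hw1 : ∑ a, p a * w a = 1 := by
    rw [← hρ, Finset.mul_sum]
    refine Finset.sum_congr rfl fun a _ => ?_
    simp only [hw]
    rw [mul_left_comm, ← Real.rpow_one_add' (hp.pos a).le (by linarith), add_sub_cancel]
  set κ := M * ∑ a, p a * w a * p a ^ (ρ - 1) with hκ
  have hκ1 : 1 < κ := by
    have e : κ - 1 = ∑ a, p a * (w a - 1) ^ 2 := by
      have e1 : κ = ∑ a, p a * w a ^ 2 := by
        rw [hκ, Finset.mul_sum]
        exact Finset.sum_congr rfl fun a _ => by simp only [hw]; ring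
      have e2 : ∀ a, p a * (w a - 1) ^ 2 = p a * w a ^ 2 - 2 * (p a * w a) + p a := fun a => by ring
      simp only [e2, Finset.sum_add_distrib, Finset.sum_sub_distrib, ← Finset.mul_sum, hw1,
        hp.sum_eq, e1]
      ring
    obtain ⟨a, ha⟩ := hne
    have : 0 < ∑ a, p a * (w a - 1) ^ 2 := by
      refine Finset.sum_pos' (fun b _ => mul_nonneg (hp.pos b).le (sq_nonneg _))
        ⟨a, Finset.mem_univ a, mul_pos (hp.pos a) ?_⟩
      have : w a - 1 ≠ 0 := sub_ne_zero.2 ha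
      positivity
    linarith
  -- Enough tilted levels for the lower bound on `covGrowth` to exceed the upper bound `C * m ^ (ρ -
  -- 1)` on `meanDiff`, which has the same order.
  obtain ⟨J, hJ⟩ := pow_unbounded_of_one_lt ((C + 1) / c₂) hκ1
  have hJ' : C + 1 ≤ κ ^ J * c₂ := by
    rw [div_lt_iff₀ hc₂] at hJ
    exact hJ.le
  set W := statVar p M w J + 1 with hW
  have hW0 : 0 < W := by
    have := statVar_nonneg hp w J
    linarith
  obtain ⟨N, hN⟩ := exists_nat_ge (q / q ^ J + 2)
  have hN2 : (2 : ℝ) ≤ N := by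
    have : 0 ≤ q / q ^ J := by positivity
    linarith
  set c₃ := (2⁻¹ : ℝ) ^ (2 * (ρ - 1)) / W with hc₃
  set c₄ := c₁ / (N : ℝ) ^ (ρ - 1) with hc₄
  have hc₃0 : 0 < c₃ := by positivity
  have hc₄0 : 0 < c₄ := by positivity
  refine ⟨min c₃ c₄, lt_min hc₃0 hc₄0, fun n hn => ?_⟩
  have hn' : (2 : ℝ) ≤ n := by exact_mod_cast hn
  have hn0 : (0 : ℝ) < n := by linarith
  -- Finitely many `n` are covered by the weaker bound of order `n ^ ρ`, at the price of a constant.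
  rcases le_or_gt n N with hnN | hnN
  · obtain ⟨h₀, hh₀⟩ := H₁ n hn
    refine ⟨h₀, fun h hh => le_trans ?_ (hh₀ h hh)⟩
    calc min c₃ c₄ * (n : ℝ) ^ (2 * ρ - 1) ≤ c₄ * (n : ℝ) ^ (2 * ρ - 1) := by
          gcongr; exact min_le_right _ _
      _ = c₁ * (n : ℝ) ^ ρ * ((n : ℝ) ^ (ρ - 1) / (N : ℝ) ^ (ρ - 1)) := by
          rw [show 2 * ρ - 1 = ρ + (ρ - 1) by ring, Real.rpow_add hn0, hc₄]; ring
      _ ≤ c₁ * (n : ℝ) ^ ρ := by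
          refine mul_le_of_le_one_right (by positivity) (div_le_one_of_le₀ ?_ (by positivity))
          gcongr
  · obtain ⟨m, rfl⟩ : ∃ m, n = m + 1 := ⟨n - 1, by omega⟩
    have hm1 : 1 ≤ m := by omega
    have hm : (1 : ℝ) ≤ m := by exact_mod_cast hm1
    have hmN : (N : ℝ) ≤ m := by exact_mod_cast (by omega : N ≤ m)
    obtain ⟨h₀, hh₀⟩ := exists_pow_mul_le_one hP0 hP1 (by linarith : (0 : ℝ) < m)
    refine ⟨h₀ + 1 + J, fun h hh => ?_⟩
    obtain ⟨k, rfl, hk⟩ : ∃ k, h = k + 1 + J ∧ h₀ ≤ k := ⟨h - 1 - J, by omega, by omega⟩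
    have h1 := rpow_le_binom_covGrowth hp hw0 hq0 hqP (fun x => H₂ m hm1 k x) J 1
      zero_le_one le_rfl (by
        rw [mul_one, ← div_le_iff₀ (by positivity)]
        linarith) (by rw [mul_one]; exact hh₀ k hk)
    rw [mul_one, binom_one, ← hκ] at h1
    have h2 := H₃ (k + 1 + J) m
    have h3 := covSize_eq hp hw1 (k + 1) J (m + 1)
    rw [Nat.add_sub_cancel] at h3
    set X := (m : ℝ) ^ (ρ - 1) with hX
    have hX0 : 0 < X := by positivity
    have h4 : X ≤ covGrowth p M w (k + 1) J m - meanDiff p M (k + 1 + J) m := by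
      have := mul_le_mul_of_nonneg_right hJ' hX0.le
      nlinarith
    set Y := covGrowth p M w (k + 1) J m - meanDiff p M (k + 1 + J) m with hY
    -- Cauchy–Schwarz in the form of an almost optimal multiplier: the covariance is `n * Y`, and
    -- `W` exceeds the variance of the statistic per labeling by one so as to be positive. This
    -- gives a variance of at least `n * Y ^ 2 / W`.
    have h5 := varSize_add_covSize_nonneg hp hw1 (k + 1) J (m + 1) (-(Y / W))
    rw [h3] at h5
    have h6 : ((m + 1 : ℕ) : ℝ) * Y ^ 2 / W ≤ varSize p M (k + 1 + J) (m + 1) := by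
      have e : 2 * -(Y / W) * (((m + 1 : ℕ) : ℝ) * Y)
          + (-(Y / W)) ^ 2 * (statVar p M w J * ((m + 1 : ℕ) : ℝ)) =
          -(((m + 1 : ℕ) : ℝ) * Y ^ 2 / W) - (Y / W) ^ 2 * ((m + 1 : ℕ) : ℝ) := by
        have : statVar p M w J = W - 1 := by rw [hW]; ring
        rw [this]
        field_simp
        ring
      have : 0 ≤ (Y / W) ^ 2 * ((m + 1 : ℕ) : ℝ) := by positivity
      linarith
    refine le_trans ?_ h6
    have h7 : (2⁻¹ : ℝ) ^ (2 * (ρ - 1)) * ((m + 1 : ℕ) : ℝ) ^ (2 * (ρ - 1)) ≤ Y ^ 2 := by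
      rw [← Real.mul_rpow (by norm_num) hn0.le]
      calc (2⁻¹ * ((m + 1 : ℕ) : ℝ)) ^ (2 * (ρ - 1)) ≤ (m : ℝ) ^ (2 * (ρ - 1)) := by
            refine Real.rpow_le_rpow (by positivity) ?_ (by linarith)
            push_cast; linarith
        _ = X ^ 2 := by
            rw [hX, ← Real.rpow_natCast, ← Real.rpow_mul (by linarith)]
            congr 1; push_cast; ring
        _ ≤ Y ^ 2 := pow_le_pow_left₀ hX0.le h4 2
    calc min c₃ c₄ * ((m + 1 : ℕ) : ℝ) ^ (2 * ρ - 1) ≤ c₃ * ((m + 1 : ℕ) : ℝ) ^ (2 * ρ - 1) := by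
          gcongr; exact min_le_left _ _
      _ = ((m + 1 : ℕ) : ℝ) * ((2⁻¹ : ℝ) ^ (2 * (ρ - 1)) * ((m + 1 : ℕ) : ℝ) ^ (2 * (ρ - 1))) / W := by
          rw [show 2 * ρ - 1 = 2 * (ρ - 1) + 1 by ring, Real.rpow_add_one hn0.ne', hc₃]; ring
      _ ≤ _ := by gcongr

/-- The slopes are nonnegative and at most of order `n ^ (1 - s)`, so their spread needs no further
argument with `r = 1 - s`. -/
lemma exists_spreadBound (hp : NonExplosive p M) {s : ℝ} (hs0 : 0 < s) (hs1 : s < 1)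
    (hs : M * ∑ a, p a ^ (2 - s) < 1) : ∃ D, SpreadBound p M s (1 - s) D := by
  obtain ⟨D, hD, H⟩ := meanDiff_le (y := 2 - s) hp (by linarith) (by linarith) hs
  refine ⟨D, { hp with
    s_pos := hs0
    s_lt := hs1
    sum_lt := hs
    le_r := by linarith
    r_le := le_rfl
    D_nonneg := hD.le
    spread := fun h n hn a b => ?_ }⟩
  have h1 : ∀ a, slope p M h n a ≤ D * (n : ℝ) ^ (1 - s) := fun a => by
    refine (H h _).trans ?_
    rw [show 2 - s - 1 = 1 - s by ring]
    have := floor_mul_le (hp.lt_one a).le n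
    have : 0 ≤ 1 - s := by linarith
    gcongr
  have h2 : ∀ a, 0 ≤ slope p M h n a := fun a => meanDiff_nonneg hp _ _
  exact abs_sub_le_of_nonneg_of_le (h2 a) (h1 a) (h2 b) (h1 b)

lemma exists_second_moment_le (hp : NonExplosive p M) (n : ℕ) :
    ∃ C : ℝ, ∀ h, varSize p M h n + meanSize p M h n ^ 2 ≤ C := by
  obtain ⟨ρ, hρ1, hρ2, -, hlt⟩ := exists_critical_exponent hp
  obtain ⟨D, hS⟩ := exists_spreadBound hp (s := 2 - (ρ + (2 - ρ) / 2)) (by linarith) (by linarith)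
    (hlt _ (by linarith))
  obtain ⟨C₁, -, H₁⟩ := abs_meanSize_le hS
  obtain ⟨C₂, -, H₂⟩ := varSize_le hS
  refine ⟨C₂ * (n : ℝ) ^ 3 + (C₁ * (n : ℝ) ^ 2) ^ 2, fun h => add_le_add (H₂ h n) ?_⟩
  rw [← sq_abs]
  exact pow_le_pow_left₀ (abs_nonneg _) (H₁ h n) 2

/-- The quantitative central limit theorem, uniformly in the height of truncation, together with a
lower bound for the variance. -/
lemma exists_gaussDist_le (hp : NonExplosive p M) :
    ∃ C c θ α x z : ℝ, 0 < C ∧ 0 < c ∧ 0 < θ ∧ 0 < α ∧ x < α * (1 + θ / 2) ∧ z < 3 / 2 * α ∧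
      (∀ h n : ℕ, ∀ t : ℝ, |t| ≤ 1 →
        gaussDist p M h n t ≤ C * (|t| ^ (2 + θ) * (n : ℝ) ^ x + |t| ^ 3 * (n : ℝ) ^ z)) ∧
      ∀ n : ℕ, 2 ≤ n → ∃ h₀ : ℕ, ∀ h ≥ h₀, c * (n : ℝ) ^ α ≤ varSize p M h n := by
  obtain ⟨ρ, hρ1, hρ2, hρ, hlt⟩ := exists_critical_exponent hp
  -- Three cases: `ρ = 1`; `ρ > 1` with a non-constant tilt; and `ρ > 1` with all `M * p a ^ (ρ -
  -- 1)` equal to `1`, which forces uniform letters and is treated first.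
  rcases hρ1.eq_or_lt with hρe | hρ1'
  on_goal 2 => by_cases hne : ∃ a, M * p a ^ (ρ - 1) ≠ 1
  on_goal 3 =>
    have heq : ∀ a b, p a = p b := fun a b => by
      push Not at hne
      have hM : (0 : ℝ) < M := by exact_mod_cast hp.one_le
      have h1 : p a ^ (ρ - 1) = p b ^ (ρ - 1) :=
        mul_left_cancel₀ hM.ne' ((hne a).trans (hne b).symm)
      exact (Real.rpow_left_inj (hp.pos a).le (hp.pos b).le (by linarith)).1 h1
    set η := min (2 - ρ) (1 / 2) with hη
    have hη0 : 0 < η := lt_min (by linarith) (by norm_num)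
    have hη1 : η ≤ 2 - ρ := min_le_left _ _
    have hη2 : η ≤ 1 / 2 := min_le_right _ _
    set s := 2 - (ρ + η / 256) with hs
    -- Equal probabilities give equal slopes, so the spread is zero and `r` may be as small as `1 /
    -- 2 - s`. Here `2 - s` is just above `ρ`.
    have hS : SpreadBound p M s (1 / 2 - s) 0 :=
      { hp with
        s_pos := by linarith
        s_lt := by linarith
        sum_lt := hlt _ (by linarith)
        le_r := le_rfl
        r_le := by linarith
        D_nonneg := le_rfl
        spread := fun h n hn a b => by simp [slope, heq a b] }
    obtain ⟨c, hc, Hc⟩ := exists_rpow_le_varSize hp hρ1 hρ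
    obtain ⟨C, hC, HC⟩ := gaussDist_le hS (w := max (1 / 2 - s + 1 - s) (1 - s))
      (le_max_left _ _) (le_max_right _ _) (θ := η / 32) (by positivity) (by linarith)
      (x := max (max (1 / 2 - s + 1 - s) (1 - s) + 1 / 2 + 8 * (η / 32)) (2 - s))
      (z := max (3 * (1 / 2 - s) + 1) (2 - s)) (le_max_left _ _) (le_max_left _ _)
      (le_max_right _ _) (le_max_right _ _)
    refine ⟨C, c, η / 32, ρ, _, _, hC, hc, by positivity, by linarith, ?_, ?_, HC, Hc⟩
    · have h1 : ρ + η / 64 ≤ ρ * (1 + η / 32 / 2) := by nlinarith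
      refine max_lt ?_ (by linarith)
      rw [← max_add_add_right, ← max_add_add_right]
      exact max_lt (by linarith) (by linarith)
    · exact max_lt (by linarith) (by linarith)
  all_goals
    obtain ⟨c, hc, Hc⟩ : ∃ c > 0, ∀ n : ℕ, 2 ≤ n → ∃ h₀ : ℕ, ∀ h ≥ h₀,
        c * (n : ℝ) ^ (2 * ρ - 1) ≤ varSize p M h n := by
      -- In the case `ρ = 1` the general bound already has the order `2 * ρ - 1 = ρ`.
      first
        | exact exists_rpow_le_varSize_of_ne hp hρ1 hρ2 hρ hne
        | have := exists_rpow_le_varSize hp hρ1 hρ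
          rwa [show 2 * ρ - 1 = ρ by linarith]
    set η := min (2 - ρ) (1 / 2) with hη
    have hη0 : 0 < η := lt_min (by linarith) (by norm_num)
    have hη1 : η ≤ 2 - ρ := min_le_left _ _
    have hη2 : η ≤ 1 / 2 := min_le_right _ _
    set s := 2 - (ρ + η / 256) with hs
    obtain ⟨D, hS⟩ := exists_spreadBound hp (s := s) (by linarith) (by linarith)
      (hlt _ (by linarith))
    obtain ⟨C, hC, HC⟩ := gaussDist_le hS (w := 2 * (1 - s))
      (by linarith) (by linarith) (θ := η / 32) (by positivity) (by linarith)
      (x := max (2 * (1 - s) + 1 / 2 + 8 * (η / 32)) (2 - s))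
      (z := max (3 * (1 - s) + 1) (2 - s)) (le_max_left _ _) (le_max_left _ _)
      (le_max_right _ _) (le_max_right _ _)
    refine ⟨C, c, η / 32, 2 * ρ - 1, _, _, hC, hc, by positivity, by linarith, ?_, ?_, HC, Hc⟩
    · have h1 : 2 * ρ - 1 + η / 64 ≤ (2 * ρ - 1) * (1 + η / 32 / 2) := by nlinarith
      exact max_lt (by linarith) (by linarith)
    · exact max_lt (by linarith) (by linarith)

end LowerBoundsNonuniform


/-! ### Nodes of bounded depth -/

section Truncation

variable {M : ℕ} {𝒜 ι : Type*}

/-- The nodes at depth `< h` of the G-trie built from the labelings `L k`. -/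
def truncNodes (h : ℕ) (L : ι → Labeling M 𝒜) : Set (List (Fin M × 𝒜)) :=
  {w | w.length < h ∧ ∃ k l : ι, k ≠ l ∧ Occurs (L k) w ∧ Occurs (L l) w}

/-- The number of nodes at depth `< h` of the G-trie built from the labelings `L k`. -/
noncomputable def truncSize (h : ℕ) (L : ι → Labeling M 𝒜) : ℕ := (truncNodes h L).ncard

/-- The number of nodes at depth `≤ h` below the root's edges that go in a given direction, if
`l k` is the letter of the `k`-th labeling on this edge, and `L k` its restriction to the subtree. -/
noncomputable def branchSize [Fintype 𝒜] (h : ℕ) (l : ι → 𝒜) (L : ι → Labeling M 𝒜) : ℕ :=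
  ∑ a, truncSize h fun k : {k // l k = a} => L k

lemma truncNodes_succ (h : ℕ) (L : ι → Labeling M 𝒜) :
    truncNodes (h + 1) L = {w | w = [] ∧ ∃ k l : ι, k ≠ l} ∪ ⋃ q : Fin M × 𝒜,
      List.cons q '' truncNodes h fun k : {k // L k ([], q.1) = q.2} => (L k).sub q.1 := by
  ext w
  rcases w with _ | ⟨q, w⟩
  · simp [truncNodes, Occurs]
  · simp only [truncNodes, Set.mem_ofPred_eq, List.length_cons, add_lt_add_iff_right, Set.mem_union,
      reduceCtorEq, false_and, false_or, Set.mem_iUnion, Set.mem_image, List.cons.injEq]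
    constructor
    · rintro ⟨hw, k, l, hkl, ⟨h1, h2⟩, ⟨h3, h4⟩⟩
      exact ⟨q, w, ⟨hw, ⟨k, h1⟩, ⟨l, h3⟩, fun e => hkl (congrArg Subtype.val e), h2, h4⟩, rfl, rfl⟩
    · rintro ⟨_, _, ⟨hw, k, l, hkl, h2, h4⟩, rfl, rfl⟩
      exact ⟨hw, k, l, fun e => hkl (Subtype.ext e), ⟨k.2, h2⟩, ⟨l.2, h4⟩⟩

variable [Fintype 𝒜]

lemma finite_truncNodes (h : ℕ) (L : ι → Labeling M 𝒜) : (truncNodes h L).Finite :=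
  (List.finite_length_lt (Fin M × 𝒜) h).subset fun _ hw => hw.1

lemma truncSize_le (h : ℕ) (L : ι → Labeling M 𝒜) :
    truncSize h L ≤ {w : List (Fin M × 𝒜) | w.length < h}.ncard :=
  Set.ncard_le_ncard (fun _ hw => hw.1) (List.finite_length_lt (Fin M × 𝒜) h)

omit [Fintype 𝒜] in
lemma truncSize_zero (L : ι → Labeling M 𝒜) : truncSize 0 L = 0 := by
  have : truncNodes 0 L = ∅ := by
    ext w; simp [truncNodes]
  simp [truncSize, this]

lemma truncSize_succ [Finite ι] (h : ℕ) (L : ι → Labeling M 𝒜) :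
    truncSize (h + 1) L = (if 2 ≤ Nat.card ι then 1 else 0) +
      ∑ i, branchSize h (fun k => L k ([], i)) fun k => (L k).sub i := by
  have hfin : ∀ q : Fin M × 𝒜, (List.cons q '' truncNodes h
      fun k : {k // L k ([], q.1) = q.2} => (L k).sub q.1).Finite :=
    fun q => (finite_truncNodes h _).image _
  have hroot : {w : List (Fin M × 𝒜) | w = [] ∧ ∃ k l : ι, k ≠ l}.ncard =
      if 2 ≤ Nat.card ι then 1 else 0 := by
    have e : 2 ≤ Nat.card ι ↔ ∃ k l : ι, k ≠ l := by
      rw [Nat.succ_le_iff, Finite.one_lt_card_iff_nontrivial, nontrivial_iff]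
    split_ifs with hc
    · simp [e.1 hc]
    · have : {w : List (Fin M × 𝒜) | w = [] ∧ ∃ k l : ι, k ≠ l} = ∅ :=
        Set.eq_empty_of_forall_notMem fun w hw => hc (e.2 hw.2)
      rw [this, Set.ncard_empty]
  rw [truncSize, truncNodes_succ, Set.ncard_union_eq ?_ ?_ (Set.finite_iUnion hfin), hroot,
    Set.ncard_iUnion_of_finite hfin, finsum_eq_sum_of_fintype, Fintype.sum_prod_type]
  · congr 1
    refine Finset.sum_congr rfl fun i _ => Finset.sum_congr rfl fun a _ => ?_
    exact Set.ncard_image_of_injective _ List.cons_injective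
  · intro q q' hq
    rw [Function.onFun, Set.disjoint_left]
    rintro _ ⟨w, _, rfl⟩ ⟨w', _, hw'⟩
    exact hq (List.cons.inj hw').1.symm
  · rw [Set.disjoint_left]
    rintro _ ⟨rfl, _⟩ hw
    simp at hw
  · exact (Set.finite_singleton []).subset fun w hw => hw.1

variable [MeasurableSpace 𝒜] [DiscreteMeasurableSpace 𝒜]

omit [Fintype 𝒜] [DiscreteMeasurableSpace 𝒜] in
lemma measurable_sub (i : Fin M) :
    Measurable fun L : ι → Labeling M 𝒜 => fun k => (L k).sub i := by
  refine measurable_pi_lambda _ fun k => measurable_pi_lambda _ fun e => ?_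
  exact (measurable_pi_apply (i :: e.1, e.2)).comp (measurable_pi_apply k)

/-- By induction on the height: for each of the countably many configurations of root letters, the
branch is a finite sum of truncated sizes of subfamilies. -/
lemma measurable_truncSize [Finite ι] (h : ℕ) :
    Measurable fun L : ι → Labeling M 𝒜 => truncSize h L := by
  induction h generalizing ι with
  | zero => simp only [truncSize_zero]; exact measurable_const
  | succ h ih =>
    simp only [truncSize_succ]
    refine measurable_const.add (Finset.measurable_sum _ fun i _ => ?_)
    have h1 : Measurable fun z : (ι → 𝒜) × (ι → Labeling M 𝒜) => branchSize h z.1 z.2 := by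
      refine measurable_from_prod_countable_right fun l => ?_
      refine Finset.measurable_sum _ fun a _ => ?_
      refine (ih (ι := {k // l k = a})).comp (measurable_pi_lambda _ fun k => ?_)
      exact measurable_pi_apply k.1
    have h2 : Measurable fun L : ι → Labeling M 𝒜 => fun k => L k ([], i) :=
      measurable_pi_lambda _ fun k => (measurable_pi_apply ([], i)).comp (measurable_pi_apply k)
    have h3 := h1.comp (h2.prodMk (measurable_sub i))
    exact h3

lemma measurable_branchSize [Finite ι] (h : ℕ) (l : ι → 𝒜) :
    Measurable fun L : ι → Labeling M 𝒜 => branchSize h l L := by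
  refine Finset.measurable_sum _ fun a _ => ?_
  refine (measurable_truncSize (ι := {k // l k = a}) h).comp (measurable_pi_lambda _ fun k => ?_)
  exact measurable_pi_apply k.1

lemma measurable_uncurry_branchSize [Finite ι] (h : ℕ) :
    Measurable fun z : (ι → 𝒜) × (ι → Labeling M 𝒜) => branchSize h z.1 z.2 :=
  measurable_from_prod_countable_right fun l => measurable_branchSize h l

end Truncation

/-! ### Letter counts are multinomial -/

section Counts

variable {𝒜 : Type*} [Fintype 𝒜] [DecidableEq 𝒜] {p : 𝒜 → ℝ} {E : Type*} [NormedAddCommGroup E]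
  [NormedSpace ℝ E]

lemma sum_prod_smul_fin (n : ℕ) (G : (𝒜 → ℕ) → E) :
    ∑ l : Fin n → 𝒜, (∏ k, p (l k)) • G (fun a => Nat.card {k // l k = a}) = multi p n G := by
  induction n generalizing G with
  | zero =>
    simp only [Finset.univ_unique, Finset.univ_eq_empty, Finset.prod_empty, one_smul,
      Finset.sum_singleton, multi_zero]
    congr 1
    funext a
    simp
  | succ n ih =>
    rw [← (Fin.consEquiv fun _ => 𝒜).sum_comp, Fintype.sum_prod_type, multi_succ]
    refine Finset.sum_congr rfl fun b _ => ?_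
    rw [← ih, Finset.smul_sum]
    refine Finset.sum_congr rfl fun l _ => ?_
    rw [smul_smul, Fin.prod_univ_succ]
    simp only [Fin.consEquiv_apply, Fin.cons_zero, Fin.cons_succ]
    congr 2
    funext a
    simp only [Nat.card_eq_fintype_card, Fintype.card_subtype, Pi.add_apply, Finset.card_filter]
    rw [Fin.sum_univ_succ]
    simp only [Fin.cons_zero, Fin.cons_succ, Pi.single_apply]
    rw [add_comm]
    congr 1
    simp only [eq_comm]

/-- Counts of independent letters are multinomial. -/
lemma sum_prod_smul {ι : Type*} [Fintype ι] [DecidableEq ι] (G : (𝒜 → ℕ) → E) :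
    ∑ l : ι → 𝒜, (∏ k, p (l k)) • G (fun a => Nat.card {k // l k = a}) =
      multi p (Nat.card ι) G := by
  let e := Finite.equivFin ι
  rw [← sum_prod_smul_fin, ← (e.symm.arrowCongr (Equiv.refl 𝒜)).sum_comp]
  refine Finset.sum_congr rfl fun l _ => ?_
  congr 1
  · exact e.prod_comp fun k => p (l k)
  · congr 1
    funext a
    exact Nat.card_congr (e.subtypeEquiv fun k => Iff.rfl)

end Counts

/-! ### Grouping independent families -/

section Independence

variable {Ω 𝒜 : Type*} [MeasurableSpace Ω] {μ : Measure Ω} [MeasurableSpace 𝒜]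

/-- Independence means that the joint law is a product measure, and currying identifies a product
over a sigma type with a product of products. -/
lemma iIndepFun_curry {K : Type*} {κ : K → Type*} {X : (i : K) → κ i → Ω → 𝒜}
    (mX : ∀ i j, Measurable (X i j)) (hX : iIndepFun (fun (q : (i : K) × κ i) => X q.1 q.2) μ) :
    iIndepFun (fun i ω j => X i j ω) μ := by
  have := hX.isProbabilityMeasure
  have hp : ∀ i j, IsProbabilityMeasure (μ.map (X i j)) := fun i j =>
    Measure.isProbabilityMeasure_map (mX i j).aemeasurable
  have hi : ∀ i, iIndepFun (X i) μ := fun i =>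
    hX.precomp (g := fun j => (⟨i, j⟩ : (i : K) × κ i)) sigma_mk_injective
  rw [iIndepFun_iff_map_fun_eq_infinitePi_map (by fun_prop)]
  have e : (MeasurableEquiv.piCurry fun (i : K) (_ : κ i) => 𝒜) ∘ (fun ω q => X q.1 q.2 ω)
      = fun ω i j => X i j ω := by
    ext; simp [Sigma.curry]
  rw [← e, ← Measure.map_map (by fun_prop) (by fun_prop),
    (iIndepFun_iff_map_fun_eq_infinitePi_map (by fun_prop)).1 hX,
    Measure.infinitePi_map_piCurry (fun i j => μ.map (X i j))]
  congr 1
  funext i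
  rw [(iIndepFun_iff_map_fun_eq_infinitePi_map (by fun_prop)).1 (hi i)]

end Independence


/-! ### Moments of sums and conditioning on finitely many values -/

section Moments

variable {Ω : Type*} [MeasurableSpace Ω] {μ : Measure Ω} [IsProbabilityMeasure μ]

lemma memLp_natCast {S : Ω → ℕ} (hS : Measurable S) {C : ℕ} (hC : ∀ ω, S ω ≤ C) :
    MemLp (fun ω => (S ω : ℝ)) 2 μ := by
  refine MemLp.of_bound (measurable_from_nat.comp hS).aestronglyMeasurable C (ae_of_all _ fun ω => ?_)
  rw [Real.norm_natCast]
  exact_mod_cast hC ω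

lemma integral_sub_sq_eq {f : Ω → ℝ} (hf : MemLp f 2 μ) (m : ℝ) :
    ∫ ω, (f ω - m) ^ 2 ∂μ = variance f μ + (∫ ω, f ω ∂μ - m) ^ 2 := by
  rw [variance_eq_sub hf]
  have h1 : Integrable (fun ω => f ω ^ 2) μ := hf.integrable_sq
  have h2 : Integrable (fun ω => 2 * m * f ω) μ := (hf.integrable one_le_two).const_mul _
  have h3 : Integrable (fun ω => f ω ^ 2 - 2 * m * f ω) μ := h1.sub h2
  have e : ∀ ω, (f ω - m) ^ 2 = f ω ^ 2 - 2 * m * f ω + m ^ 2 := fun ω => by ring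
  simp only [e, Pi.pow_apply]
  rw [integral_add h3 (integrable_const _), integral_sub h1 h2, integral_const_mul, integral_const]
  simp only [probReal_univ, one_smul]
  ring

lemma measurable_expI : Measurable expI := by
  unfold expI
  fun_prop

lemma measurable_expI_natCast {S : Ω → ℕ} (hS : Measurable S) (t : ℝ) :
    Measurable fun ω => expI (t * S ω) :=
  measurable_expI.comp (measurable_const.mul (measurable_from_nat.comp hS))

variable {K : Type*} [Fintype K] {T : K → Ω → ℕ} {C : ℕ}

lemma integral_natCast_sum (mT : ∀ k, Measurable (T k)) (hC : ∀ k ω, T k ω ≤ C) :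
    ∫ ω, ((∑ k, T k ω : ℕ) : ℝ) ∂μ = ∑ k, ∫ ω, (T k ω : ℝ) ∂μ := by
  simp only [Nat.cast_sum]
  exact integral_finsetSum _ fun k _ => (memLp_natCast (mT k) (hC k)).integrable one_le_two

lemma variance_natCast_sum (hT : iIndepFun T μ) (mT : ∀ k, Measurable (T k))
    (hC : ∀ k ω, T k ω ≤ C) :
    variance (fun ω => ((∑ k, T k ω : ℕ) : ℝ)) μ = ∑ k, variance (fun ω => (T k ω : ℝ)) μ := by
  rw [← IndepFun.variance_sum (fun k _ => memLp_natCast (mT k) (hC k)) fun k _ l _ hkl =>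
    (hT.indepFun hkl).comp measurable_from_nat measurable_from_nat]
  congr 1
  funext ω
  simp

omit [IsProbabilityMeasure μ] in
lemma integral_expI_sum (hT : iIndepFun T μ) (mT : ∀ k, Measurable (T k)) (t : ℝ) :
    ∫ ω, expI (t * (∑ k, T k ω : ℕ)) ∂μ = ∏ k, ∫ ω, expI (t * T k ω) ∂μ := by
  simp only [Nat.cast_sum, Finset.mul_sum, expI_sum]
  exact hT.integral_fun_prod_comp (f := fun _ (j : ℕ) => expI (t * j))
    (fun k => (mT k).aemeasurable) fun k => (measurable_from_nat).aestronglyMeasurable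

omit [IsProbabilityMeasure μ] in
/-- Conditioning on a variable with finitely many values. -/
lemma integral_eq_sum_of_indepFun {α β E : Type*} [Fintype α] [MeasurableSpace α]
    [MeasurableSingletonClass α] [MeasurableSpace β] [NormedAddCommGroup E] [NormedSpace ℝ E]
    {A : Ω → α} {B : Ω → β} (hAB : IndepFun A B μ) (hA : Measurable A) (hB : Measurable B)
    {F : α → β → E} (hF : ∀ l, StronglyMeasurable (F l))
    (hFi : ∀ l, Integrable (fun ω => F l (B ω)) μ) :
    ∫ ω, F (A ω) (B ω) ∂μ = ∑ l, μ.real {ω | A ω = l} • ∫ ω, F l (B ω) ∂μ := by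
  classical
  have mA : ∀ l, MeasurableSet {ω | A ω = l} := fun l => hA (measurableSet_singleton l)
  have e : (fun ω => F (A ω) (B ω)) =
      fun ω => ∑ l, {ω | A ω = l}.indicator (fun ω => F l (B ω)) ω := by
    funext ω
    rw [Finset.sum_eq_single (A ω)]
    · simp
    · intro l _ hl
      simp [Set.indicator, Ne.symm hl]
    · simp
  rw [e, integral_finsetSum _ fun l _ => (hFi l).indicator (mA l)]
  refine Finset.sum_congr rfl fun l _ => ?_
  rw [integral_indicator (mA l)]
  exact Indep.setIntegral_eq_smul (f := F l) hA.comap_le hAB hB.aemeasurable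
    ⟨{l}, measurableSet_singleton l, rfl⟩ (hF l).aestronglyMeasurable

end Moments

/-! ### Independence of the root letters, the branches and the groups -/

section Model

/-- The letters that a family of random labelings puts on the edges, as in `IsRandomLabelings`. -/
structure IsLetterFamily {M : ℕ} {ι 𝒜 : Type*} [MeasurableSpace 𝒜] (p : 𝒜 → ℝ)
    {Ω : Type*} [MeasurableSpace Ω] (X : ι → Edge M → Ω → 𝒜) (μ : Measure Ω) : Prop where
  measurable : ∀ k e, Measurable (X k e)
  indep : iIndepFun (fun (ke : ι × Edge M) => X ke.1 ke.2) μ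
  law : ∀ k e a, μ.real {ω | X k e ω = a} = p a

variable {M : ℕ} {ι 𝒜 : Type*} [MeasurableSpace 𝒜] {p : 𝒜 → ℝ} {Ω : Type*} [MeasurableSpace Ω]
  {μ : Measure Ω} {X : ι → Edge M → Ω → 𝒜}

lemma IsLetterFamily.sub (hX : IsLetterFamily p X μ) (i : Fin M) :
    IsLetterFamily p (fun k e => X k (i :: e.1, e.2)) μ where
  measurable k e := hX.measurable _ _
  indep := hX.indep.precomp (g := fun ke : ι × Edge M => (ke.1, (i :: ke.2.1, ke.2.2))) (by
    rintro ⟨k, v, j⟩ ⟨k', v', j'⟩ h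
    simpa using h)
  law k e a := hX.law _ _ _

lemma IsLetterFamily.restrict (hX : IsLetterFamily p X μ) (q : ι → Prop) :
    IsLetterFamily p (fun (k : {k // q k}) e => X k e) μ where
  measurable k e := hX.measurable _ _
  indep := hX.indep.precomp (g := fun ke : {k // q k} × Edge M => ((ke.1 : ι), ke.2)) (by
    rintro ⟨k, e⟩ ⟨k', e'⟩ h
    simpa [Subtype.ext_iff] using h)
  law k e a := hX.law _ _ _

/-- The two families read disjoint sets of edges; a Boolean index separates them so that
`iIndepFun_curry` applies. -/
lemma IsLetterFamily.indepFun_root_sub (hX : IsLetterFamily p X μ) (i : Fin M) :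
    IndepFun (fun ω k => X k ([], i) ω) (fun ω k (e : Edge M) => X k (i :: e.1, e.2) ω) μ := by
  let κ : Bool → Type _ := fun b => cond b ι (ι × Edge M)
  let g : (b : Bool) → κ b → ι × Edge M := fun b => match b with
    | true => fun k : ι => (k, ([], i))
    | false => fun ke : ι × Edge M => (ke.1, (i :: ke.2.1, ke.2.2))
  have hg : Function.Injective fun q : (b : Bool) × κ b => g q.1 q.2 := by
    rintro ⟨_ | _, x⟩ ⟨_ | _, y⟩ hxy
    · obtain ⟨k, v, j⟩ : ι × Edge M := x
      obtain ⟨k', v', j'⟩ : ι × Edge M := y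
      simp only [g, Prod.mk.injEq, List.cons.injEq, true_and] at hxy
      obtain ⟨rfl, rfl, rfl⟩ := hxy
      rfl
    · simp [g] at hxy
    · simp [g] at hxy
    · simp only [g, Prod.mk.injEq, and_true] at hxy
      subst hxy
      rfl
  have h1 := iIndepFun_curry (X := fun b (j : κ b) => X (g b j).1 (g b j).2)
    (fun b j => hX.measurable _ _) (hX.indep.precomp hg)
  have h2 := h1.indepFun (i := true) (j := false) (by decide)
  exact h2.comp (φ := fun z : ι → 𝒜 => z)
    (ψ := fun (z : ι × Edge M → 𝒜) (k : ι) (e : Edge M) => z (k, e)) measurable_id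
    (measurable_pi_lambda _ fun k => measurable_pi_lambda _ fun e => measurable_pi_apply (k, e))

variable [Fintype 𝒜] [DiscreteMeasurableSpace 𝒜]

lemma IsLetterFamily.iIndepFun_branchSize [Finite ι] (hX : IsLetterFamily p X μ) (h : ℕ) :
    iIndepFun (fun (i : Fin M) ω => branchSize h (fun k => X k ([], i) ω)
      fun k e => X k (i :: e.1, e.2) ω) μ := by
  -- The edges read by branch `i`: `none` stands for its root edge, `some e` for the edge `e` of the
  -- subtree.
  let g : (i : Fin M) → (ι × Option (Edge M)) → ι × Edge M := fun i z => match z.2 with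
    | none => (z.1, ([], i))
    | some e => (z.1, (i :: e.1, e.2))
  have hg : Function.Injective fun q : (_ : Fin M) × (ι × Option (Edge M)) => g q.1 q.2 := by
    rintro ⟨i, k, _ | ⟨v, j⟩⟩ ⟨i', k', _ | ⟨v', j'⟩⟩ hxy
    · simp only [g, Prod.mk.injEq, true_and] at hxy
      obtain ⟨rfl, rfl⟩ := hxy
      rfl
    · simp [g] at hxy
    · simp [g] at hxy
    · simp only [g, Prod.mk.injEq, List.cons.injEq] at hxy
      obtain ⟨rfl, ⟨rfl, rfl⟩, rfl⟩ := hxy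
      rfl
  have h1 := iIndepFun_curry (X := fun i z => X (g i z).1 (g i z).2)
    (fun b j => hX.measurable _ _) (hX.indep.precomp hg)
  have h2 : Measurable fun (z : ι × Option (Edge M) → 𝒜) (k : ι) => z (k, none) :=
    measurable_pi_lambda _ fun k => measurable_pi_apply _
  have h3 : Measurable fun (z : ι × Option (Edge M) → 𝒜) (k : ι) (e : Edge M) => z (k, some e) :=
    measurable_pi_lambda _ fun k => measurable_pi_lambda _ fun e => measurable_pi_apply _
  have h4 := (measurable_uncurry_branchSize (M := M) (ι := ι) (𝒜 := 𝒜) h).comp (h2.prodMk h3)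
  have h5 := h1.comp (fun _ => _) fun _ => h4
  exact h5

lemma IsLetterFamily.iIndepFun_truncSize [Finite ι] (hX : IsLetterFamily p X μ) (h : ℕ)
    (l : ι → 𝒜) :
    iIndepFun (fun (a : 𝒜) ω => truncSize h fun (k : {k // l k = a}) e => X k e ω) μ := by
  have hg : Function.Injective fun q : (a : 𝒜) × ({k // l k = a} × Edge M) =>
      ((q.2.1 : ι), q.2.2) := by
    rintro ⟨a, ⟨k, rfl⟩, e⟩ ⟨b, ⟨k', rfl⟩, e'⟩ hxy
    simp only [Prod.mk.injEq] at hxy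
    obtain ⟨rfl, rfl⟩ := hxy
    rfl
  have h1 := iIndepFun_curry (X := fun (a : 𝒜) (z : {k // l k = a} × Edge M) => X z.1 z.2)
    (fun b j => hX.measurable _ _) (hX.indep.precomp hg)
  refine h1.comp (fun a (z : {k // l k = a} × Edge M → 𝒜) => truncSize h fun k e => z (k, e))
    fun a => (measurable_truncSize h).comp ?_
  exact measurable_pi_lambda _ fun k => measurable_pi_lambda _ fun e => measurable_pi_apply _

end Model


/-! ### The truncated size follows the recursions -/

section SizeLaw

variable {M : ℕ} {𝒜 : Type*} [Fintype 𝒜] [DecidableEq 𝒜] {p : 𝒜 → ℝ} {Ω : Type*}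
  [MeasurableSpace Ω] {μ : Measure Ω}

/-- The random variable `S` has the mean, the variance and the characteristic function of the
number of nodes at depth `< h` of the G-trie built from `n` random labelings. -/
structure HasSizeLaw (p : 𝒜 → ℝ) (M h n : ℕ) (S : Ω → ℕ) (μ : Measure Ω) : Prop where
  mean : ∫ ω, (S ω : ℝ) ∂μ = meanSize p M h n
  var : variance (fun ω => (S ω : ℝ)) μ = varSize p M h n
  char : ∀ t, ∫ ω, expI (t * S ω) ∂μ = charSize p M h n t

variable [MeasurableSpace 𝒜] [DiscreteMeasurableSpace 𝒜] {ι : Type*}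

omit [DecidableEq 𝒜] [MeasurableSpace 𝒜] [DiscreteMeasurableSpace 𝒜] in
lemma branchSize_le (h : ℕ) (l : ι → 𝒜) (L : ι → Labeling M 𝒜) :
    branchSize h l L ≤ Fintype.card 𝒜 * {w : List (Fin M × 𝒜) | w.length < h}.ncard := by
  refine (Finset.sum_le_sum fun a _ => truncSize_le h _).trans ?_
  rw [Finset.sum_const, Finset.card_univ, smul_eq_mul]

variable [IsProbabilityMeasure μ] {X : ι → Edge M → Ω → 𝒜}

omit [Fintype 𝒜] [DecidableEq 𝒜] [DiscreteMeasurableSpace 𝒜] [IsProbabilityMeasure μ] in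
lemma IsLetterFamily.measurable_labelings (hX : IsLetterFamily p X μ) :
    Measurable fun ω k e => X k e ω :=
  measurable_pi_lambda _ fun k => measurable_pi_lambda _ fun e => hX.measurable k e

/-- Moments of the size of a branch given the letters on the edges at the root. -/
lemma branchSize_moments_of_letters [Finite ι] (hX : IsLetterFamily p X μ) (h : ℕ) (l : ι → 𝒜)
    (ih : ∀ (a : 𝒜), HasSizeLaw p M h (Nat.card {k // l k = a})
      (fun ω => truncSize h fun (k : {k // l k = a}) e => X k e ω) μ) :
    ∫ ω, (branchSize h l (fun k e => X k e ω) : ℝ) ∂μ =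
        levelMean p M h (fun a => Nat.card {k // l k = a}) ∧
      (∀ m : ℝ, ∫ ω, ((branchSize h l (fun k e => X k e ω) : ℝ) - m) ^ 2 ∂μ =
        levelVar p M h (fun a => Nat.card {k // l k = a}) +
          (levelMean p M h (fun a => Nat.card {k // l k = a}) - m) ^ 2) ∧
      ∀ t : ℝ, ∫ ω, expI (t * branchSize h l (fun k e => X k e ω)) ∂μ =
        ∏ a, charSize p M h (Nat.card {k // l k = a}) t := by
  set T : 𝒜 → Ω → ℕ := fun a ω => truncSize h fun (k : {k // l k = a}) e => X k e ω with hT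
  have hb : ∀ ω, branchSize h l (fun k e => X k e ω) = ∑ a, T a ω := fun ω => rfl
  have mT : ∀ a, Measurable (T a) := fun a => by
    have := (measurable_truncSize h).comp (hX.restrict fun k => l k = a).measurable_labelings
    exact this
  have iT : iIndepFun T μ := hX.iIndepFun_truncSize h l
  have bT : ∀ a ω, T a ω ≤ {w : List (Fin M × 𝒜) | w.length < h}.ncard :=
    fun a ω => truncSize_le h _
  have mS : Measurable fun ω => branchSize h l (fun k e => X k e ω) := by
    have := (measurable_branchSize h l).comp hX.measurable_labelings
    exact this
  have hmean : ∫ ω, (branchSize h l (fun k e => X k e ω) : ℝ) ∂μ =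
      levelMean p M h (fun a => Nat.card {k // l k = a}) := by
    simp only [hb]
    rw [integral_natCast_sum mT bT, levelMean]
    exact Finset.sum_congr rfl fun a _ => (ih a).mean
  refine ⟨hmean, fun m => ?_, fun t => ?_⟩
  · have hvar : variance (fun ω => (branchSize h l (fun k e => X k e ω) : ℝ)) μ =
        levelVar p M h (fun a => Nat.card {k // l k = a}) := by
      simp only [hb]
      rw [variance_natCast_sum iT mT bT, levelVar]
      exact Finset.sum_congr rfl fun a _ => (ih a).var
    have hL := memLp_natCast (μ := μ) mS fun ω => branchSize_le h l _
    rw [← hvar, ← hmean]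
    exact integral_sub_sq_eq hL m
  · simp only [hb]
    rw [integral_expI_sum iT mT]
    exact Finset.prod_congr rfl fun a _ => (ih a).char t

omit [Fintype 𝒜] [DecidableEq 𝒜] [IsProbabilityMeasure μ] in
lemma IsLetterFamily.real_root_eq [Fintype ι] (hX : IsLetterFamily p X μ) (i : Fin M)
    (l : ι → 𝒜) : μ.real {ω | (fun k => X k ([], i) ω) = l} = ∏ k, p (l k) := by
  have h1 : iIndepFun (fun k => X k ([], i)) μ :=
    hX.indep.precomp (g := fun k : ι => (k, (([], i) : Edge M))) fun k k' hk => by simpa using hk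
  have e : {ω | (fun k => X k ([], i) ω) = l} = ⋂ k, {ω | X k ([], i) ω = l k} := by
    ext ω
    simp [funext_iff]
  have h2 := h1.meas_iInter (s := fun k => {ω | X k ([], i) ω = l k})
    fun k => ⟨{l k}, measurableSet_singleton _, rfl⟩
  rw [e, measureReal_def, h2, ENNReal.toReal_prod]
  exact Finset.prod_congr rfl fun k _ => hX.law k _ _

/-- Condition on the root letters, which are independent of the subtrees. The conditional
expectation depends only on the letter counts, and these are multinomial. -/
lemma integral_root_eq_multi {E : Type*} [NormedAddCommGroup E] [NormedSpace ℝ E]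
    [MeasurableSpace E] [BorelSpace E] [SecondCountableTopology E] [Finite ι]
    (hX : IsLetterFamily p X μ) (h : ℕ) (i : Fin M) {φ : ℕ → E} {G : (𝒜 → ℕ) → E}
    (hG : ∀ l : ι → 𝒜, ∫ ω, φ (branchSize h l (fun k e => X k (i :: e.1, e.2) ω)) ∂μ =
      G (fun a => Nat.card {k // l k = a})) :
    ∫ ω, φ (branchSize h (fun k => X k ([], i) ω) (fun k e => X k (i :: e.1, e.2) ω)) ∂μ =
      multi p (Nat.card ι) G := by
  classical
  have := Fintype.ofFinite ι
  have mφ : Measurable φ := measurable_from_nat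
  have mL := (hX.sub i).measurable_labelings
  have hbd : ∃ C, ∀ j ≤ Fintype.card 𝒜 * {w : List (Fin M × 𝒜) | w.length < h}.ncard,
      ‖φ j‖ ≤ C := by
    refine ⟨∑ j ∈ Finset.range (Fintype.card 𝒜 * {w : List (Fin M × 𝒜) | w.length < h}.ncard + 1),
      ‖φ j‖, fun j hj => ?_⟩
    exact Finset.single_le_sum (f := fun j => ‖φ j‖) (fun _ _ => norm_nonneg _)
      (Finset.mem_range.2 (by omega))
  obtain ⟨C, hC⟩ := hbd
  rw [integral_eq_sum_of_indepFun (F := fun l L => φ (branchSize h l L))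
    (hX.indepFun_root_sub i) (measurable_pi_lambda _ fun k => hX.measurable _ _) mL
    (fun l => (mφ.comp (measurable_branchSize h l)).stronglyMeasurable) fun l => ?_]
  · rw [← sum_prod_smul]
    refine Finset.sum_congr rfl fun l _ => ?_
    rw [hX.real_root_eq, hG]
  · refine Integrable.of_bound
      ((mφ.comp (measurable_branchSize h l)).comp mL).aestronglyMeasurable C (ae_of_all _ fun ω => ?_)
    exact hC _ (branchSize_le h l _)

/-- The law of the number of nodes of bounded depth. -/
theorem hasSizeLaw_truncSize [Finite ι] (hX : IsLetterFamily p X μ) (h : ℕ) :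
    HasSizeLaw p M h (Nat.card ι) (fun ω => truncSize h fun k e => X k e ω) μ := by
  induction h generalizing ι with
  | zero =>
    simp only [truncSize_zero]
    refine ⟨by simp [meanSize], by simp [varSize, variance_eq_integral], fun t => ?_⟩
    simp [charSize, expI_zero]
  | succ h ih =>
    set R : Fin M → Ω → ℕ := fun i ω => branchSize h (fun k => X k ([], i) ω)
      fun k e => X k (i :: e.1, e.2) ω with hR
    set n := Nat.card ι with hn
    have hS : ∀ ω, truncSize (h + 1) (fun k e => X k e ω) =
        (if 2 ≤ n then 1 else 0) + ∑ i, R i ω := fun ω => truncSize_succ h _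
    have mR : ∀ i, Measurable (R i) := fun i => by
      have h1 : Measurable fun ω k => X k ([], i) ω :=
        measurable_pi_lambda _ fun k => hX.measurable _ _
      have := (measurable_uncurry_branchSize h).comp
        (h1.prodMk (hX.sub i).measurable_labelings)
      exact this
    have iR : iIndepFun R μ := hX.iIndepFun_branchSize h
    have bR : ∀ i ω, R i ω ≤ Fintype.card 𝒜 * {w : List (Fin M × 𝒜) | w.length < h}.ncard :=
      fun i ω => branchSize_le h _ _
    have key := fun (i : Fin M) (l : ι → 𝒜) => branchSize_moments_of_letters (hX.sub i) h l
      fun a => ih ((hX.sub i).restrict fun k => l k = a)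
    have hmean : ∀ i, ∫ ω, (R i ω : ℝ) ∂μ = multi p n (levelMean p M h) := fun i =>
      integral_root_eq_multi hX h i (φ := fun j => (j : ℝ)) fun l => (key i l).1
    -- Law of total variance: the conditional second moments are taken about the unconditional mean,
    -- and averaging them gives the mean conditional variance plus the variance of the conditional
    -- mean.
    have hvar : ∀ i, variance (fun ω => (R i ω : ℝ)) μ =
        multi p n (levelVar p M h) + multiVar p n (levelMean p M h) := fun i => by
      rw [variance_eq_integral (X := fun ω => (R i ω : ℝ))
        (measurable_from_nat.comp (mR i)).aemeasurable, hmean, multiVar,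
        ← multi_add]
      exact integral_root_eq_multi hX h i
        (φ := fun j => ((j : ℝ) - multi p n (levelMean p M h)) ^ 2) fun l => (key i l).2.1 _
    have hchar : ∀ i t, ∫ ω, expI (t * R i ω) ∂μ =
        multi p n (fun c => ∏ a, charSize p M h (c a) t) := fun i t =>
      integral_root_eq_multi hX h i (φ := fun j => expI (t * j)) fun l => (key i l).2.2 t
    have mSum : Measurable fun ω => ∑ i, R i ω := Finset.measurable_sum _ fun i _ => mR i
    have bSum : ∀ ω, ∑ i, R i ω ≤
        ∑ _i : Fin M, Fintype.card 𝒜 * {w : List (Fin M × 𝒜) | w.length < h}.ncard :=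
      fun ω => Finset.sum_le_sum fun i _ => bR i ω
    have hL := memLp_natCast (μ := μ) mSum bSum
    refine ⟨?_, ?_, fun t => ?_⟩
    · simp only [hS, Nat.cast_add]
      rw [integral_add (integrable_const _) (hL.integrable one_le_two), integral_const,
        integral_natCast_sum mR bR]
      simp only [hmean, Finset.sum_const, Finset.card_univ, Fintype.card_fin, nsmul_eq_mul,
        probReal_univ, one_smul, meanSize]
      unfold levelMean
      push_cast
      rfl
    · simp only [hS, Nat.cast_add]
      rw [variance_const_add hL.aestronglyMeasurable, variance_natCast_sum iR mR bR]
      simp only [hvar, Finset.sum_const, Finset.card_univ, Fintype.card_fin, nsmul_eq_mul, varSize]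
      rfl
    · simp only [hS, Nat.cast_add, mul_add, expI_add]
      rw [integral_const_mul, integral_expI_sum iR mR]
      simp only [hchar, Finset.prod_const, Finset.card_univ, Fintype.card_fin, charSize]
      push_cast
      rfl

end SizeLaw


/-! ### From truncated to full node sets -/

section Nodes

variable {M n : ℕ} {𝒜 : Type*} [Fintype 𝒜] (L : Fin n → Labeling M 𝒜)

lemma truncSize_mono {h h' : ℕ} (hh : h ≤ h') : truncSize h L ≤ truncSize h' L :=
  Set.ncard_le_ncard (fun _ hw => ⟨hw.1.trans_le hh, hw.2⟩) (finite_truncNodes h' L)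

/-- If there were infinitely many nodes, `B + 1` of them would already lie below some finite depth.
-/
lemma finite_nodes_of_truncSize_le {B : ℕ} (hB : ∀ h, truncSize h L ≤ B) : (nodes L).Finite := by
  by_contra hinf
  obtain ⟨t, ht, hcard⟩ := Set.Infinite.exists_subset_card_eq hinf (B + 1)
  have h1 : (t : Set (List (Fin M × 𝒜))) ⊆ truncNodes (t.sup List.length + 1) L := fun w hw =>
    ⟨Nat.lt_succ_of_le (Finset.le_sup (f := List.length) hw), ht hw⟩
  have h2 := Set.ncard_le_ncard h1 (finite_truncNodes _ L)
  rw [Set.ncard_coe_finset, hcard] at h2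
  exact absurd (h2.trans (hB _)) (by omega)

omit [Fintype 𝒜] in
lemma truncSize_eventually_eq (hfin : (nodes L).Finite) :
    ∀ᶠ h in atTop, truncSize h L = size L := by
  filter_upwards [eventually_ge_atTop (hfin.toFinset.sup List.length + 1)] with h hh
  have : truncNodes h L = nodes L := by
    ext w
    refine ⟨fun hw => hw.2, fun hw => ⟨?_, hw⟩⟩
    have := Finset.le_sup (f := List.length) (hfin.mem_toFinset.2 hw)
    omega
  rw [truncSize, this, size]

lemma truncSize_le_size (hfin : (nodes L).Finite) (h : ℕ) : truncSize h L ≤ size L := by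
  obtain ⟨k, hk, hk'⟩ := ((truncSize_eventually_eq L hfin).and (eventually_ge_atTop h)).exists
  exact (truncSize_mono L hk').trans hk.le

end Nodes

/-! ### Removing the truncation -/

section Limit

open scoped Topology ENNReal

variable {M n : ℕ} {𝒜 : Type*} [Fintype 𝒜] [DecidableEq 𝒜] [MeasurableSpace 𝒜]
  [DiscreteMeasurableSpace 𝒜] {p : 𝒜 → ℝ} {Ω : Type*} [MeasurableSpace Ω] {μ : Measure Ω}
  [IsProbabilityMeasure μ] {X : Fin n → Edge M → Ω → 𝒜}

omit [Fintype 𝒜] [DecidableEq 𝒜] [DiscreteMeasurableSpace 𝒜] [IsProbabilityMeasure μ] in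
lemma IsRandomLabelings.isLetterFamily (hX : IsRandomLabelings p X μ) : IsLetterFamily p X μ :=
  ⟨hX.measurable, hX.indep, hX.law⟩

omit [DecidableEq 𝒜] [IsProbabilityMeasure μ] in
lemma measurable_truncSize_labelings (hX : IsRandomLabelings p X μ) (h : ℕ) :
    Measurable fun ω => truncSize h fun k e => X k e ω := by
  have := (measurable_truncSize h).comp hX.isLetterFamily.measurable_labelings
  exact this

lemma hasSizeLaw_truncSize_labelings (hX : IsRandomLabelings p X μ) (h : ℕ) :
    HasSizeLaw p M h n (fun ω => truncSize h fun k e => X k e ω) μ := by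
  have := hasSizeLaw_truncSize hX.isLetterFamily h
  rwa [Nat.card_fin] at this

omit [DecidableEq 𝒜] in
lemma memLp_truncSize_labelings (hX : IsRandomLabelings p X μ) (h : ℕ) :
    MemLp (fun ω => (truncSize h (fun k e => X k e ω) : ℝ)) 2 μ :=
  memLp_natCast (measurable_truncSize_labelings hX h) fun _ => truncSize_le h _

/-- Monotone convergence and second moments bounded uniformly in the height. This yields both almost
sure finiteness and, through the limit, a square-integrable dominating function. -/
lemma lintegral_iSup_truncSize_sq_lt_top (hp : NonExplosive p M) (hX : IsRandomLabelings p X μ) :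
    ∫⁻ ω, ⨆ h, ENNReal.ofReal ((truncSize h (fun k e => X k e ω) : ℝ) ^ 2) ∂μ < ∞ := by
  obtain ⟨C, hC⟩ := exists_second_moment_le hp n
  rw [lintegral_iSup]
  · refine (iSup_le fun h => ?_).trans_lt (ENNReal.ofReal_lt_top (r := C))
    have hL := memLp_truncSize_labelings hX h
    have hlaw := hasSizeLaw_truncSize_labelings hX h
    rw [← ofReal_integral_eq_lintegral_ofReal hL.integrable_sq (ae_of_all _ fun ω => sq_nonneg _)]
    refine ENNReal.ofReal_le_ofReal ((le_of_eq ?_).trans (hC h))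
    have := variance_eq_sub hL
    rw [hlaw.var] at this
    simp only [Pi.pow_apply] at this
    rw [hlaw.mean] at this
    linarith
  · intro h
    have : Measurable fun ω => (truncSize h (fun k e => X k e ω) : ℝ) :=
      measurable_from_nat.comp (measurable_truncSize_labelings hX h)
    exact (this.pow_const 2).ennreal_ofReal
  · intro h h' hh ω
    refine ENNReal.ofReal_le_ofReal (pow_le_pow_left₀ (Nat.cast_nonneg _) ?_ 2)
    exact_mod_cast truncSize_mono _ hh

lemma ae_finite_nodes (hp : NonExplosive p M) (hX : IsRandomLabelings p X μ) :
    ∀ᵐ ω ∂μ, (nodes fun k e => X k e ω).Finite := by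
  have hm : Measurable fun ω => ⨆ h, ENNReal.ofReal ((truncSize h (fun k e => X k e ω) : ℝ) ^ 2) := by
    refine Measurable.iSup fun h => ?_
    have : Measurable fun ω => (truncSize h (fun k e => X k e ω) : ℝ) :=
      measurable_from_nat.comp (measurable_truncSize_labelings hX h)
    exact (this.pow_const 2).ennreal_ofReal
  filter_upwards [ae_lt_top hm (lintegral_iSup_truncSize_sq_lt_top hp hX).ne] with ω hω
  obtain ⟨B, hB⟩ := ENNReal.exists_nat_gt hω.ne
  refine finite_nodes_of_truncSize_le _ (B := B) fun h => ?_
  have h1 : ENNReal.ofReal ((truncSize h (fun k e => X k e ω) : ℝ) ^ 2) ≤ B :=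
    (le_iSup (fun h => ENNReal.ofReal ((truncSize h (fun k e => X k e ω) : ℝ) ^ 2)) h).trans hB.le
  rw [← ENNReal.ofReal_natCast, ENNReal.ofReal_le_ofReal_iff (Nat.cast_nonneg _)] at h1
  have h2 : truncSize h (fun k e => X k e ω) ^ 2 ≤ B := by exact_mod_cast h1
  exact (Nat.le_self_pow two_ne_zero _).trans h2

lemma ae_eventually_eq_randomSize (hp : NonExplosive p M) (hX : IsRandomLabelings p X μ) :
    ∀ᵐ ω ∂μ, ∀ᶠ h in atTop, (truncSize h (fun k e => X k e ω) : ℝ) = randomSize X ω := by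
  filter_upwards [ae_finite_nodes hp hX] with ω hω
  filter_upwards [truncSize_eventually_eq _ hω] with h hh
  rw [hh, randomSize]

lemma ae_truncSize_le_randomSize (hp : NonExplosive p M) (hX : IsRandomLabelings p X μ) (h : ℕ) :
    ∀ᵐ ω ∂μ, (truncSize h (fun k e => X k e ω) : ℝ) ≤ randomSize X ω := by
  filter_upwards [ae_finite_nodes hp hX] with ω hω
  rw [randomSize]
  exact_mod_cast truncSize_le_size _ hω h

lemma memLp_randomSize (hp : NonExplosive p M) (hX : IsRandomLabelings p X μ) :
    MemLp (randomSize X) 2 μ := by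
  have hm : AEStronglyMeasurable (randomSize X) μ :=
    aestronglyMeasurable_of_tendsto_ae atTop
      (fun h => (memLp_truncSize_labelings hX h).aestronglyMeasurable) (by
        filter_upwards [ae_eventually_eq_randomSize hp hX] with ω hω
        exact tendsto_const_nhds.congr' (hω.mono fun _ => Eq.symm))
  rw [memLp_two_iff_integrable_sq hm]
  refine ⟨hm.pow 2, lt_of_le_of_lt (lintegral_mono_ae ?_) (lintegral_iSup_truncSize_sq_lt_top hp hX)⟩
  filter_upwards [ae_eventually_eq_randomSize hp hX] with ω hω
  obtain ⟨h, hh⟩ := hω.exists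
  rw [← hh, Real.enorm_eq_ofReal (sq_nonneg _)]
  exact le_iSup (fun h => ENNReal.ofReal ((truncSize h (fun k e => X k e ω) : ℝ) ^ 2)) h

lemma tendsto_meanSize (hp : NonExplosive p M) (hX : IsRandomLabelings p X μ) :
    Tendsto (fun h => meanSize p M h n) atTop (𝓝 (∫ ω, randomSize X ω ∂μ)) := by
  simp only [← (hasSizeLaw_truncSize_labelings hX _).mean]
  refine tendsto_integral_of_dominated_convergence (randomSize X)
    (fun h => (memLp_truncSize_labelings hX h).aestronglyMeasurable)
    ((memLp_randomSize hp hX).integrable one_le_two) (fun h => ?_) ?_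
  · filter_upwards [ae_truncSize_le_randomSize hp hX h] with ω hω
    rwa [Real.norm_natCast]
  · filter_upwards [ae_eventually_eq_randomSize hp hX] with ω hω
    exact tendsto_const_nhds.congr' (hω.mono fun _ => Eq.symm)

lemma tendsto_varSize (hp : NonExplosive p M) (hX : IsRandomLabelings p X μ) :
    Tendsto (fun h => varSize p M h n) atTop (𝓝 (variance (randomSize X) μ)) := by
  rw [variance_eq_sub (memLp_randomSize hp hX)]
  have e : ∀ h, varSize p M h n = ∫ ω, (truncSize h (fun k e => X k e ω) : ℝ) ^ 2 ∂μ
      - meanSize p M h n ^ 2 := fun h => by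
    have hlaw := hasSizeLaw_truncSize_labelings hX h
    rw [← hlaw.var, ← hlaw.mean, variance_eq_sub (memLp_truncSize_labelings hX h)]
    rfl
  simp only [e]
  refine Tendsto.sub ?_ ((tendsto_meanSize hp hX).pow 2)
  refine tendsto_integral_of_dominated_convergence (fun ω => randomSize X ω ^ 2)
    (fun h => (memLp_truncSize_labelings hX h).aestronglyMeasurable.pow 2)
    (memLp_randomSize hp hX).integrable_sq (fun h => ?_) ?_
  · filter_upwards [ae_truncSize_le_randomSize hp hX h] with ω hω
    rw [Real.norm_of_nonneg (sq_nonneg _)]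
    exact pow_le_pow_left₀ (Nat.cast_nonneg _) hω 2
  · filter_upwards [ae_eventually_eq_randomSize hp hX] with ω hω
    exact tendsto_const_nhds.congr' (hω.mono fun h hh => by simp only [hh, Pi.pow_apply])

lemma tendsto_charSize (hp : NonExplosive p M) (hX : IsRandomLabelings p X μ) (t : ℝ) :
    Tendsto (fun h => charSize p M h n t) atTop (𝓝 (∫ ω, expI (t * randomSize X ω) ∂μ)) := by
  simp only [← (hasSizeLaw_truncSize_labelings hX _).char]
  refine tendsto_integral_of_dominated_convergence (fun _ => 1)
    (fun h => (measurable_expI_natCast (measurable_truncSize_labelings hX h) t).aestronglyMeasurable)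
    (integrable_const _) (fun h => ae_of_all _ fun ω => (norm_expI _).le) ?_
  filter_upwards [ae_eventually_eq_randomSize hp hX] with ω hω
  exact tendsto_const_nhds.congr' (hω.mono fun h hh => by simp only [hh])

lemma tendsto_gaussDist (hp : NonExplosive p M) (hX : IsRandomLabelings p X μ) (t : ℝ) :
    Tendsto (fun h => gaussDist p M h n t) atTop (𝓝
      ‖expI (-(t * ∫ ω, randomSize X ω ∂μ)) * ∫ ω, expI (t * randomSize X ω) ∂μ
        - (Real.exp (-(t ^ 2 / 2 * variance (randomSize X) μ)) : ℝ)‖) := by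
  have hc : Continuous expI := by unfold expI; fun_prop
  refine Tendsto.norm (Tendsto.sub (Tendsto.mul ?_ (tendsto_charSize hp hX t)) ?_)
  · exact (hc.tendsto _).comp ((tendsto_meanSize hp hX).const_mul t).neg
  · have h1 : Continuous fun y : ℝ => ((Real.exp (-(t ^ 2 / 2 * y)) : ℝ) : ℂ) := by fun_prop
    exact (h1.tendsto _).comp (tendsto_varSize hp hX)

end Limit

/-! ### The central limit theorem -/

section CentralLimit

open scoped Topology

/-- With a variance of order at least `n ^ α`, the standardized frequency is `O(n ^ (-α / 2))`, so
its power `b` beats `n ^ x` as soon as `x < α * b / 2`. -/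
lemma tendsto_div_sqrt_rpow_mul {α x b c : ℝ} (hb : 0 < b) (hx : x < α * (b / 2)) (hc : 0 < c)
    {v : ℕ → ℝ} (hv : ∀ n : ℕ, 2 ≤ n → c * (n : ℝ) ^ α ≤ v n) (u : ℝ) :
    Tendsto (fun n : ℕ => |u / √(v n)| ^ b * (n : ℝ) ^ x) atTop (𝓝 0) := by
  have h1 : Tendsto (fun n : ℕ => (|u| / √c) ^ b * (n : ℝ) ^ (-(α * (b / 2) - x))) atTop (𝓝 0) := by
    have := ((tendsto_rpow_neg_atTop (sub_pos.2 hx)).comp tendsto_natCast_atTop_atTop).const_mul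
      ((|u| / √c) ^ b)
    rwa [mul_zero] at this
  refine squeeze_zero' (Eventually.of_forall fun n => by positivity) ?_ h1
  filter_upwards [eventually_ge_atTop 2] with n hn
  have hn0 : (0 : ℝ) < n := by exact_mod_cast (by omega : 0 < n)
  have h2 : |u / √(v n)| ≤ |u| / √c * (n : ℝ) ^ (-(α / 2)) := by
    rw [abs_div, abs_of_nonneg (Real.sqrt_nonneg _)]
    calc |u| / √(v n) ≤ |u| / √(c * (n : ℝ) ^ α) := by
          gcongr
          exact hv n hn
      _ = |u| / √c * (n : ℝ) ^ (-(α / 2)) := by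
          rw [Real.sqrt_mul hc.le, Real.sqrt_eq_rpow ((n : ℝ) ^ α), ← Real.rpow_mul hn0.le,
            Real.rpow_neg hn0.le, ← div_div, div_eq_mul_inv (|u| / √c)]
          congr 3
          ring
  calc |u / √(v n)| ^ b * (n : ℝ) ^ x ≤ (|u| / √c * (n : ℝ) ^ (-(α / 2))) ^ b * (n : ℝ) ^ x := by
        gcongr
    _ = _ := by
        rw [Real.mul_rpow (by positivity) (by positivity), ← Real.rpow_mul hn0.le, mul_assoc,
          ← Real.rpow_add hn0]
        congr 2
        ring

lemma charFun_map_standardized {Ω : Type*} [MeasurableSpace Ω] {μ : Measure Ω} {f : Ω → ℝ}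
    (hf : AEMeasurable f μ) (m r u : ℝ) :
    charFun (μ.map fun ω => (f ω - m) / r) u =
      expI (-(u / r * m)) * ∫ ω, expI (u / r * f ω) ∂μ := by
  rw [charFun_apply_real, integral_map ((hf.sub_const m).div_const r) (by fun_prop),
    ← integral_const_mul]
  congr 1
  funext ω
  rw [← expI_add, expI]
  congr 1
  push_cast
  ring

/-- The central limit theorem for the size of the G-trie. -/
theorem tendstoInDistribution_randomSize {M : ℕ} {𝒜 : Type*} [Fintype 𝒜] [DecidableEq 𝒜]
    [MeasurableSpace 𝒜] [DiscreteMeasurableSpace 𝒜] {p : 𝒜 → ℝ} (hp : NonExplosive p M)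
    {Ω : ℕ → Type*} [∀ n, MeasurableSpace (Ω n)] (μ : (n : ℕ) → Measure (Ω n))
    [∀ n, IsProbabilityMeasure (μ n)] {X : (n : ℕ) → Fin n → Edge M → Ω n → 𝒜}
    (hX : ∀ n, IsRandomLabelings p (X n) (μ n)) :
    (∀ n, 2 ≤ n → 0 < variance (randomSize (X n)) (μ n)) ∧
    TendstoInDistribution
      (fun n ω => (randomSize (X n) ω - ∫ ω', randomSize (X n) ω' ∂(μ n)) /
        √(variance (randomSize (X n)) (μ n)))
      atTop (id : ℝ → ℝ) μ (gaussianReal 0 1) := by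
  obtain ⟨C, c, θ, α, x, z, hC, hc, hθ, hα, hx, hz, H, Hv⟩ := exists_gaussDist_le hp
  set v : ℕ → ℝ := fun n => variance (randomSize (X n)) (μ n) with hv
  have hvar : ∀ n : ℕ, 2 ≤ n → c * (n : ℝ) ^ α ≤ v n := fun n hn => by
    obtain ⟨h₀, hh₀⟩ := Hv n hn
    exact ge_of_tendsto (tendsto_varSize hp (hX n)) (eventually_atTop.2 ⟨h₀, hh₀⟩)
  have hpos : ∀ n, 2 ≤ n → 0 < v n := fun n hn => by
    have hn0 : (0 : ℝ) < n := by exact_mod_cast (by omega : 0 < n)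
    exact lt_of_lt_of_le (by positivity) (hvar n hn)
  have hm : ∀ n, AEMeasurable (randomSize (X n)) (μ n) := fun n =>
    (memLp_randomSize hp (hX n)).aestronglyMeasurable.aemeasurable
  refine ⟨hpos, ⟨fun n => ((hm n).sub_const _).div_const _, aemeasurable_id, ?_⟩⟩
  refine ProbabilityMeasure.tendsto_iff_tendsto_charFun.2 fun u => ?_
  simp only [ProbabilityMeasure.coe_mk, Measure.map_id]
  rw [charFun_gaussianReal, tendsto_iff_norm_sub_tendsto_zero]
  -- The case `b = 1`, `x = 0`: the frequency tends to zero, so the condition `|t| ≤ 1` of the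
  -- Gaussian comparison holds eventually.
  have h0 : Tendsto (fun n => |u / √(v n)| ^ (1 : ℝ) * (n : ℝ) ^ (0 : ℝ)) atTop (𝓝 0) :=
    tendsto_div_sqrt_rpow_mul one_pos (by positivity) hc hvar u
  simp only [Real.rpow_one, Real.rpow_zero, mul_one] at h0
  have h1 := tendsto_div_sqrt_rpow_mul (α := α) (x := x) (b := 2 + θ) (by linarith)
    (by linarith [show α * ((2 + θ) / 2) = α * (1 + θ / 2) by ring]) hc hvar u
  have h2 := tendsto_div_sqrt_rpow_mul (b := 3) (x := z) (by norm_num) (by linarith) hc hvar u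
  have h3 := (h1.add h2).const_mul C
  rw [add_zero, mul_zero] at h3
  refine squeeze_zero' (Eventually.of_forall fun n => norm_nonneg _) ?_ h3
  filter_upwards [h0.eventually (ge_mem_nhds one_pos), eventually_ge_atTop 2] with n hn1 hn2
  -- The bound is uniform in the height and survives the limit. At this frequency the Gaussian
  -- factor is `exp (-u ^ 2 / 2)`.
  have h4 := le_of_tendsto (tendsto_gaussDist hp (hX n) (u / √(v n)))
    (Eventually.of_forall fun h => H h n _ hn1)
  rw [charFun_map_standardized (hm n)]
  have e : (u / √(v n)) ^ 2 / 2 * v n = u ^ 2 / 2 := by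
    rw [div_pow, Real.sq_sqrt (hpos n hn2).le]
    have := (hpos n hn2).ne'
    field_simp
  rw [show variance (randomSize (X n)) (μ n) = v n from rfl, e] at h4
  refine (le_of_eq ?_).trans (h4.trans (le_of_eq ?_))
  · congr 2
    push_cast
    congr 1
    simp
  · norm_cast

end CentralLimit

end GTrie

theorem theorem1 {𝒜 : Type*} [Fintype 𝒜] [MeasurableSpace 𝒜] [DiscreteMeasurableSpace 𝒜]
    (M : ℕ) (hM : 1 ≤ M)
    (p : 𝒜 → ℝ) (hp : ∀ a, 0 < p a ∧ p a < 1) (hp_sum : ∑ a, p a = 1)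
    (h_nonexplosive : ∑ a, p a ^ 2 < 1 / (M : ℝ))
    {Ω : ℕ → Type*} [∀ n, MeasurableSpace (Ω n)]
    (μ : (n : ℕ) → Measure (Ω n)) [∀ n, IsProbabilityMeasure (μ n)]
    (X : (n : ℕ) → Fin n → GTrie.Edge M → Ω n → 𝒜)
    (hX : ∀ n, GTrie.IsRandomLabelings p (X n) (μ n)) :
    (∀ n, (∀ᵐ ω ∂(μ n), (GTrie.nodes fun k e => X n k e ω).Finite) ∧
      MemLp (GTrie.randomSize (X n)) 2 (μ n)) ∧
    (∀ n, 2 ≤ n → 0 < variance (GTrie.randomSize (X n)) (μ n)) ∧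
    TendstoInDistribution
      (fun n ω => (GTrie.randomSize (X n) ω - ∫ ω', GTrie.randomSize (X n) ω' ∂(μ n)) /
        √(variance (GTrie.randomSize (X n)) (μ n)))
      atTop (id : ℝ → ℝ) μ (gaussianReal 0 1) := by
  classical
  have hM0 : (0 : ℝ) < M := by exact_mod_cast hM
  have hp' : GTrie.NonExplosive p M :=
    { pos := fun a => (hp a).1
      lt_one := fun a => (hp a).2
      sum_eq := hp_sum
      one_le := hM
      sum_sq_lt := by rwa [lt_div_iff₀ hM0, mul_comm] at h_nonexplosive }
  exact ⟨fun n => ⟨GTrie.ae_finite_nodes hp' (hX n), GTrie.memLp_randomSize hp' (hX n)⟩,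
    GTrie.tendstoInDistribution_randomSize hp' μ hX⟩
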